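/- Let $(M,F)$ be a connected $n$-dimensional Finsler manifold: $M$ is a smooth manifold and $F:TM\to\mathbb R$ is continuous at the zero vectors, $C^\infty$ on $\{y\neq 0\}$, satisfies $F(x,y)>0$ for $y\ne 0$ and $F(x,\lambda y)=|\lambda|F(x,y)$ for all $\lambda\in\mathbb R$, and has positive definite fundamental tensor $g_{ij}(x,y)=\frac12\frac{\partial^2F^2}{\partial y^i\partial y^j}$ for $y\neq 0$. Fix $x_0,x_1\in M$ (not necessarily distinct) and let $\Omega$ be the set of piecewise $C^\infty$ regular curves $c:[0,1]\to M$ with $c(0)=x_0$, $c(1)=x_1$ (regular: all velocities, including the one-sided ones at break points and end points, are nonzero). For $p\in\mathbb R\setminus\{0\}$ put $$E_p(c)=\int_0^1\big[g_{ij}(c(t),\dot c(t))\,\dot c^i(t)\,\dot c^j(t)\big]^{p/2}\,dt .$$ A curve $c\in\Omega$ is a critical point of $E_p$ if $\frac{d}{ds}E_p(c_s)\big|_{s=0}=0$ for every one-parameter variation $(c_s)_{|s|<\varepsilon}\subset\Omega$ of $c$, i.e. every family with $c_0=c$ such that $(s,t)\mapsto c_s(t)$ is continuous and is $C^\infty$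 on the strips $(-\varepsilon,\varepsilon)\times[t_{i-1},t_i]$ of some partition $0=t_0<\dots<t_k=1$. A geodesic is a $C^\infty$ regular curve $c:[0,1]\to M$ with $\frac{\nabla\dot c}{dt}=0$ on $[0,1]$, where, along $c$ and in local coordinates, $$\Big(\frac{\nabla X}{dt}\Big)^i=\frac{dX^i}{dt}+X^m\Big[L^i_{mk}\dot c^k+C^i_{mk}\big(\ddot c^k+N^k_l\dot c^l\big)\Big],$$ the coefficients $L^i_{mk},C^i_{mk},N^k_l$ of the Cartan connection of $F$ being evaluated at $(c,\dot c)$. Here $N^i_j=\frac12\frac{\partial}{\partial y^j}(\Gamma^i_{kl}y^ky^l)$, where $\Gamma^i_{jk}$, $L^i_{jk}$, $C^i_{jk}$ are all given by $\frac12 g^{im}(D_jg_{mk}+D_kg_{jm}-D_mg_{jk})$ with, respectively, $D_j=\frac{\partial}{\partial x^j}$, $D_j=\frac{\partial}{\partial x^j}-N^l_j\frac{\partial}{\partial y^l}$, $D_j=\frac{\partial}{\partial y^j}$. Let $p\neq0$ and $c\in\Omega$. (i) If $p\neq 1$, then $c$ is a critical point of $E_p$ if and only if $c$ is a geodesic.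 (ii) If $p=1$, then $c$ is a critical point of $E_1$ if and only if $c$ is a reparametrized geodesic, i.e. $c=\gamma\circ\varphi$ with a geodesic $\gamma:[0,1]\to M$ and a continuous $\varphi:[0,1]\to[0,1]$ with $\varphi(0)=0$, $\varphi(1)=1$ that is, on each interval of some partition of $[0,1]$, $C^\infty$ with positive derivative. -/

import Mathlib

open Set
open scoped Manifold ContDiff

noncomputable section

namespace FinslerEnergy

/-- The model space `ℝⁿ`. -/
abbrev Model (n : ℕ) : Type := EuclideanSpace ℝ (Fin n)

/-! ### Finsler manifolds -/

section Finsler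

variable {n : ℕ} {M : Type*} [TopologicalSpace M] [ChartedSpace (Model n) M]

/-- The fundamental tensor `g_y(u, v) = ½ D²(F(x, ·)²)(y)(u, v)` on the tangent space at `x`. -/
def fundamentalTensor (F : TangentBundle (𝓡 n) M → ℝ) (x : M) (y u v : TangentSpace (𝓡 n) x) : ℝ :=
  (1 / 2) * fderiv ℝ (fun z : TangentSpace (𝓡 n) x =>
    fderiv ℝ (fun w : TangentSpace (𝓡 n) x => F ⟨x, w⟩ ^ 2) z v) y u

end Finsler

/-- A (reversible) Finsler fundamental function `F : TM → ℝ` on an `n`-dimensional manifold. -/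
structure FinslerMetric (n : ℕ) (M : Type*) [TopologicalSpace M] [ChartedSpace (Model n) M]
    [IsManifold (𝓡 n) ∞ M] where
  toFun : TangentBundle (𝓡 n) M → ℝ
  pos : ∀ (x : M) (y : TangentSpace (𝓡 n) x), y ≠ 0 → 0 < toFun ⟨x, y⟩
  homogeneous : ∀ (x : M) (y : TangentSpace (𝓡 n) x) (r : ℝ),
    toFun ⟨x, r • y⟩ = |r| * toFun ⟨x, y⟩
  posDef : ∀ (x : M) (y v : TangentSpace (𝓡 n) x), y ≠ 0 → v ≠ 0 →
    0 < fundamentalTensor toFun x y v v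
  smooth : ContMDiffOn (𝓡 n).tangent 𝓘(ℝ, ℝ) ∞ toFun {v | v.2 ≠ 0}
  continuousAt_zero : ∀ x : M, ContinuousAt toFun ⟨x, 0⟩

/-! ### Piecewise smooth regular curves, the `p`-energy and its critical points

Curves `[0, 1] → M` are represented by maps `ℝ → M`; only their values on `[0, 1]` matter. -/

/-- `0 = τ₀ < τ₁ < ⋯ < τ_k = 1`. -/
def IsPartition {k : ℕ} (τ : Fin (k + 1) → ℝ) : Prop :=
  StrictMono τ ∧ τ 0 = 0 ∧ τ (Fin.last k) = 1

section Curves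

variable (n : ℕ) {M : Type*} [TopologicalSpace M] [ChartedSpace (Model n) M]

/-- The velocity of the curve `c` at `t`, relative to the parameter interval `S`
(one-sided at the end points of `S`). -/
def velocity (c : ℝ → M) (S : Set ℝ) (t : ℝ) : TangentSpace (𝓡 n) (c t) :=
  mfderivWithin 𝓘(ℝ, ℝ) (𝓡 n) c S t (1 : ℝ)

/-- `Ω`: the piecewise `C^∞` regular curves `c : [0, 1] → M` from `x₀` to `x₁`. -/
def pathSpace (x₀ x₁ : M) : Set (ℝ → M) :=
  {c | ContinuousOn c (Icc 0 1) ∧ c 0 = x₀ ∧ c 1 = x₁ ∧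
    ∃ (k : ℕ) (τ : Fin (k + 1) → ℝ), IsPartition τ ∧ ∀ i : Fin k,
      ContMDiffOn 𝓘(ℝ, ℝ) (𝓡 n) ∞ c (Icc (τ i.castSucc) (τ i.succ)) ∧
      ∀ t ∈ Icc (τ i.castSucc) (τ i.succ), velocity n c (Icc (τ i.castSucc) (τ i.succ)) t ≠ 0}

/-- `α s t = c_s(t)`, `|s| < ε`, is a one-parameter variation of `c` in `Ω`: it is continuous,
`C^∞` on the strips `(-ε, ε) × [τ_{i}, τ_{i+1}]` of some partition, `c_0 = c` on `[0, 1]`,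
and every `c_s` lies in `Ω`. -/
def IsVariation (x₀ x₁ : M) (c : ℝ → M) (ε : ℝ) (α : ℝ → ℝ → M) : Prop :=
  0 < ε ∧ (∀ t ∈ Icc (0 : ℝ) 1, α 0 t = c t) ∧
  (∀ s ∈ Ioo (-ε) ε, α s ∈ pathSpace n x₀ x₁) ∧
  ContinuousOn (fun q : ℝ × ℝ => α q.1 q.2) (Ioo (-ε) ε ×ˢ Icc 0 1) ∧
  ∃ (k : ℕ) (τ : Fin (k + 1) → ℝ), IsPartition τ ∧ ∀ i : Fin k,
    ContMDiffOn 𝓘(ℝ, ℝ × ℝ) (𝓡 n) ∞ (fun q : ℝ × ℝ => α q.1 q.2)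
      (Ioo (-ε) ε ×ˢ Icc (τ i.castSucc) (τ i.succ))

end Curves

section Energy

variable {n : ℕ} {M : Type*} [TopologicalSpace M] [ChartedSpace (Model n) M]
  [IsManifold (𝓡 n) ∞ M]

/-- The `p`-energy `E_p(c) = ∫₀¹ g(ċ, ċ)^{p/2} dt`, where `g` is taken at `(c(t), ċ(t))`. -/
def pEnergy (F : FinslerMetric n M) (p : ℝ) (c : ℝ → M) : ℝ :=
  ∫ t in (0 : ℝ)..1,
    (fundamentalTensor F.toFun (c t) (velocity n c (Icc 0 1) t)
      (velocity n c (Icc 0 1) t) (velocity n c (Icc 0 1) t)) ^ (p / 2)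

/-- `c` is a critical point of `E_p : Ω → ℝ`: the derivative of `s ↦ E_p(c_s)` at `0` vanishes
for every one-parameter variation of `c` in `Ω`. -/
def IsCriticalPoint (F : FinslerMetric n M) (p : ℝ) (x₀ x₁ : M) (c : ℝ → M) : Prop :=
  ∀ (ε : ℝ) (α : ℝ → ℝ → M), IsVariation n x₀ x₁ c ε α →
    HasDerivAt (fun s => pEnergy F p (α s)) 0 0

end Energy

/-! ### The Cartan connection in local coordinates -/

section Partials

variable {n : ℕ}

/-- `∂f/∂x^i`. -/
def pdx (i : Fin n) (f : Model n → Model n → ℝ) (x y : Model n) : ℝ :=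
  fderiv ℝ (fun x' => f x' y) x (EuclideanSpace.single i 1)

/-- `∂f/∂y^i`. -/
def pdy (i : Fin n) (f : Model n → Model n → ℝ) (x y : Model n) : ℝ :=
  fderiv ℝ (fun y' => f x y') y (EuclideanSpace.single i 1)

end Partials

section Cartan

variable {n : ℕ} {M : Type*} [TopologicalSpace M] [ChartedSpace (Model n) M]
  [IsManifold (𝓡 n) ∞ M] (F : FinslerMetric n M) (e : OpenPartialHomeomorph M (Model n))

/-- `F` in the coordinates `(x^i, y^i)` of `TM` induced by the chart `e`. -/
def localF (x y : Model n) : ℝ :=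
  F.toFun ⟨e.symm x, mfderiv 𝓘(ℝ, Model n) (𝓡 n) e.symm x y⟩

/-- `g_{ij} = ½ ∂²F²/∂y^i∂y^j`. -/
def gLower (i j : Fin n) (x y : Model n) : ℝ :=
  (1 / 2) * pdy i (pdy j (fun x y => localF F e x y ^ 2)) x y

/-- `g^{ij}`, the inverse matrix of `g_{ij}`. -/
def gUpper (i j : Fin n) (x y : Model n) : ℝ :=
  (Matrix.of fun a b => gLower F e a b x y)⁻¹ i j

/-- `Γ^i_{jk}`, the formal Christoffel symbols. -/
def christoffel (i j k : Fin n) (x y : Model n) : ℝ :=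
  (1 / 2) * ∑ m, gUpper F e i m x y *
    (pdx j (gLower F e m k) x y + pdx k (gLower F e j m) x y - pdx m (gLower F e j k) x y)

/-- `Γ^i_{00} = Γ^i_{kl} y^k y^l`. -/
def christoffel00 (i : Fin n) (x y : Model n) : ℝ :=
  ∑ k, ∑ l, christoffel F e i k l x y * y k * y l

/-- The nonlinear connection `N^i_j = ½ ∂Γ^i_{00}/∂y^j`. -/
def nonlinearConn (i j : Fin n) (x y : Model n) : ℝ :=
  (1 / 2) * pdy j (christoffel00 F e i) x y

/-- The horizontal derivative `δf/δx^i = ∂f/∂x^i - N^j_i ∂f/∂y^j`. -/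
def deltaX (i : Fin n) (f : Model n → Model n → ℝ) (x y : Model n) : ℝ :=
  pdx i f x y - ∑ j, nonlinearConn F e j i x y * pdy j f x y

/-- The horizontal coefficients `L^i_{jk}` of the Cartan connection. -/
def cartanL (i j k : Fin n) (x y : Model n) : ℝ :=
  (1 / 2) * ∑ m, gUpper F e i m x y *
    (deltaX F e j (gLower F e m k) x y + deltaX F e k (gLower F e j m) x y
      - deltaX F e m (gLower F e j k) x y)

/-- The vertical coefficients `C^i_{jk}` of the Cartan connection. -/
def cartanC (i j k : Fin n) (x y : Model n) : ℝ :=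
  (1 / 2) * ∑ m, gUpper F e i m x y *
    (pdy j (gLower F e m k) x y + pdy k (gLower F e j m) x y - pdy m (gLower F e j k) x y)

/-- The `i`-th component at `t` of the covariant derivative `∇X/dt` along a curve with coordinate
expression `u : ℝ → ℝⁿ`, parametrized by `S`, of the vector field along it with components `X^i(t)`:
`dX^i/dt + X^m [L^i_{mk}(u, u̇) u̇^k + C^i_{mk}(u, u̇) (ü^k + N^k_l(u, u̇) u̇^l)]`. -/
def covDeriv (S : Set ℝ) (u X : ℝ → Model n) (i : Fin n) (t : ℝ) : ℝ :=
  derivWithin X S t i + ∑ m, X t m * ∑ k,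
    (cartanL F e i m k (u t) (derivWithin u S t) * derivWithin u S t k
      + cartanC F e i m k (u t) (derivWithin u S t) *
        (derivWithin (derivWithin u S) S t k
          + ∑ l, nonlinearConn F e k l (u t) (derivWithin u S t) * derivWithin u S t l))

end Cartan

/-! ### Geodesics -/

section Geodesics

variable {n : ℕ} {M : Type*} [TopologicalSpace M] [ChartedSpace (Model n) M]
  [IsManifold (𝓡 n) ∞ M]

/-- `c : [0, 1] → M` is a geodesic: a `C^∞` regular curve with `∇ċ/dt = 0` at every `t ∈ [0, 1]`,
in every chart around `c(t)`. -/
def IsGeodesic (F : FinslerMetric n M) (c : ℝ → M) : Prop :=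
  ContMDiffOn 𝓘(ℝ, ℝ) (𝓡 n) ∞ c (Icc 0 1) ∧
  (∀ t ∈ Icc (0 : ℝ) 1, velocity n c (Icc 0 1) t ≠ 0) ∧
  ∀ t ∈ Icc (0 : ℝ) 1, ∀ e ∈ IsManifold.maximalAtlas (𝓡 n) ∞ M, c t ∈ e.source →
    ∀ i : Fin n,
      covDeriv F e (Icc 0 1) (fun r => e (c r)) (derivWithin (fun r => e (c r)) (Icc 0 1)) i t = 0

/-- An orientation preserving piecewise `C^∞` regular change of parameter of `[0, 1]`. -/
def IsParameterChange (φ : ℝ → ℝ) : Prop :=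
  ContinuousOn φ (Icc 0 1) ∧ φ 0 = 0 ∧ φ 1 = 1 ∧
    ∃ (k : ℕ) (τ : Fin (k + 1) → ℝ), IsPartition τ ∧ ∀ i : Fin k,
      ContDiffOn ℝ ∞ φ (Icc (τ i.castSucc) (τ i.succ)) ∧
      ∀ t ∈ Icc (τ i.castSucc) (τ i.succ), 0 < derivWithin φ (Icc (τ i.castSucc) (τ i.succ)) t

/-- `c : [0, 1] → M` is a reparametrized geodesic: `c = γ ∘ φ` with `γ` a geodesic and `φ` a
change of parameter. -/
def IsReparametrizedGeodesic (F : FinslerMetric n M) (c : ℝ → M) : Prop :=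
  ∃ (γ : ℝ → M) (φ : ℝ → ℝ), IsGeodesic F γ ∧ IsParameterChange φ ∧
    ∀ t ∈ Icc (0 : ℝ) 1, c t = γ (φ t)

end Geodesics

end FinslerEnergy

end

noncomputable section

namespace FinslerEnergy

set_option linter.unusedSectionVars false

/-! ### Partitions of the unit interval -/

/-! By Euler's identity g(y, y) = F(y)², so E_p is the integral of F(c, ċ)^p, and critical points
can be studied through the Euler-Lagrange equation of F^p on each smooth piece and the matching of
momenta at the breaks.

The local input is homogeneity. Since F has degree 1 in y, the Euler-Lagrange equation of F holds
automatically in the direction y (`fderiv_fderiv_chartF_self`). For F^p with p ≠ 0, 1, testing in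
that direction therefore leaves only dF/dt = 0. Thus the equation of F^p says that the speed is
constant and that F satisfies its own equation, which is the equation of F²
(`geodesic_equation_of_eulerLagrange`, `geodesic_equation_iff_chartF`). The latter is ü + Γ₀₀(u, u̇)
= 0, and so is ∇ċ/dt = 0: contracted with y, the vertical coefficients C vanish and L reduces to Γ
(`geodesic_equation_iff`, `covDeriv_velocity`).

A geodesic is critical for every p: its constant speed comes out of the first variation, and the
remaining integrand is the t-derivative of the pairing of momentum with variation field, which
vanishes at the fixed end points (`IsGeodesic.isCriticalPoint`).

Conversely, let c be critical and p ≠ 1. Variations supported in a chart give the Euler-Lagrange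
equation on each piece and equality of the one-sided momenta F^(p-1) ∂F/∂y at each break
(`IsCriticalPoint.eulerLagrange`). Strict convexity of F² makes y ↦ F^(p-1) ∂F/∂y injective for p ≠
1 (`IsMinkowskiNorm.eq_of_legendre_eq`), so the velocity has no jump, and a solution of a smooth
second order equation without a velocity jump is smooth (`contDiffOn_of_second_order`).

For p = 1 the functional is length, which is invariant under changes of parameter, and so is
criticality (`IsCriticalPoint.comp`). Reparametrizing by normalized arc length gives constant speed,
for which the first variations of E_1 and E_2 are proportional (`IsCriticalPoint.of_speed_eq`), so
the case p = 2 applies. -/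

lemma IsPartition.mem_Icc {k : ℕ} {τ : Fin (k + 1) → ℝ} (h : IsPartition τ) (i : Fin (k + 1)) :
    τ i ∈ Icc (0 : ℝ) 1 :=
  ⟨h.2.1 ▸ h.1.monotone (Fin.zero_le i), h.2.2 ▸ h.1.monotone (Fin.le_last i)⟩

/-- `P a b` holds for all subintervals `[a, b]` of `[0, 1]` without points of some finite set in
their interior. -/
def PiecewiseOn (P : ℝ → ℝ → Prop) : Prop :=
  ∃ S : Finset ℝ, ∀ a b, 0 ≤ a → a < b → b ≤ 1 → (∀ x ∈ S, x ∉ Ioo a b) → P a b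

lemma PiecewiseOn.mono {P Q : ℝ → ℝ → Prop} (h : PiecewiseOn P)
    (hPQ : ∀ a b, 0 ≤ a → a < b → b ≤ 1 → P a b → Q a b) : PiecewiseOn Q :=
  let ⟨S, hS⟩ := h
  ⟨S, fun a b ha hab hb hx => hPQ a b ha hab hb (hS a b ha hab hb hx)⟩

lemma PiecewiseOn.and {P Q : ℝ → ℝ → Prop} (hP : PiecewiseOn P) (hQ : PiecewiseOn Q) :
    PiecewiseOn fun a b => P a b ∧ Q a b := by
  classical
  obtain ⟨S, hS⟩ := hP
  obtain ⟨T, hT⟩ := hQ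
  exact ⟨S ∪ T, fun a b ha hab hb hx =>
    ⟨hS a b ha hab hb fun x h => hx x (Finset.mem_union_left _ h),
      hT a b ha hab hb fun x h => hx x (Finset.mem_union_right _ h)⟩⟩

/-- Trading a partition for a finite exceptional set turns common refinement into a union of finite
sets. The exceptional set is the set of nodes: an interval with no node inside it lies in a single
piece. -/
lemma IsPartition.piecewiseOn {P : ℝ → ℝ → Prop} {k : ℕ} {τ : Fin (k + 1) → ℝ}
    (h : IsPartition τ) (hP : ∀ i : Fin k, P (τ i.castSucc) (τ i.succ))
    (hsub : ∀ a b a' b', P a b → a ≤ a' → a' < b' → b' ≤ b → P a' b') : PiecewiseOn P := by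
  classical
  refine ⟨Finset.univ.image τ, fun a b ha hab hb hx => ?_⟩
  by_contra hcon
  -- If no piece contains `[a, b]`, each node at or left of `a` is followed by another such node,
  -- until `1 ≤ a`.
  have key : ∀ j, τ j ≤ a := by
    intro j
    induction j using Fin.induction with
    | zero => rw [h.2.1]; exact ha
    | succ i hi =>
      by_contra hlt
      have h1 : b ≤ τ i.succ := by
        by_contra h2
        exact hx (τ i.succ) (Finset.mem_image_of_mem _ (Finset.mem_univ _))
          ⟨lt_of_not_ge hlt, lt_of_not_ge h2⟩
      exact hcon (hsub _ _ _ _ (hP i) hi hab h1)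
  have := key (Fin.last k)
  rw [h.2.2] at this
  linarith

lemma PiecewiseOn.exists_partition {P : ℝ → ℝ → Prop} (h : PiecewiseOn P) :
    ∃ (k : ℕ) (τ : Fin (k + 1) → ℝ), IsPartition τ ∧
      ∀ i : Fin k, P (τ i.castSucc) (τ i.succ) := by
  classical
  obtain ⟨S, hS⟩ := h
  set T : Finset ℝ := insert 0 (insert 1 (S.filter (· ∈ Ioo (0 : ℝ) 1))) with hT
  have h0 : (0 : ℝ) ∈ T := by simp [hT]
  have h1 : (1 : ℝ) ∈ T := by simp [hT]
  have hTI : ∀ x ∈ T, x ∈ Icc (0 : ℝ) 1 := by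
    intro x hx
    simp only [hT, Finset.mem_insert, Finset.mem_filter] at hx
    rcases hx with rfl | rfl | hx
    · simp
    · simp
    · exact Ioo_subset_Icc_self hx.2
  obtain ⟨k, hk⟩ : ∃ k, T.card = k + 1 := Nat.exists_eq_succ_of_ne_zero (Finset.card_ne_zero_of_mem h0)
  have hr : ∀ x ∈ T, ∃ j, T.orderEmbOfFin hk j = x := by
    intro x hx
    have : x ∈ Set.range (T.orderEmbOfFin hk) := by rw [Finset.range_orderEmbOfFin]; exact hx
    exact this
  have hm : ∀ j, T.orderEmbOfFin hk j ∈ T := fun j => T.orderEmbOfFin_mem hk j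
  have hmono : StrictMono (T.orderEmbOfFin hk) := (T.orderEmbOfFin hk).strictMono
  have e0 : T.orderEmbOfFin hk 0 = 0 := by
    obtain ⟨j, hj⟩ := hr 0 h0
    exact le_antisymm (hj ▸ hmono.monotone (Fin.zero_le j)) (hTI _ (hm 0)).1
  have e1 : T.orderEmbOfFin hk (Fin.last k) = 1 := by
    obtain ⟨j, hj⟩ := hr 1 h1
    exact le_antisymm (hTI _ (hm _)).2 (hj ▸ hmono.monotone (Fin.le_last j))
  refine ⟨k, T.orderEmbOfFin hk, ⟨hmono, e0, e1⟩, fun i =>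
    hS _ _ (hTI _ (hm _)).1 (hmono i.castSucc_lt_succ) (hTI _ (hm _)).2 ?_⟩
  intro x hxS hx
  have hxT : x ∈ T := by
    simp only [hT, Finset.mem_insert, Finset.mem_filter]
    exact Or.inr (Or.inr ⟨hxS, (hTI _ (hm _)).1.trans_lt hx.1, hx.2.trans_le (hTI _ (hm _)).2⟩)
  obtain ⟨j, rfl⟩ := hr x hxT
  have h2 := hmono.lt_iff_lt.1 hx.1
  have h3 := hmono.lt_iff_lt.1 hx.2
  simp only [Fin.lt_def, Fin.val_castSucc, Fin.val_succ] at h2 h3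
  omega

/-- The gluing principle: integrability, integral identities, continuity and, later, being a
geodesic all pass from the pieces to `[0, 1]` through it. -/
lemma PiecewiseOn.induction {P : ℝ → ℝ → Prop} (h : PiecewiseOn P)
    (htrans : ∀ a b c, 0 ≤ a → a < b → b < c → c ≤ 1 → P a b → P b c → P a c) : P 0 1 := by
  obtain ⟨k, τ, hτ, hP⟩ := h.exists_partition
  have key : ∀ j : Fin (k + 1), j ≠ 0 → P 0 (τ j) := by
    intro j
    induction j using Fin.induction with
    | zero => exact fun h => absurd rfl h
    | succ i hi =>
      intro _
      by_cases hi0 : i.castSucc = 0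
      · have := hP i
        rwa [hi0, hτ.2.1] at this
      · refine htrans _ _ _ le_rfl ?_ (hτ.1 i.castSucc_lt_succ) (hτ.mem_Icc _).2 (hi hi0) (hP i)
        rw [← hτ.2.1]
        exact hτ.1 (Fin.pos_of_ne_zero hi0)
  have := key (Fin.last k) (by
    intro h0
    have h1 := hτ.2.2
    rw [h0, hτ.2.1] at h1
    exact zero_ne_one h1)
  rwa [hτ.2.2] at this

/-- A finite set has no points other than `t` itself near `t`, so a short enough interval starting
at `t` is admissible. -/
lemma PiecewiseOn.exists_right {P : ℝ → ℝ → Prop} (h : PiecewiseOn P) {t d : ℝ} (ht : t ∈ Ico (0 : ℝ) 1)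
    (htd : t < d) : ∃ b, t < b ∧ b ≤ 1 ∧ b ≤ d ∧ P t b := by
  obtain ⟨S, hS⟩ := h
  have hfin : ((S : Set ℝ) \ {t})ᶜ ∈ nhds t :=
    (S.finite_toSet.subset sdiff_subset).isClosed.isOpen_compl.mem_nhds (by simp)
  obtain ⟨ε, hε, hb⟩ := Metric.mem_nhds_iff.1 hfin
  refine ⟨min (t + ε) (min 1 d), ?_, ?_, ?_, ?_⟩
  · simp [hε, ht.2, htd]
  · simp
  · simp
  · refine hS _ _ ht.1 (by simp [hε, ht.2, htd]) (by simp) fun x hx hxI => ?_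
    have h1 : x < t + ε := hxI.2.trans_le (min_le_left _ _)
    have : x ∈ Metric.ball t ε := by
      rw [Metric.mem_ball, Real.dist_eq, abs_lt]
      constructor <;> linarith [hxI.1]
    exact hb this ⟨hx, hxI.1.ne'⟩

lemma PiecewiseOn.exists_left {P : ℝ → ℝ → Prop} (h : PiecewiseOn P) {t d : ℝ} (ht : t ∈ Ioc (0 : ℝ) 1)
    (hdt : d < t) : ∃ a, a < t ∧ 0 ≤ a ∧ d ≤ a ∧ P a t := by
  obtain ⟨S, hS⟩ := h
  have hfin : ((S : Set ℝ) \ {t})ᶜ ∈ nhds t :=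
    (S.finite_toSet.subset sdiff_subset).isClosed.isOpen_compl.mem_nhds (by simp)
  obtain ⟨ε, hε, hb⟩ := Metric.mem_nhds_iff.1 hfin
  refine ⟨max (t - ε) (max 0 d), ?_, ?_, ?_, ?_⟩
  · simp [hε, ht.1, hdt]
  · simp
  · simp
  · refine hS _ _ (by simp) (by simp [hε, ht.1, hdt]) ht.2 fun x hx hxI => ?_
    have h1 : t - ε < x := (le_max_left _ _).trans_lt hxI.1
    have : x ∈ Metric.ball t ε := by
      rw [Metric.mem_ball, Real.dist_eq, abs_lt]
      constructor <;> linarith [hxI.2]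
    exact hb this ⟨hx, hxI.2.ne⟩

/-! ### Calculus on intervals -/

/-- Bootstrapping for w' = H(w): if w is C^m, so is w', hence w is C^(m+1). It gives smoothness of
unbroken geodesics and of inverse parameter changes. -/
lemma contDiffOn_of_hasDerivWithinAt_comp {E : Type*} [NormedAddCommGroup E] [NormedSpace ℝ E]
    {s : Set ℝ} (hs : UniqueDiffOn ℝ s) {U : Set E} {H : E → E} (hH : ContDiffOn ℝ ∞ H U)
    {w : ℝ → E} (hw : MapsTo w s U) (h : ∀ t ∈ s, HasDerivWithinAt w (H (w t)) s t) :
    ContDiffOn ℝ ∞ w s := by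
  rw [contDiffOn_infty]
  intro m
  induction m with
  | zero => exact contDiffOn_zero.2 fun t ht => (h t ht).continuousWithinAt
  | succ m ih =>
    push_cast
    rw [contDiffOn_succ_iff_derivWithin hs]
    refine ⟨fun t ht => (h t ht).differentiableWithinAt, fun h => by simp at h, ?_⟩
    have := (hH.of_le (by exact_mod_cast le_top : (m : ℕ∞ω) ≤ ∞)).comp ih hw
    exact this.congr fun t ht => (h t ht).derivWithin (hs t ht)

/-- The fundamental lemma of the calculus of variations: g vanishes almost everywhere, hence
everywhere by continuity. -/
lemma eqOn_zero_of_integral_mul_eq_zero {a b : ℝ} {g : ℝ → ℝ} (hg : ContinuousOn g (Ioo a b))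
    (h : ∀ ρ : ℝ → ℝ, ContDiff ℝ ∞ ρ → HasCompactSupport ρ → tsupport ρ ⊆ Ioo a b →
      ∫ t, ρ t * g t = 0) : EqOn g 0 (Ioo a b) := by
  have h1 := isOpen_Ioo.ae_eq_zero_of_integral_contDiff_smul_eq_zero
    (hg.locallyIntegrableOn (μ := MeasureTheory.volume) measurableSet_Ioo) h
  refine MeasureTheory.Measure.eqOn_open_of_ae_eq (μ := MeasureTheory.volume) ?_ isOpen_Ioo hg
    continuousOn_const
  exact (MeasureTheory.ae_restrict_iff' measurableSet_Ioo).2 h1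

lemma integral_mul_deriv_of_contDiffOn {a b : ℝ} (hab : a < b) {P ρ : ℝ → ℝ}
    (hP : ContDiffOn ℝ ∞ P (Icc a b)) (hρ : ContDiff ℝ ∞ ρ) :
    ∫ t in a..b, P t * deriv ρ t =
      P b * ρ b - P a * ρ a - ∫ t in a..b, derivWithin P (Icc a b) t * ρ t := by
  have hu : UniqueDiffOn ℝ (Icc a b) := uniqueDiffOn_Icc hab
  apply intervalIntegral.integral_mul_deriv_eq_deriv_mul_of_hasDerivWithinAt
  · rw [uIcc_of_le hab.le]
    exact fun x hx => (hP.differentiableOn (by simp) x hx).hasDerivWithinAt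
  · exact fun x hx => (hρ.differentiable (by simp) x).hasDerivAt.hasDerivWithinAt
  · apply ContinuousOn.intervalIntegrable
    rw [uIcc_of_le hab.le]
    exact hP.continuousOn_derivWithin hu (by simp)
  · exact (hρ.continuous_deriv (by simp)).intervalIntegrable _ _

/-- The weak Euler-Lagrange equation across a corner `t₀`. -/
lemma weak_eulerLagrange {a t₀ b : ℝ} (ha : a < t₀) (hb : t₀ < b) {P X P' X' : ℝ → ℝ}
    (hP : ContDiffOn ℝ ∞ P (Icc a t₀)) (hX : ContinuousOn X (Icc a t₀))
    (hP' : ContDiffOn ℝ ∞ P' (Icc t₀ b)) (hX' : ContinuousOn X' (Icc t₀ b))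
    (h : ∀ ρ : ℝ → ℝ, ContDiff ℝ ∞ ρ → HasCompactSupport ρ → tsupport ρ ⊆ Ioo a b →
      (∫ t in a..t₀, X t * ρ t + P t * deriv ρ t) +
        (∫ t in t₀..b, X' t * ρ t + P' t * deriv ρ t) = 0) :
    EqOn (derivWithin P (Icc a t₀)) X (Ioo a t₀) ∧ EqOn (derivWithin P' (Icc t₀ b)) X' (Ioo t₀ b) ∧
      P t₀ = P' t₀ := by
  have hD : ContinuousOn (derivWithin P (Icc a t₀)) (Icc a t₀) :=
    hP.continuousOn_derivWithin (uniqueDiffOn_Icc ha) (by simp)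
  have hD' : ContinuousOn (derivWithin P' (Icc t₀ b)) (Icc t₀ b) :=
    hP'.continuousOn_derivWithin (uniqueDiffOn_Icc hb) (by simp)
  have parts : ∀ {a b : ℝ} {P X : ℝ → ℝ}, a < b → ContDiffOn ℝ ∞ P (Icc a b) →
      ContinuousOn X (Icc a b) → ∀ ρ : ℝ → ℝ, ContDiff ℝ ∞ ρ →
      ∫ t in a..b, X t * ρ t + P t * deriv ρ t =
        (∫ t in a..b, ρ t * (X t - derivWithin P (Icc a b) t)) + (P b * ρ b - P a * ρ a) := by
    intro a b P X hab hP hX ρ hρ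
    have hDc : ContinuousOn (derivWithin P (Icc a b)) (Icc a b) :=
      hP.continuousOn_derivWithin (uniqueDiffOn_Icc hab) (by simp)
    have i1 : IntervalIntegrable (fun t => X t * ρ t) MeasureTheory.volume a b := by
      apply ContinuousOn.intervalIntegrable
      rw [uIcc_of_le hab.le]
      exact hX.mul hρ.continuous.continuousOn
    have i2 : IntervalIntegrable (fun t => P t * deriv ρ t) MeasureTheory.volume a b := by
      apply ContinuousOn.intervalIntegrable
      rw [uIcc_of_le hab.le]
      exact hP.continuousOn.mul (hρ.continuous_deriv (by simp)).continuousOn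
    have i3 : IntervalIntegrable (fun t => derivWithin P (Icc a b) t * ρ t)
        MeasureTheory.volume a b := by
      apply ContinuousOn.intervalIntegrable
      rw [uIcc_of_le hab.le]
      exact hDc.mul hρ.continuous.continuousOn
    have e : ∫ t in a..b, ρ t * (X t - derivWithin P (Icc a b) t) =
        (∫ t in a..b, X t * ρ t) - ∫ t in a..b, derivWithin P (Icc a b) t * ρ t := by
      rw [← intervalIntegral.integral_sub i1 i3]
      congr 1; ext t; ring
    rw [intervalIntegral.integral_add i1 i2, integral_mul_deriv_of_contDiffOn hab hP hρ, e]
    ring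
  have off : ∀ {ρ : ℝ → ℝ} {s : Set ℝ} {x : ℝ}, tsupport ρ ⊆ s → x ∉ s → ρ x = 0 :=
    fun hs hx => image_eq_zero_of_notMem_tsupport fun h => hx (hs h)
  have full : ∀ {ρ g : ℝ → ℝ} {a b : ℝ}, a < b → tsupport ρ ⊆ Ioo a b →
      ∫ t in a..b, ρ t * g t = ∫ t, ρ t * g t := by
    intro ρ g a b hab hs
    apply intervalIntegral.integral_eq_integral_of_support_subset
    intro x hx
    exact Ioo_subset_Ioc_self (hs (subset_tsupport _ (left_ne_zero_of_mul hx)))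
  have zero : ∀ {ρ g : ℝ → ℝ} {a b : ℝ}, a ≤ b → (∀ x ∈ Icc a b, ρ x = 0) →
      ∫ t in a..b, ρ t * g t = 0 := by
    intro ρ g a b hab hs
    rw [intervalIntegral.integral_congr (g := fun _ => (0 : ℝ)), intervalIntegral.integral_zero]
    intro x hx
    rw [uIcc_of_le hab] at hx
    simp [hs x hx]
  -- For ρ supported left of `t₀`, the right integral and all boundary terms vanish.
  have L : EqOn (fun t => X t - derivWithin P (Icc a t₀) t) 0 (Ioo a t₀) := by
    refine eqOn_zero_of_integral_mul_eq_zero ((hX.sub hD).mono Ioo_subset_Icc_self) ?_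
    intro ρ hρ hc hs
    have h0 := h ρ hρ hc (hs.trans (Ioo_subset_Ioo le_rfl hb.le))
    rw [parts ha hP hX ρ hρ, parts hb hP' hX' ρ hρ,
      zero hb.le fun x hx => off hs fun h => absurd h.2 (not_lt.2 hx.1), full ha hs,
      off hs (x := a) (by simp), off hs (x := t₀) (by simp),
      off hs (x := b) (by simp [hb.le])] at h0
    simpa using h0
  have R : EqOn (fun t => X' t - derivWithin P' (Icc t₀ b) t) 0 (Ioo t₀ b) := by
    refine eqOn_zero_of_integral_mul_eq_zero ((hX'.sub hD').mono Ioo_subset_Icc_self) ?_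
    intro ρ hρ hc hs
    have h0 := h ρ hρ hc (hs.trans (Ioo_subset_Ioo ha.le le_rfl))
    rw [parts ha hP hX ρ hρ, parts hb hP' hX' ρ hρ,
      zero ha.le fun x hx => off hs fun h => absurd h.1 (not_lt.2 hx.2), full hb hs,
      off hs (x := b) (by simp), off hs (x := t₀) (by simp),
      off hs (x := a) (by simp [ha.le])] at h0
    simpa using h0
  refine ⟨fun t ht => (sub_eq_zero.1 (L ht)).symm, fun t ht => (sub_eq_zero.1 (R ht)).symm, ?_⟩
  -- With both equations known, a bump with ρ(t₀) = 1 leaves exactly the jump P(t₀) - P'(t₀).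
  obtain ⟨ρ, hρs, hρc, hρ, -, hρ1⟩ :=
    exists_contDiff_tsupport_subset (n := ⊤) (Ioo_mem_nhds ha hb)
  have h0 := h ρ hρ hρc hρs
  have small : ∀ {a b : ℝ} {g : ℝ → ℝ}, a ≤ b → EqOn g 0 (Ioo a b) →
      ∫ t in a..b, ρ t * g t = 0 := by
    intro a b g hab hg
    rw [intervalIntegral.integral_of_le hab, MeasureTheory.integral_Ioc_eq_integral_Ioo,
      MeasureTheory.setIntegral_congr_fun measurableSet_Ioo (g := fun _ => (0 : ℝ))]
    · simp
    · intro x hx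
      simp [hg hx]
  rw [parts ha hP hX ρ hρ, parts hb hP' hX' ρ hρ, small ha.le L, small hb.le R,
    off hρs (x := a) (by simp), off hρs (x := b) (by simp), hρ1] at h0
  linarith

/-- Differentiation under the integral sign for a function that is `C¹` on a strip. -/
lemma hasDerivAt_integral_of_contDiffOn_strip {ε a b : ℝ} (hε : 0 < ε) (hab : a < b)
    {f : ℝ × ℝ → ℝ} (hf : ContDiffOn ℝ 1 f (Ioo (-ε) ε ×ˢ Icc a b)) :
    (∀ s ∈ Ioo (-ε) ε, IntervalIntegrable (fun t => f (s, t)) MeasureTheory.volume a b) ∧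
    IntervalIntegrable (fun t => deriv (fun s => f (s, t)) 0) MeasureTheory.volume a b ∧
    HasDerivAt (fun s => ∫ t in a..b, f (s, t)) (∫ t in a..b, deriv (fun s => f (s, t)) 0) 0 := by
  set S : Set (ℝ × ℝ) := Ioo (-ε) ε ×ˢ Icc a b with hS
  have hu : UniqueDiffOn ℝ S := (isOpen_Ioo.uniqueDiffOn).prod (uniqueDiffOn_Icc hab)
  set D : ℝ × ℝ → ℝ := fun q => fderivWithin ℝ f S q (1, 0) with hDdef
  have hD : ContinuousOn D S := (hf.continuousOn_fderivWithin hu le_rfl).clm_apply continuousOn_const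
  have hint : ∀ s ∈ Ioo (-ε) ε, ∀ g : ℝ × ℝ → ℝ, ContinuousOn g S →
      IntervalIntegrable (fun t => g (s, t)) MeasureTheory.volume a b := by
    intro s hs g hg
    apply ContinuousOn.intervalIntegrable
    rw [uIcc_of_le hab.le]
    exact hg.comp (by fun_prop) fun t ht => ⟨hs, ht⟩
  have hder : ∀ s ∈ Ioo (-ε) ε, ∀ t ∈ Icc a b, HasDerivAt (fun s => f (s, t)) (D (s, t)) s := by
    intro s hs t ht
    have h1 : HasFDerivWithinAt f (fderivWithin ℝ f S (s, t)) S (s, t) :=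
      (hf.differentiableOn (by simp) (s, t) ⟨hs, ht⟩).hasFDerivWithinAt
    have h2 : HasDerivWithinAt (fun s : ℝ => (s, t)) ((1 : ℝ), (0 : ℝ)) (Ioo (-ε) ε) s :=
      ((hasDerivAt_id s).prodMk (hasDerivAt_const s t)).hasDerivWithinAt
    exact (h1.comp_hasDerivWithinAt s h2 (show MapsTo _ _ S from fun r hr => ⟨hr, ht⟩)).hasDerivAt (isOpen_Ioo.mem_nhds hs)
  have h0 : (0 : ℝ) ∈ Ioo (-ε) ε := ⟨by linarith, hε⟩
  -- Halving the s-interval makes the strip compact, so the s-derivative has a constant dominating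
  -- bound.
  have hcompact : IsCompact (Icc (-(ε / 2)) (ε / 2) ×ˢ Icc a b) := isCompact_Icc.prod isCompact_Icc
  have hsub : Icc (-(ε / 2)) (ε / 2) ×ˢ Icc a b ⊆ S :=
    prod_mono (fun x hx => ⟨by linarith [hx.1], by linarith [hx.2]⟩) le_rfl
  obtain ⟨C, hC⟩ := hcompact.exists_bound_of_continuousOn (hD.mono hsub)
  have key := intervalIntegral.hasDerivAt_integral_of_dominated_loc_of_deriv_le
    (μ := MeasureTheory.volume) (a := a) (b := b)
    (F := fun s t => f (s, t)) (F' := fun s t => D (s, t)) (x₀ := 0) (bound := fun _ => C)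
    (s := Icc (-(ε / 2)) (ε / 2)) (Icc_mem_nhds (by linarith) (by linarith))
    (Filter.eventually_of_mem (isOpen_Ioo.mem_nhds h0) fun s hs =>
      (intervalIntegrable_iff.1 (hint s hs f hf.continuousOn)).1)
    (hint 0 h0 f hf.continuousOn)
    (intervalIntegrable_iff.1 (hint 0 h0 D hD)).1
    (Filter.Eventually.of_forall fun t ht s hs => hC (s, t) (mk_mem_prod hs (by
      rw [uIoc_of_le hab.le] at ht; exact Ioc_subset_Icc_self ht)))
    intervalIntegrable_const
    (Filter.Eventually.of_forall fun t ht s hs => by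
      rw [uIoc_of_le hab.le] at ht
      exact hder s ⟨by linarith [hs.1], by linarith [hs.2]⟩ t (Ioc_subset_Icc_self ht))
  have heq : EqOn (fun t => D (0, t)) (fun t => deriv (fun s => f (s, t)) 0) (uIcc a b) := by
    intro t ht
    rw [uIcc_of_le hab.le] at ht
    exact (hder 0 h0 t ht).deriv.symm
  refine ⟨fun s hs => hint s hs f hf.continuousOn, ?_, ?_⟩
  · exact key.1.congr (heq.mono uIoc_subset_uIcc)
  · rw [← intervalIntegral.integral_congr heq]
    exact key.2

/-! ### Homogeneous functions and Minkowski norms -/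

section Minkowski

variable {E : Type*} [NormedAddCommGroup E] [NormedSpace ℝ E]

/-- Euler's identity. -/
lemma fderiv_self_of_homogeneous {h : E → ℝ} {y : E} (m : ℕ) (hd : DifferentiableAt ℝ h y)
    (hh : ∀ r : ℝ, 0 < r → h (r • y) = r ^ m * h y) : fderiv ℝ h y y = m * h y := by
  have h1 : HasDerivAt (fun r : ℝ => r • y) y 1 := by
    simpa using (hasDerivAt_id (1 : ℝ)).smul_const y
  have h2 : HasDerivAt (fun r : ℝ => h (r • y)) (fderiv ℝ h y y) 1 := by
    have h3 : HasFDerivAt h (fderiv ℝ h y) ((1 : ℝ) • y) := by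
      rw [one_smul]; exact hd.hasFDerivAt
    exact h3.comp_hasDerivAt (1 : ℝ) h1
  have h3 : HasDerivAt (fun r : ℝ => r ^ m * h y) (m * h y) 1 := by
    simpa using (hasDerivAt_pow m (1 : ℝ)).mul_const (h y)
  refine h2.unique (h3.congr_of_eventuallyEq ?_)
  filter_upwards [lt_mem_nhds (zero_lt_one' ℝ)] with r hr using hh r hr

lemma fderiv_homogeneous {h : E → ℝ} (m : ℕ)
    (hh : ∀ r : ℝ, 0 < r → ∀ y, h (r • y) = r ^ (m + 1) * h y) {r : ℝ} (hr : 0 < r) (y v : E) :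
    fderiv ℝ h (r • y) v = r ^ m * fderiv ℝ h y v := by
  have h1 : (fun y => h (r • y)) = fun y => r ^ (m + 1) * h y := funext (hh r hr)
  have h2 := congrArg (fun k => fderiv ℝ k y v) h1
  have h3 : fderiv ℝ (fun y => h (r • y)) y = r • fderiv ℝ h (r • y) := fderiv_comp_smul r
  have h4 : fderiv ℝ (fun y => r ^ (m + 1) * h y) y = r ^ (m + 1) • fderiv ℝ h y := by
    have := fderiv_const_smul_field (𝕜 := ℝ) (r ^ (m + 1)) (f := h)
    exact congrFun this y
  simp only [h3, h4, _root_.smul_apply, smul_eq_mul] at h2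
  apply mul_left_cancel₀ hr.ne'
  rw [h2]; ring

/-- A reversible Minkowski norm: positive, absolutely homogeneous, smooth away from `0`, with
positive definite fundamental tensor. -/
structure IsMinkowskiNorm (f : E → ℝ) : Prop where
  pos : ∀ y, y ≠ 0 → 0 < f y
  homogeneous : ∀ (r : ℝ) y, f (r • y) = |r| * f y
  smooth : ContDiffOn ℝ ∞ f {0}ᶜ
  posDef : ∀ y v, y ≠ 0 → v ≠ 0 → 0 < fderiv ℝ (fun z => fderiv ℝ (fun w => f w ^ 2) z v) y v

namespace IsMinkowskiNorm

variable {f : E → ℝ} (hf : IsMinkowskiNorm f)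
include hf

lemma contDiffAt {y : E} (hy : y ≠ 0) : ContDiffAt ℝ ∞ f y :=
  hf.smooth.contDiffAt (isOpen_compl_singleton.mem_nhds hy)

lemma differentiableAt {y : E} (hy : y ≠ 0) : DifferentiableAt ℝ f y :=
  (hf.contDiffAt hy).differentiableAt (by simp)

lemma fderiv_self {y : E} (hy : y ≠ 0) : fderiv ℝ f y y = f y := by
  have := fderiv_self_of_homogeneous 1 (hf.differentiableAt hy) fun r hr => by
    rw [hf.homogeneous, abs_of_pos hr, pow_one]
  simpa using this

lemma fderiv_sq {y : E} (hy : y ≠ 0) (v : E) :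
    fderiv ℝ (fun w => f w ^ 2) y v = 2 * f y * fderiv ℝ f y v := by
  have := ((hf.differentiableAt hy).hasFDerivAt.pow 2).fderiv
  rw [this]; simp

/-- Euler's identity for y ↦ D(f²)(y)v, which is homogeneous of degree 1. -/
lemma hessian_self {y : E} (hy : y ≠ 0) (v : E) :
    fderiv ℝ (fun z => fderiv ℝ (fun w => f w ^ 2) z v) y y =
      fderiv ℝ (fun w => f w ^ 2) y v := by
  have hd : ContDiffAt ℝ 1 (fun z => fderiv ℝ (fun w => f w ^ 2) z v) y :=
    (((hf.contDiffAt hy).pow 2).fderiv_right (m := 1) (by norm_cast)).clm_apply contDiffAt_const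
  have := fderiv_self_of_homogeneous 1 (hd.differentiableAt (by simp)) fun r hr =>
    fderiv_homogeneous (h := fun w => f w ^ 2) 1
      (fun r hr y => by rw [hf.homogeneous, abs_of_pos hr]; ring) hr y v
  simpa using this

/-- Strict convexity of f²: its graph lies strictly above the tangent plane at y, and D(f²)(y)y =
2f(y)². If the segment from y to z avoids 0, positivity of the Hessian makes the derivative along it
strictly increasing, and the mean value theorem concludes. -/
lemma fderiv_sq_lt {y z : E} (hy : y ≠ 0) (hyz : y ≠ z) :
    fderiv ℝ (fun w => f w ^ 2) y z < f y ^ 2 + f z ^ 2 := by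
  have self : fderiv ℝ (fun w => f w ^ 2) y y = 2 * f y ^ 2 := by
    rw [hf.fderiv_sq hy, hf.fderiv_self hy]; ring
  by_cases h0 : ∀ t ∈ Icc (0 : ℝ) 1, y + t • (z - y) ≠ 0
  · set v := z - y with hv
    have hv0 : v ≠ 0 := sub_ne_zero.2 hyz.symm
    have hsq : ∀ x, x ≠ 0 → ContDiffAt ℝ ∞ (fun w => f w ^ 2) x := fun x hx =>
      (hf.contDiffAt hx).pow 2
    have hl : ∀ t : ℝ, HasDerivAt (fun t : ℝ => y + t • v) v t := fun t => by
      simpa using ((hasDerivAt_id t).smul_const v).const_add y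
    have d1 : ∀ t ∈ Icc (0 : ℝ) 1, HasDerivAt (fun t : ℝ => f (y + t • v) ^ 2)
        (fderiv ℝ (fun w => f w ^ 2) (y + t • v) v) t := fun t ht => by
      have h2 := ((hsq _ (h0 t ht)).differentiableAt (by simp)).hasFDerivAt.comp_hasDerivAt t (hl t)
      exact h2
    have d2 : ∀ t ∈ Icc (0 : ℝ) 1, HasDerivAt (fun t : ℝ => fderiv ℝ (fun w => f w ^ 2) (y + t • v) v)
        (fderiv ℝ (fun z => fderiv ℝ (fun w => f w ^ 2) z v) (y + t • v) v) t := fun t ht => by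
      have : ContDiffAt ℝ 1 (fun z => fderiv ℝ (fun w => f w ^ 2) z v) (y + t • v) :=
        ((hsq _ (h0 t ht)).fderiv_right (m := 1) (by norm_cast)).clm_apply contDiffAt_const
      have h2 := (this.differentiableAt (by simp)).hasFDerivAt.comp_hasDerivAt t (hl t)
      exact h2
    have mono : StrictMonoOn (fun t : ℝ => fderiv ℝ (fun w => f w ^ 2) (y + t • v) v)
        (Icc 0 1) := by
      refine strictMonoOn_of_deriv_pos (convex_Icc 0 1)
        (fun t ht => (d2 t ht).continuousAt.continuousWithinAt) fun t ht => ?_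
      rw [interior_Icc] at ht
      rw [(d2 t (Ioo_subset_Icc_self ht)).deriv]
      exact hf.posDef _ _ (h0 t (Ioo_subset_Icc_self ht)) hv0
    obtain ⟨t, ht, h2⟩ := exists_hasDerivAt_eq_slope (fun t : ℝ => f (y + t • v) ^ 2)
      (fun t => fderiv ℝ (fun w => f w ^ 2) (y + t • v) v) zero_lt_one
      (fun t ht => (d1 t ht).continuousAt.continuousWithinAt)
      (fun t ht => d1 t (Ioo_subset_Icc_self ht))
    have h3 := mono (left_mem_Icc.2 zero_le_one) (Ioo_subset_Icc_self ht) ht.1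
    have e1 : y + v = z := by rw [hv]; abel
    simp only [h2, zero_smul, add_zero, one_smul, e1, sub_zero, div_one] at h3
    rw [hv, map_sub, self] at h3
    linarith
  -- Here f² need not be twice differentiable along the segment, but z is a nonpositive multiple of
  -- y, so the left side is at most 0.
  · push Not at h0
    obtain ⟨t, ht, h1⟩ := h0
    have ht0 : 0 < t := lt_of_le_of_ne ht.1 fun h => hy (by simpa [← h] using h1)
    have hz' : z = (-((1 - t) / t)) • y := by
      have h2 : t • z = -((1 - t) • y) := by
        rw [← sub_eq_zero, ← h1, sub_smul, smul_sub, one_smul]; abel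
      rw [neg_smul, div_eq_inv_mul, mul_smul, ← smul_neg, ← h2, inv_smul_smul₀ ht0.ne']
    have h3 : fderiv ℝ (fun w => f w ^ 2) y z ≤ 0 := by
      rw [hz', map_smul, self, smul_eq_mul]
      have : 0 ≤ (1 - t) / t := div_nonneg (by linarith [ht.2]) ht.1
      nlinarith [sq_nonneg (f y)]
    have := hf.pos y hy
    nlinarith [sq_nonneg (f z)]

/-- The fundamental inequality of Minkowski norms: rescale z to have the norm of y, then use the
strict convexity of f². If the rescaled vector is y itself, equality holds by Euler's identity. -/
lemma fderiv_le {y z : E} (hy : y ≠ 0) (hz : z ≠ 0) : fderiv ℝ f y z ≤ f z := by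
  have py := hf.pos y hy
  have pz := hf.pos z hz
  by_cases h : y = (f y / f z) • z
  · have h1 : z = (f z / f y) • y := by
      conv_rhs => rhs; rw [h]
      rw [smul_smul, div_mul_div_cancel₀ py.ne', div_self pz.ne', one_smul]
    conv_lhs => rw [h1]
    rw [map_smul, hf.fderiv_self hy, smul_eq_mul, div_mul_cancel₀ _ py.ne']
  · have h1 := hf.fderiv_sq_lt hy h
    rw [hf.fderiv_sq hy, hf.homogeneous, map_smul, abs_of_pos (div_pos py pz),
      div_mul_cancel₀ _ pz.ne', smul_eq_mul] at h1
    have h2 : f y / f z * fderiv ℝ f y z < f y := by nlinarith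
    rw [div_mul_eq_mul_div, div_lt_iff₀ pz] at h2
    exact (lt_of_mul_lt_mul_left h2 py.le).le

/-- Injectivity of the Legendre transformation of `f ^ p` for `p ≠ 1`. -/
lemma eq_of_legendre_eq {p : ℝ} (hp : p ≠ 1) {y z : E} (hy : y ≠ 0) (hz : z ≠ 0)
    (h : ∀ v, f y ^ (p - 1) * fderiv ℝ f y v = f z ^ (p - 1) * fderiv ℝ f z v) : y = z := by
  have py := hf.pos y hy
  have pz := hf.pos z hz
  -- Evaluate at v = y: f(y)^(p-1) f(y) = f(z)^(p-1) Df(z)y ≤ f(z)^(p-1) f(y). By symmetry the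
  -- powers agree, and p ≠ 1 lets the norms be recovered from them.
  have hle : ∀ {y z : E}, y ≠ 0 → z ≠ 0 →
      (∀ v, f y ^ (p - 1) * fderiv ℝ f y v = f z ^ (p - 1) * fderiv ℝ f z v) →
      f y ^ (p - 1) ≤ f z ^ (p - 1) := by
    intro y z hy hz h
    have h1 := h y
    rw [hf.fderiv_self hy] at h1
    have h2 := mul_le_mul_of_nonneg_left (hf.fderiv_le hz hy)
      (Real.rpow_nonneg (hf.pos z hz).le (p - 1))
    rw [← h1] at h2
    exact le_of_mul_le_mul_right h2 (hf.pos y hy)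
  have he : f y ^ (p - 1) = f z ^ (p - 1) :=
    le_antisymm (hle hy hz h) (hle hz hy fun v => (h v).symm)
  have hyz : f y = f z := (Real.rpow_left_inj py.le pz.le (sub_ne_zero.2 hp)).1 he
  by_contra hne
  -- The norms are equal and Df(z)y = f(y), the equality case that strict convexity excludes for
  -- distinct vectors.
  have h1 := hf.fderiv_sq_lt hz (Ne.symm hne)
  have h2 : fderiv ℝ f z y = f y := by
    have := h y
    rw [he, hf.fderiv_self hy] at this
    exact (mul_left_cancel₀ (Real.rpow_pos_of_pos pz _).ne' this).symm
  rw [hf.fderiv_sq hz, h2, hyz] at h1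
  nlinarith

end IsMinkowskiNorm

end Minkowski

/-! ### Finsler metrics in charts -/

section Charts

variable {n : ℕ} {M : Type*} [TopologicalSpace M] [ChartedSpace (Model n) M]
  [IsManifold (𝓡 n) ∞ M] (F : FinslerMetric n M) {e : OpenPartialHomeomorph M (Model n)}

lemma mdifferentiable_of_mem_maximalAtlas (he : e ∈ IsManifold.maximalAtlas (𝓡 n) ∞ M) :
    e.MDifferentiable (𝓡 n) (𝓡 n) :=
  ⟨(contMDiffOn_of_mem_maximalAtlas he).mdifferentiableOn (by simp),
    (contMDiffOn_symm_of_mem_maximalAtlas he).mdifferentiableOn (by simp)⟩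

lemma tangentMap_of_eventuallyEq_id {f : M → M} {x : M} (hf : f =ᶠ[nhds x] id)
    (v : TangentSpace (𝓡 n) x) : tangentMap (𝓡 n) (𝓡 n) f ⟨x, v⟩ = ⟨x, v⟩ := by
  have h1 : (mfderiv (𝓡 n) (𝓡 n) f x : Model n →L[ℝ] Model n) = ContinuousLinearMap.id ℝ (Model n) :=
    hf.mfderiv_eq.trans mfderiv_id
  have h2 : mfderiv (𝓡 n) (𝓡 n) f x v = (v : Model n) := congrArg (fun k => k v) h1
  exact Bundle.TotalSpace.ext hf.eq_of_nhds (heq_of_eq h2)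

/-- The tangent map of `e.symm ∘ e` is the identity over the chart domain. -/
lemma toFun_eq_localF (he : e ∈ IsManifold.maximalAtlas (𝓡 n) ∞ M) {x : M} (hx : x ∈ e.source)
    (v : TangentSpace (𝓡 n) x) :
    F.toFun ⟨x, v⟩ = localF F e (e x) (mfderiv (𝓡 n) 𝓘(ℝ, Model n) e x v) := by
  have h1 : MDifferentiableAt (𝓡 n) 𝓘(ℝ, Model n) e x :=
    (mdifferentiable_of_mem_maximalAtlas he).mdifferentiableAt hx
  have h2 : MDifferentiableAt 𝓘(ℝ, Model n) (𝓡 n) e.symm (e x) :=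
    (mdifferentiable_of_mem_maximalAtlas he).mdifferentiableAt_symm (e.map_source hx)
  have key := tangentMap_of_eventuallyEq_id (f := e.symm ∘ e)
    (Filter.eventually_of_mem (e.open_source.mem_nhds hx) fun y hy => e.left_inv hy) v
  have h3 : tangentMap (𝓡 n) (𝓡 n) (e.symm ∘ e) ⟨x, v⟩ = ⟨e.symm (e x),
      mfderiv 𝓘(ℝ, Model n) (𝓡 n) e.symm (e x) (mfderiv (𝓡 n) 𝓘(ℝ, Model n) e x v)⟩ := by
    simp only [tangentMap, mfderiv_comp x h2 h1]
    rfl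
  rw [h3] at key
  exact congrArg F.toFun key.symm

lemma mfderiv_chart_eq_zero_iff (he : e ∈ IsManifold.maximalAtlas (𝓡 n) ∞ M) {x : M}
    (hx : x ∈ e.source) (v : TangentSpace (𝓡 n) x) :
    mfderiv (𝓡 n) 𝓘(ℝ, Model n) e x v = 0 ↔ v = 0 :=
  map_eq_zero_iff _ ((mdifferentiable_of_mem_maximalAtlas he).mfderiv_injective hx)

/-- `F` in a chart as a function on `ℝⁿ × ℝⁿ`. -/
def chartF (e : OpenPartialHomeomorph M (Model n)) (z : Model n × Model n) : ℝ :=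
  localF F e z.1 z.2

/-- The coordinate domain of `TM ∖ 0`. -/
def slitTarget (e : OpenPartialHomeomorph M (Model n)) : Set (Model n × Model n) :=
  e.target ×ˢ {0}ᶜ

lemma isOpen_slitTarget : IsOpen (slitTarget e) := e.open_target.prod isOpen_compl_singleton

lemma contDiffOn_chartF (he : e ∈ IsManifold.maximalAtlas (𝓡 n) ∞ M) :
    ContDiffOn ℝ ∞ (chartF F e) (slitTarget e) := by
  rw [← contMDiffOn_iff_contDiffOn]
  have h1 := (contMDiffOn_symm_of_mem_maximalAtlas he).contMDiffOn_tangentMapWithin (m := ∞)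
    (by simp) (e.open_target.uniqueMDiffOn)
  have h2 := contMDiff_tangentBundleModelSpaceHomeomorph_symm (I := 𝓡 n) (n := ∞)
  have h3 : ContMDiffOn (M := ModelProd (Model n) (Model n)) (𝓡 n).tangent 𝓘(ℝ, ℝ) ∞ (chartF F e)
      (slitTarget e) := by
    have h4 : MapsTo ((tangentBundleModelSpaceHomeomorph (𝓡 n)).symm :
        ModelProd (Model n) (Model n) → TangentBundle (𝓡 n) (Model n)) (slitTarget e)
        (Bundle.TotalSpace.proj ⁻¹' e.target) := fun z hz => hz.1
    have hw : ∀ z ∈ slitTarget e, mfderivWithin 𝓘(ℝ, Model n) (𝓡 n) e.symm e.target z.1 =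
        mfderiv 𝓘(ℝ, Model n) (𝓡 n) e.symm z.1 := fun z hz =>
      mfderivWithin_of_isOpen e.open_target hz.1
    refine (F.smooth.comp (h1.comp h2.contMDiffOn h4) fun z hz => ?_).congr fun z hz => ?_
    · have h5 : mfderivWithin 𝓘(ℝ, Model n) (𝓡 n) e.symm e.target z.1 z.2 ≠ 0 := by
        rw [hw z hz]
        exact (map_ne_zero_iff _
          ((mdifferentiable_of_mem_maximalAtlas he).symm.mfderiv_injective hz.1)).2 hz.2
      exact h5
    · have h5 : (⟨e.symm z.1, mfderiv 𝓘(ℝ, Model n) (𝓡 n) e.symm z.1 z.2⟩ : TangentBundle (𝓡 n) M) =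
        ⟨e.symm z.1, mfderivWithin 𝓘(ℝ, Model n) (𝓡 n) e.symm e.target z.1 z.2⟩ := by
        rw [hw z hz]
      exact congrArg F.toFun h5
  have h6 : 𝓘(ℝ, Model n × Model n) = (𝓡 n).tangent := modelWithCornersSelf_prod
  rw [h6]
  exact h3

lemma contDiffOn_localF (he : e ∈ IsManifold.maximalAtlas (𝓡 n) ∞ M) {x : Model n}
    (hx : x ∈ e.target) : ContDiffOn ℝ ∞ (localF F e x) {0}ᶜ :=
  (contDiffOn_chartF F he).comp (f := fun y => (x, y)) (by fun_prop) fun y hy => ⟨hx, hy⟩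

/-- The differential of `e.symm` is a linear isomorphism B, and the Hessian of a function composed
with B is its Hessian evaluated at B-images, so positive definiteness is transported. -/
lemma isMinkowskiNorm_localF (he : e ∈ IsManifold.maximalAtlas (𝓡 n) ∞ M) {x : Model n}
    (hx : x ∈ e.target) :
    IsMinkowskiNorm (localF F e x) := by
  have hd := (mdifferentiable_of_mem_maximalAtlas he).symm
  let B : Model n ≃L[ℝ] Model n := hd.mfderiv hx
  have hB : ∀ y, localF F e x y = F.toFun ⟨e.symm x, B y⟩ := fun y => rfl
  have hB0 : ∀ y, y ≠ 0 → B y ≠ 0 := fun y hy => by simpa using hy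
  refine ⟨fun y hy => F.pos _ _ (hB0 y hy), fun r y => ?_, contDiffOn_localF F he hx, fun y v hy hv => ?_⟩
  · rw [hB, map_smul]; exact F.homogeneous _ _ _
  · have h := F.posDef (e.symm x) (B y) (B v) (hB0 y hy) (hB0 v hv)
    let Q : Model n → ℝ := fun w => F.toFun ⟨e.symm x, w⟩ ^ 2
    have h1 : ∀ z v : Model n, fderiv ℝ (fun w => localF F e x w ^ 2) z v = fderiv ℝ Q (B z) (B v) := by
      intro z v
      exact congrArg (fun k => k v) (B.comp_right_fderiv (f := Q) (x := z))
    simp only [h1]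
    have h2 : fderiv ℝ (fun z => fderiv ℝ Q (B z) (B v)) y v =
        fderiv ℝ (fun z => fderiv ℝ Q z (B v)) (B y) (B v) :=
      congrArg (fun k => k v) (B.comp_right_fderiv (f := fun z => fderiv ℝ Q z (B v)) (x := y))
    rw [h2]
    have h3 : (0 : ℝ) < (1 / 2) * fderiv ℝ (fun z => fderiv ℝ Q z (B v)) (B y) (B v) := h
    linarith

lemma isMinkowskiNorm_toFun (x : M) : IsMinkowskiNorm fun w : Model n => F.toFun ⟨x, w⟩ := by
  -- Smoothness is assumed on the total space of TM; a chart turns it into smoothness on a single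
  -- fibre.
  have he : chartAt (Model n) x ∈ IsManifold.maximalAtlas (𝓡 n) ∞ M :=
    IsManifold.chart_mem_maximalAtlas x
  have hx := mem_chart_source (Model n) x
  have hd := mdifferentiable_of_mem_maximalAtlas he
  let A : Model n ≃L[ℝ] Model n := hd.mfderiv hx
  refine ⟨F.pos x, fun r y => F.homogeneous x y r, ?_, fun y v hy hv => ?_⟩
  · have h1 : ContDiffOn ℝ ∞ (fun w => localF F (chartAt (Model n) x) (chartAt (Model n) x x) (A w))
        {0}ᶜ :=
      (contDiffOn_localF F he (OpenPartialHomeomorph.map_source _ hx)).comp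
        A.contDiff.contDiffOn fun w hw => by simpa using hw
    exact h1.congr fun w _ => toFun_eq_localF F he hx w
  · have h3 : (0 : ℝ) < (1 / 2) * fderiv ℝ (fun z : Model n => fderiv ℝ (fun w : Model n =>
      F.toFun ⟨x, w⟩ ^ 2) z v) y v := F.posDef x y v hy hv
    linarith

/-- Euler's identity twice: ½ D²(F²)(y, y) = ½ D(F²)y = F². This makes the integrand of E_p equal to
F^p. -/
lemma fundamentalTensor_self (x : M) {y : TangentSpace (𝓡 n) x} (hy : y ≠ 0) :
    fundamentalTensor F.toFun x y y y = F.toFun ⟨x, y⟩ ^ 2 := by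
  have h := isMinkowskiNorm_toFun F x
  have h1 : ∀ z : Model n, z ≠ 0 → (1 / 2) * fderiv ℝ (fun z' : Model n =>
      fderiv ℝ (fun w : Model n => F.toFun ⟨x, w⟩ ^ 2) z' z) z z = F.toFun ⟨x, z⟩ ^ 2 := by
    intro z hz
    rw [h.hessian_self hz, h.fderiv_sq hz, h.fderiv_self hz]; ring
  exact h1 y hy

lemma fderiv_toFun (he : e ∈ IsManifold.maximalAtlas (𝓡 n) ∞ M) {x : M} (hx : x ∈ e.source)
    {y : TangentSpace (𝓡 n) x} (hy : y ≠ 0) (v : TangentSpace (𝓡 n) x) :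
    fderiv ℝ (fun w : TangentSpace (𝓡 n) x => F.toFun ⟨x, w⟩) y v =
      fderiv ℝ (localF F e (e x)) (mfderiv (𝓡 n) 𝓘(ℝ, Model n) e x y)
        (mfderiv (𝓡 n) 𝓘(ℝ, Model n) e x v) := by
  let A : Model n →L[ℝ] Model n := mfderiv (𝓡 n) 𝓘(ℝ, Model n) e x
  have hAy : A y ≠ 0 := (mfderiv_chart_eq_zero_iff he hx y).not.2 hy
  have h1 : (fun w : TangentSpace (𝓡 n) x => F.toFun ⟨x, w⟩) =
      fun w : Model n => localF F e (e x) (A w) :=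
    funext fun w => toFun_eq_localF F he hx w
  have h2 : ∀ z : Model n, A z ≠ 0 → fderiv ℝ (fun w : Model n => localF F e (e x) (A w)) z =
      (fderiv ℝ (localF F e (e x)) (A z)).comp A := fun z hz =>
    (((isMinkowskiNorm_localF F he (e.map_source hx)).differentiableAt
      hz).hasFDerivAt.comp z A.hasFDerivAt).fderiv
  rw [h1]
  exact congrArg (fun f => f v) (h2 y hAy)

lemma mfderiv_chart_velocity (he : e ∈ IsManifold.maximalAtlas (𝓡 n) ∞ M) {c : ℝ → M} {S : Set ℝ}
    {t : ℝ} (hx : c t ∈ e.source) (hc : MDifferentiableWithinAt 𝓘(ℝ, ℝ) (𝓡 n) c S t)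
    (hS : UniqueDiffWithinAt ℝ S t) :
    mfderiv (𝓡 n) 𝓘(ℝ, Model n) e (c t) (velocity n c S t) = derivWithin (fun r => e (c r)) S t := by
  have h1 := mfderiv_comp_mfderivWithin t
    ((mdifferentiable_of_mem_maximalAtlas he).mdifferentiableAt hx) hc hS.uniqueMDiffWithinAt
  rw [mfderivWithin_eq_fderivWithin] at h1
  exact (congrArg (fun k : ℝ →L[ℝ] Model n => k 1) h1).symm

lemma toFun_velocity (he : e ∈ IsManifold.maximalAtlas (𝓡 n) ∞ M) {c : ℝ → M} {S : Set ℝ}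
    {t : ℝ} (hx : c t ∈ e.source) (hc : MDifferentiableWithinAt 𝓘(ℝ, ℝ) (𝓡 n) c S t)
    (hS : UniqueDiffWithinAt ℝ S t) :
    F.toFun ⟨c t, velocity n c S t⟩ = chartF F e (e (c t), derivWithin (fun r => e (c r)) S t) := by
  rw [toFun_eq_localF F he hx, mfderiv_chart_velocity he hx hc hS]
  rfl

lemma velocity_ne_zero_iff (he : e ∈ IsManifold.maximalAtlas (𝓡 n) ∞ M) {c : ℝ → M} {S : Set ℝ}
    {t : ℝ} (hx : c t ∈ e.source) (hc : MDifferentiableWithinAt 𝓘(ℝ, ℝ) (𝓡 n) c S t)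
    (hS : UniqueDiffWithinAt ℝ S t) :
    velocity n c S t ≠ 0 ↔ derivWithin (fun r => e (c r)) S t ≠ 0 := by
  rw [← mfderiv_chart_velocity he hx hc hS]
  exact (mfderiv_chart_eq_zero_iff he hx _).not.symm

end Charts

/-! ### The geodesic equation in coordinates -/

section Partials

variable {n : ℕ}

lemma sum_apply_single (L : Model n →L[ℝ] ℝ) (v : Model n) :
    ∑ k, v k * L (EuclideanSpace.single k 1) = L v := by
  have h : v = ∑ k, v k • (EuclideanSpace.single k (1 : ℝ) : Model n) := by
    ext i
    simp [Finset.sum_apply, Pi.single_apply]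
  conv_rhs => rw [h]
  simp [map_sum]

lemma fderiv_apply_fst {h : Model n × Model n → ℝ} {z : Model n × Model n}
    (hd : DifferentiableAt ℝ h z) (v : Model n) :
    fderiv ℝ h z (v, 0) = fderiv ℝ (fun x => h (x, z.2)) z.1 v := by
  have h1 : HasFDerivAt (fun x : Model n => (x, z.2)) (ContinuousLinearMap.inl ℝ _ _) z.1 :=
    hasFDerivAt_prodMk_left z.1 z.2
  have h2 := (HasFDerivAt.comp (g := h) z.1 hd.hasFDerivAt h1).fderiv
  exact (congrArg (fun k => k v) h2).symm

lemma fderiv_apply_snd {h : Model n × Model n → ℝ} {z : Model n × Model n}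
    (hd : DifferentiableAt ℝ h z) (v : Model n) :
    fderiv ℝ h z (0, v) = fderiv ℝ (fun y => h (z.1, y)) z.2 v := by
  have h1 : HasFDerivAt (fun y : Model n => (z.1, y)) (ContinuousLinearMap.inr ℝ _ _) z.2 :=
    hasFDerivAt_prodMk_right z.1 z.2
  have h2 := (HasFDerivAt.comp (g := h) z.2 hd.hasFDerivAt h1).fderiv
  exact (congrArg (fun k => k v) h2).symm

lemma fderiv_apply_eq_add {h : Model n × Model n → ℝ} {z : Model n × Model n} (v w : Model n) :
    fderiv ℝ h z (v, w) = fderiv ℝ h z (v, 0) + fderiv ℝ h z (0, w) := by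
  rw [← map_add]; simp

variable {U : Set (Model n × Model n)} (hU : IsOpen U) {f : Model n → Model n → ℝ}
  (hf : ContDiffOn ℝ ∞ (fun z : Model n × Model n => f z.1 z.2) U)
include hU hf

lemma pdx_eq (i : Fin n) {z : Model n × Model n} (hz : z ∈ U) :
    pdx i f z.1 z.2 = fderiv ℝ (fun z : Model n × Model n => f z.1 z.2) z
      (EuclideanSpace.single i 1, 0) :=
  (fderiv_apply_fst ((hf.contDiffAt (hU.mem_nhds hz)).differentiableAt (by simp)) _).symm

lemma pdy_eq (i : Fin n) {z : Model n × Model n} (hz : z ∈ U) :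
    pdy i f z.1 z.2 = fderiv ℝ (fun z : Model n × Model n => f z.1 z.2) z
      (0, EuclideanSpace.single i 1) :=
  (fderiv_apply_snd ((hf.contDiffAt (hU.mem_nhds hz)).differentiableAt (by simp)) _).symm

lemma contDiffOn_fderiv_apply (w : Model n × Model n) :
    ContDiffOn ℝ ∞ (fun z => fderiv ℝ (fun z : Model n × Model n => f z.1 z.2) z w) U :=
  (hf.fderiv_of_isOpen hU (by simp)).clm_apply contDiffOn_const

lemma contDiffOn_pdx (i : Fin n) :
    ContDiffOn ℝ ∞ (fun z : Model n × Model n => pdx i f z.1 z.2) U :=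
  (contDiffOn_fderiv_apply hU hf _).congr fun _ hz => pdx_eq hU hf i hz

lemma contDiffOn_pdy (i : Fin n) :
    ContDiffOn ℝ ∞ (fun z : Model n × Model n => pdy i f z.1 z.2) U :=
  (contDiffOn_fderiv_apply hU hf _).congr fun _ hz => pdy_eq hU hf i hz

lemma contDiffOn_fiber (x : Model n) : ContDiffOn ℝ ∞ (f x) {y | (x, y) ∈ U} :=
  hf.comp (f := fun y => (x, y)) (by fun_prop) fun _ hy => hy

lemma pdy_comm (i j : Fin n) {z : Model n × Model n} (hz : z ∈ U) :
    pdy i (pdy j f) z.1 z.2 = pdy j (pdy i f) z.1 z.2 := by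
  have hV : IsOpen {y | (z.1, y) ∈ U} := hU.preimage (by fun_prop)
  have hc : ContDiffAt ℝ ∞ (f z.1) z.2 :=
    (contDiffOn_fiber hU hf z.1).contDiffAt (hV.mem_nhds (show (z.1, z.2) ∈ U from hz))
  have hd : DifferentiableAt ℝ (fderiv ℝ (f z.1)) z.2 :=
    (hc.fderiv_right (m := 1) (by norm_cast)).differentiableAt (by simp)
  have h1 : ∀ i j, pdy i (pdy j f) z.1 z.2 = fderiv ℝ (fderiv ℝ (f z.1)) z.2
      (EuclideanSpace.single i 1) (EuclideanSpace.single j 1) := by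
    intro i j
    have := (hd.hasFDerivAt.clm_apply (hasFDerivAt_const (EuclideanSpace.single j (1 : ℝ)) z.2)).fderiv
    have h2 := congrArg (fun k => k (EuclideanSpace.single i (1 : ℝ))) this
    simpa [pdy] using h2
  rw [h1, h1]
  exact (hc.isSymmSndFDerivAt (by simp [show (2 : ℕ∞ω) ≤ ∞ from by norm_cast])) _ _

end Partials

/-! ### Smoothness of determinants and inverse matrices. -/

lemma contDiffOn_det {E : Type*} [NormedAddCommGroup E] [NormedSpace ℝ E] {n : ℕ} {U : Set E}
    {A : E → Matrix (Fin n) (Fin n) ℝ} (hA : ∀ i j, ContDiffOn ℝ ∞ (fun z => A z i j) U) :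
    ContDiffOn ℝ ∞ (fun z => (A z).det) U := by
  simp only [Matrix.det_apply]
  refine ContDiffOn.sum fun σ _ => ContDiffOn.const_smul _ ?_
  exact contDiffOn_prod fun i _ => hA _ _

/-- Cramer's rule: the entries of the inverse are cofactors divided by the determinant. -/
lemma contDiffOn_inv_apply {E : Type*} [NormedAddCommGroup E] [NormedSpace ℝ E] {n : ℕ} {U : Set E}
    {A : E → Matrix (Fin n) (Fin n) ℝ} (hA : ∀ i j, ContDiffOn ℝ ∞ (fun z => A z i j) U)
    (hdet : ∀ z ∈ U, (A z).det ≠ 0) (i j : Fin n) : ContDiffOn ℝ ∞ (fun z => (A z)⁻¹ i j) U := by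
  simp only [Matrix.inv_def, Matrix.smul_apply, smul_eq_mul, Ring.inverse_eq_inv',
    Matrix.adjugate_apply]
  refine ((contDiffOn_det hA).inv hdet).mul (contDiffOn_det fun k l => ?_)
  simp only [Matrix.updateRow_apply]
  split_ifs
  · exact contDiffOn_const
  · exact hA k l

/-! ### Contractions of the Cartan connection with y. -/

section Cartan

variable {n : ℕ} {M : Type*} [TopologicalSpace M] [ChartedSpace (Model n) M]
  [IsManifold (𝓡 n) ∞ M] (F : FinslerMetric n M) {e : OpenPartialHomeomorph M (Model n)}
  (he : e ∈ IsManifold.maximalAtlas (𝓡 n) ∞ M)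
include he

lemma contDiffOn_localF_sq :
    ContDiffOn ℝ ∞ (fun z : Model n × Model n => localF F e z.1 z.2 ^ 2) (slitTarget e) :=
  (contDiffOn_chartF F he).pow 2

lemma contDiffOn_gLower (i j : Fin n) :
    ContDiffOn ℝ ∞ (fun z : Model n × Model n => gLower F e i j z.1 z.2) (slitTarget e) :=
  contDiffOn_const.mul (contDiffOn_pdy isOpen_slitTarget
    (contDiffOn_pdy (f := fun x y => localF F e x y ^ 2) isOpen_slitTarget
      (contDiffOn_localF_sq F he) j) i)

lemma gLower_comm (i j : Fin n) {z : Model n × Model n} (hz : z ∈ slitTarget e) :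
    gLower F e i j z.1 z.2 = gLower F e j i z.1 z.2 := by
  simp only [gLower]
  rw [pdy_comm (f := fun x y => localF F e x y ^ 2) isOpen_slitTarget
    (contDiffOn_localF_sq F he) i j hz]

lemma pdx_congr {f g : Model n → Model n → ℝ} {z : Model n × Model n} (hz : z ∈ slitTarget e)
    (h : ∀ w ∈ slitTarget e, f w.1 w.2 = g w.1 w.2) (i : Fin n) :
    pdx i f z.1 z.2 = pdx i g z.1 z.2 := by
  have : (fun x => f x z.2) =ᶠ[nhds z.1] fun x => g x z.2 :=
    Filter.eventually_of_mem (e.open_target.mem_nhds hz.1) fun x hx => h (x, z.2) ⟨hx, hz.2⟩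
  simp only [pdx, this.fderiv_eq]

lemma pdy_congr {f g : Model n → Model n → ℝ} {z : Model n × Model n} (hz : z ∈ slitTarget e)
    (h : ∀ w ∈ slitTarget e, f w.1 w.2 = g w.1 w.2) (i : Fin n) :
    pdy i f z.1 z.2 = pdy i g z.1 z.2 := by
  have : (fun y => f z.1 y) =ᶠ[nhds z.2] fun y => g z.1 y :=
    Filter.eventually_of_mem (isOpen_compl_singleton.mem_nhds hz.2) fun y hy => h (z.1, y) ⟨hz.1, hy⟩
  simp only [pdy, this.fderiv_eq]

/-- Total symmetry of the Cartan tensor: ∂g_ij/∂y^k is half a third y-derivative of F². -/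
lemma pdy_gLower_rotate (i j k : Fin n) {z : Model n × Model n} (hz : z ∈ slitTarget e) :
    pdy k (gLower F e i j) z.1 z.2 = pdy i (gLower F e k j) z.1 z.2 := by
  have hp := contDiffOn_pdy (f := fun x y => localF F e x y ^ 2) isOpen_slitTarget
    (contDiffOn_localF_sq F he) j
  have h1 : ∀ i k, pdy k (gLower F e i j) z.1 z.2 =
      (1 / 2) * pdy k (pdy i (pdy j fun x y => localF F e x y ^ 2)) z.1 z.2 := by
    intro i k
    have hd : DifferentiableAt ℝ (fun y => pdy i (pdy j fun x y => localF F e x y ^ 2) z.1 y) z.2 :=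
      ((contDiffOn_fiber isOpen_slitTarget (contDiffOn_pdy isOpen_slitTarget hp i) z.1).contDiffAt
        ((isOpen_slitTarget.preimage (by fun_prop)).mem_nhds
          (show (z.1, z.2) ∈ slitTarget e from hz))).differentiableAt (by simp)
    have := congrArg (fun L => L (EuclideanSpace.single k (1 : ℝ)))
      (hd.hasFDerivAt.const_mul (1 / 2)).fderiv
    exact this
  rw [h1, h1, pdy_comm isOpen_slitTarget hp k i hz]

lemma pdy_gLower_comm (i j k : Fin n) {z : Model n × Model n} (hz : z ∈ slitTarget e) :
    pdy k (gLower F e i j) z.1 z.2 = pdy k (gLower F e j i) z.1 z.2 :=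
  pdy_congr he hz (fun _ hw => gLower_comm F he i j hw) k

/-- Euler's identity in degree 0: g_ij is a second derivative of a function of degree 2. -/
lemma sum_pdy_gLower (i j : Fin n) {z : Model n × Model n} (hz : z ∈ slitTarget e) :
    ∑ k, z.2 k * pdy k (gLower F e i j) z.1 z.2 = 0 := by
  have hm := isMinkowskiNorm_localF F he hz.1
  have hd : DifferentiableAt ℝ (fun y => gLower F e i j z.1 y) z.2 :=
    ((contDiffOn_fiber isOpen_slitTarget (contDiffOn_gLower F he i j) z.1).contDiffAt
      ((isOpen_slitTarget.preimage (by fun_prop)).mem_nhds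
        (show (z.1, z.2) ∈ slitTarget e from hz))).differentiableAt (by simp)
  have h1 := fderiv_self_of_homogeneous 0 hd fun r hr => by
    have h2 : ∀ r : ℝ, 0 < r → ∀ y, pdy j (fun x y => localF F e x y ^ 2) z.1 (r • y) =
        r ^ 1 * pdy j (fun x y => localF F e x y ^ 2) z.1 y := fun r hr y =>
      fderiv_homogeneous 1 (h := fun y => localF F e z.1 y ^ 2)
        (fun r hr y => by rw [hm.homogeneous, abs_of_pos hr]; ring) hr y _
    have h3 := fderiv_homogeneous 0 (by simpa using h2) hr z.2 (EuclideanSpace.single i (1 : ℝ))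
    rw [pow_zero, one_mul] at h3 ⊢
    exact congrArg (fun t => (1 / 2 : ℝ) * t) h3
  rw [Nat.cast_zero, zero_mul] at h1
  rw [← h1, ← sum_apply_single]
  rfl

/-- By total symmetry the three terms of the Christoffel expression collapse to one, which y
annihilates. -/
lemma sum_cartanC (i k : Fin n) {z : Model n × Model n} (hz : z ∈ slitTarget e) :
    ∑ m, z.2 m * cartanC F e i m k z.1 z.2 = 0 := by
  have key : ∀ l, ∑ m, z.2 m * (pdy m (gLower F e l k) z.1 z.2 + pdy k (gLower F e m l) z.1 z.2
      - pdy l (gLower F e m k) z.1 z.2) = 0 := by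
    intro l
    have h : ∀ m, z.2 m * (pdy m (gLower F e l k) z.1 z.2 + pdy k (gLower F e m l) z.1 z.2
      - pdy l (gLower F e m k) z.1 z.2) = z.2 m * pdy m (gLower F e k l) z.1 z.2 := by
      intro m
      rw [pdy_gLower_rotate F he m l k hz, pdy_gLower_rotate F he m k l hz]
      ring
    simp only [h]
    exact sum_pdy_gLower F he k l hz
  simp only [cartanC]
  calc _ = (1 / 2) * ∑ l, gUpper F e i l z.1 z.2 * ∑ m, z.2 m * (pdy m (gLower F e l k) z.1 z.2 +
        pdy k (gLower F e m l) z.1 z.2 - pdy l (gLower F e m k) z.1 z.2) := by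
        simp only [Finset.mul_sum]
        rw [Finset.sum_comm]
        refine Finset.sum_congr rfl fun l _ => Finset.sum_congr rfl fun m _ => by ring
    _ = 0 := by simp [key]

/-- The correction y^k N^j_m ∂g_lk/∂y^j vanishes: symmetry moves the y-derivative onto the index
contracted with y. Hence the nonlinear connection disappears from the geodesic equation. -/
lemma sum_deltaX (l m : Fin n) {z : Model n × Model n} (hz : z ∈ slitTarget e) :
    ∑ k, z.2 k * deltaX F e m (gLower F e l k) z.1 z.2 =
      ∑ k, z.2 k * pdx m (gLower F e l k) z.1 z.2 := by
  have h : ∑ k, z.2 k * ∑ j, nonlinearConn F e j m z.1 z.2 * pdy j (gLower F e l k) z.1 z.2 = 0 := by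
    calc _ = ∑ j, nonlinearConn F e j m z.1 z.2 *
          ∑ k, z.2 k * pdy k (gLower F e j l) z.1 z.2 := by
          simp only [Finset.mul_sum]
          rw [Finset.sum_comm]
          refine Finset.sum_congr rfl fun j _ => Finset.sum_congr rfl fun k _ => ?_
          rw [pdy_gLower_comm F he l k j hz, pdy_gLower_rotate F he k l j hz]
          ring
      _ = 0 := by simp [sum_pdy_gLower F he _ _ hz]
  simp only [deltaX, mul_sub, Finset.sum_sub_distrib, h, sub_zero]

lemma sum_cartanL (i : Fin n) {z : Model n × Model n} (hz : z ∈ slitTarget e) :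
    ∑ m, z.2 m * ∑ k, cartanL F e i m k z.1 z.2 * z.2 k = christoffel00 F e i z.1 z.2 := by
  -- `D` stands for either δ/δx or ∂/∂x, so L and Γ are contracted by one computation. In every
  -- resulting term a metric index is contracted with y, which is where δ/δx may be replaced by
  -- ∂/∂x.
  have split : ∀ D : Fin n → (Model n → Model n → ℝ) → ℝ, (∑ m, ∑ k, z.2 m * z.2 k *
      (1 / 2 * ∑ l, gUpper F e i l z.1 z.2 * (D m (gLower F e l k) + D k (gLower F e m l)
        - D l (gLower F e m k)))) = ∑ l, 1 / 2 * gUpper F e i l z.1 z.2 *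
      ((∑ m, z.2 m * ∑ k, z.2 k * D m (gLower F e l k)) +
        (∑ k, z.2 k * ∑ m, z.2 m * D k (gLower F e m l)) -
        ∑ m, z.2 m * ∑ k, z.2 k * D l (gLower F e m k)) := by
    intro D
    have h1 : ∀ l, (∑ k, z.2 k * ∑ m, z.2 m * D k (gLower F e m l)) =
        ∑ m, ∑ k, z.2 k * (z.2 m * D k (gLower F e m l)) := fun l => by
      simp only [Finset.mul_sum]
      rw [Finset.sum_comm]
    simp only [h1]
    simp only [Finset.mul_sum, ← Finset.sum_add_distrib, ← Finset.sum_sub_distrib]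
    rw [Finset.sum_comm' (t' := Finset.univ) (s' := fun _ => Finset.univ) (by simp)]
    rw [Finset.sum_congr rfl fun k _ => Finset.sum_comm]
    rw [Finset.sum_comm]
    refine Finset.sum_congr rfl fun l _ => ?_
    rw [Finset.sum_comm]
    refine Finset.sum_congr rfl fun m _ => Finset.sum_congr rfl fun k _ => by ring
  have hsym : ∀ k l, ∑ m, z.2 m * deltaX F e k (gLower F e m l) z.1 z.2 =
      ∑ m, z.2 m * pdx k (gLower F e m l) z.1 z.2 := by
    intro k l
    have h : ∑ m, z.2 m * pdx k (gLower F e m l) z.1 z.2 = ∑ m, z.2 m * pdx k (gLower F e l m) z.1 z.2 :=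
      Finset.sum_congr rfl fun m _ => by rw [pdx_congr he hz fun _ hw => gLower_comm F he m l hw]
    rw [h, ← sum_deltaX F he l k hz]
    refine Finset.sum_congr rfl fun m _ => ?_
    simp only [deltaX]
    rw [pdx_congr he hz (fun _ hw => gLower_comm F he m l hw)]
    simp only [pdy_gLower_comm F he m l _ hz]
  calc _ = ∑ m, ∑ k, z.2 m * z.2 k * cartanL F e i m k z.1 z.2 := by
        simp only [Finset.mul_sum]
        refine Finset.sum_congr rfl fun m _ => Finset.sum_congr rfl fun k _ => by ring
    _ = ∑ m, ∑ k, z.2 m * z.2 k * christoffel F e i m k z.1 z.2 := by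
        simp only [cartanL, christoffel]
        rw [split fun m f => deltaX F e m f z.1 z.2, split fun m f => pdx m f z.1 z.2]
        simp only [sum_deltaX F he _ _ hz, hsym]
    _ = _ := by
        simp only [christoffel00]
        refine Finset.sum_congr rfl fun m _ => Finset.sum_congr rfl fun k _ => by ring

/-- On velocity fields the covariant derivative is `ü + Γ₀₀(u, u̇)`. -/
lemma covDeriv_velocity {S : Set ℝ} {u : ℝ → Model n} {t : ℝ}
    (hz : (u t, derivWithin u S t) ∈ slitTarget e) (i : Fin n) :
    covDeriv F e S u (derivWithin u S) i t =
      derivWithin (derivWithin u S) S t i + christoffel00 F e i (u t) (derivWithin u S t) := by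
  have h1 := sum_cartanL F he i hz
  have h2 : ∀ w : Fin n → ℝ, ∑ m, derivWithin u S t m *
      ∑ k, cartanC F e i m k (u t) (derivWithin u S t) * w k = 0 := by
    intro w
    have h3 : ∀ k, ∑ m, derivWithin u S t m * cartanC F e i m k (u t) (derivWithin u S t) = 0 :=
      fun k => sum_cartanC F he i k hz
    calc _ = ∑ k, (∑ m, derivWithin u S t m * cartanC F e i m k (u t) (derivWithin u S t)) * w k := by
          simp only [Finset.mul_sum, Finset.sum_mul]
          rw [Finset.sum_comm]
          refine Finset.sum_congr rfl fun k _ => Finset.sum_congr rfl fun m _ => by ring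
      _ = 0 := by simp [h3]
  simp only [covDeriv, Finset.sum_add_distrib, mul_add, h2, add_zero]
  simp only at h1
  rw [← h1]

/-- `hessian_self` in coordinates: ∂F²/∂y^j = 2 g_jk y^k. -/
lemma fderiv_localF_sq_snd (j : Fin n) {z : Model n × Model n} (hz : z ∈ slitTarget e) :
    fderiv ℝ (fun z => chartF F e z ^ 2) z (0, EuclideanSpace.single j 1) =
      2 * ∑ k, z.2 k * gLower F e j k z.1 z.2 := by
  have hm := isMinkowskiNorm_localF F he hz.1
  have h0 : DifferentiableAt ℝ (fun z => chartF F e z ^ 2) z :=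
    ((contDiffOn_localF_sq F he).contDiffAt (isOpen_slitTarget.mem_nhds hz)).differentiableAt (by simp)
  rw [fderiv_apply_snd h0]
  have h1 := hm.hessian_self hz.2 (EuclideanSpace.single j (1 : ℝ))
  have h2 : ∀ k, gLower F e j k z.1 z.2 = 1 / 2 * fderiv ℝ (fun y => fderiv ℝ
      (fun w => localF F e z.1 w ^ 2) y (EuclideanSpace.single j 1)) z.2
        (EuclideanSpace.single k 1) := fun k => gLower_comm F he j k hz
  have h3 : fderiv ℝ (fun y => chartF F e (z.1, y) ^ 2) z.2 (EuclideanSpace.single j 1) =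
    fderiv ℝ (fun w => localF F e z.1 w ^ 2) z.2 (EuclideanSpace.single j 1) := rfl
  rw [h3, ← h1, ← sum_apply_single, Finset.mul_sum]
  refine Finset.sum_congr rfl fun k _ => ?_
  rw [h2]; ring

lemma chartF_sq_eq {z : Model n × Model n} (hz : z ∈ slitTarget e) :
    chartF F e z ^ 2 = ∑ j, ∑ k, z.2 j * (z.2 k * gLower F e j k z.1 z.2) := by
  have hm := isMinkowskiNorm_localF F he hz.1
  have h0 : DifferentiableAt ℝ (fun z => chartF F e z ^ 2) z :=
    ((contDiffOn_localF_sq F he).contDiffAt (isOpen_slitTarget.mem_nhds hz)).differentiableAt (by simp)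
  have h1 : fderiv ℝ (fun z => chartF F e z ^ 2) z (0, z.2) = 2 * chartF F e z ^ 2 := by
    rw [fderiv_apply_snd h0]
    have h3 := hm.fderiv_sq hz.2 z.2
    rw [hm.fderiv_self hz.2] at h3
    calc _ = _ := h3
      _ = _ := by simp only [chartF]; ring
  have h2 := sum_apply_single ((fderiv ℝ (fun z => chartF F e z ^ 2) z).comp
    (ContinuousLinearMap.inr ℝ (Model n) (Model n))) z.2
  simp only [ContinuousLinearMap.comp_apply, ContinuousLinearMap.inr_apply] at h2
  rw [h1] at h2
  have h3 : ∑ j, z.2 j * fderiv ℝ (fun z => chartF F e z ^ 2) z (0, EuclideanSpace.single j 1) =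
      2 * ∑ j, ∑ k, z.2 j * (z.2 k * gLower F e j k z.1 z.2) := by
    simp only [fderiv_localF_sq_snd F he _ hz, Finset.mul_sum]
    refine Finset.sum_congr rfl fun j _ => Finset.sum_congr rfl fun k _ => by ring
  linarith

lemma gLower_quadratic_pos {z : Model n × Model n} (hz : z ∈ slitTarget e) {v : Model n}
    (hv : v ≠ 0) : 0 < ∑ j, v j * ∑ k, gLower F e j k z.1 z.2 * v k := by
  have hm := isMinkowskiNorm_localF F he hz.1
  have hc : ContDiffAt ℝ ∞ (fun w => localF F e z.1 w ^ 2) z.2 := (hm.contDiffAt hz.2).pow 2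
  have hd : DifferentiableAt ℝ (fderiv ℝ (fun w => localF F e z.1 w ^ 2)) z.2 :=
    (hc.fderiv_right (m := 1) (by norm_cast)).differentiableAt (by simp)
  have h1 : ∀ a b, fderiv ℝ (fun y => fderiv ℝ (fun w => localF F e z.1 w ^ 2) y b) z.2 a =
      fderiv ℝ (fderiv ℝ (fun w => localF F e z.1 w ^ 2)) z.2 a b := by
    intro a b
    have := (hd.hasFDerivAt.clm_apply (hasFDerivAt_const b z.2)).fderiv
    have h2 := congrArg (fun k => k a) this
    simpa using h2
  have hpos := hm.posDef z.2 v hz.2 hv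
  rw [h1] at hpos
  set H := fderiv ℝ (fderiv ℝ (fun w => localF F e z.1 w ^ 2)) z.2
  have h2 : ∀ j k, gLower F e j k z.1 z.2 =
      1 / 2 * H (EuclideanSpace.single j 1) (EuclideanSpace.single k 1) := fun j k =>
    congrArg (fun t => 1 / 2 * t) (h1 _ _)
  have h3 : ∀ j, ∑ k, gLower F e j k z.1 z.2 * v k = 1 / 2 * H (EuclideanSpace.single j 1) v := by
    intro j
    rw [← sum_apply_single (H (EuclideanSpace.single j 1)) v, Finset.mul_sum]
    exact Finset.sum_congr rfl fun k _ => by rw [h2]; ring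
  have h4 := sum_apply_single (H.flip v) v
  simp only [ContinuousLinearMap.flip_apply] at h4
  have h5 : ∑ j, v j * ∑ k, gLower F e j k z.1 z.2 * v k = 1 / 2 * H v v := by
    rw [← h4, Finset.mul_sum]
    exact Finset.sum_congr rfl fun j _ => by rw [h3]; ring
  rw [h5]; linarith

/-- A kernel vector would contradict positive definiteness. -/
lemma det_gLower_ne_zero {z : Model n × Model n} (hz : z ∈ slitTarget e) :
    (Matrix.of fun a b => gLower F e a b z.1 z.2).det ≠ 0 := by
  intro h0
  obtain ⟨v, hv, h1⟩ := Matrix.exists_mulVec_eq_zero_iff.2 h0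
  have h2 := gLower_quadratic_pos F he hz (v := WithLp.toLp 2 v) (by simpa using hv)
  have h3 : ∀ j, ∑ k, gLower F e j k z.1 z.2 * v k = 0 := fun j => congrFun h1 j
  simp [h3] at h2

lemma contDiffOn_christoffel00 (i : Fin n) :
    ContDiffOn ℝ ∞ (fun z : Model n × Model n => christoffel00 F e i z.1 z.2) (slitTarget e) := by
  have hg : ∀ i j, ContDiffOn ℝ ∞ (fun z : Model n × Model n => gUpper F e i j z.1 z.2)
      (slitTarget e) := fun i j =>
    contDiffOn_inv_apply (A := fun z : Model n × Model n => Matrix.of fun a b => gLower F e a b z.1 z.2)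
      (fun a b => contDiffOn_gLower F he a b) (fun z hz => det_gLower_ne_zero F he hz) i j
  have hp : ∀ i j k, ContDiffOn ℝ ∞ (fun z : Model n × Model n => pdx i (gLower F e j k) z.1 z.2)
      (slitTarget e) := fun i j k =>
    contDiffOn_pdx isOpen_slitTarget (contDiffOn_gLower F he j k) i
  have hy : ∀ k, ContDiffOn ℝ ∞ (fun z : Model n × Model n => z.2 k) (slitTarget e) := fun k =>
    ((contDiff_piLp_apply 2).comp contDiff_snd).contDiffOn
  simp only [christoffel00, christoffel]
  exact ContDiffOn.sum fun k _ => ContDiffOn.sum fun l _ => ((contDiffOn_const.mul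
    (ContDiffOn.sum fun m _ => (hg i m).mul (((hp k m l).add (hp l k m)).sub (hp m k l)))).mul
      (hy k)).mul (hy l)

end Cartan

/-! ### The geodesic equation as the Euler-Lagrange equation of F². -/

section Cartan

variable {n : ℕ} {M : Type*} [TopologicalSpace M] [ChartedSpace (Model n) M]
  [IsManifold (𝓡 n) ∞ M] (F : FinslerMetric n M) {e : OpenPartialHomeomorph M (Model n)}
  (he : e ∈ IsManifold.maximalAtlas (𝓡 n) ∞ M)
include he

/-- `F²` in a chart as a function on `ℝⁿ × ℝⁿ`. -/
abbrev chartSq (F : FinslerMetric n M) (e : OpenPartialHomeomorph M (Model n))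
    (z : Model n × Model n) : ℝ := chartF F e z ^ 2

/-- The geodesic equation before raising the index: `½ y^k y^l (2 ∂_k g_{jl} - ∂_j g_{kl})`. -/
def loweredSpray (F : FinslerMetric n M) (e : OpenPartialHomeomorph M (Model n)) (z : Model n × Model n)
    (j : Fin n) : ℝ :=
  1 / 2 * ∑ k, ∑ l, z.2 k * z.2 l *
    (2 * pdx k (gLower F e j l) z.1 z.2 - pdx j (gLower F e k l) z.1 z.2)

lemma differentiableAt_gLower_fst (j k : Fin n) {z : Model n × Model n} (hz : z ∈ slitTarget e) :
    DifferentiableAt ℝ (fun x => gLower F e j k x z.2) z.1 := by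
  have h : ContDiffOn ℝ ∞ (fun x => gLower F e j k x z.2) e.target :=
    (contDiffOn_gLower F he j k).comp (f := fun x => (x, z.2)) (by fun_prop) fun x hx => ⟨hx, hz.2⟩
  exact (h.contDiffAt (e.open_target.mem_nhds hz.1)).differentiableAt (by simp)

lemma contDiffAt_chartSq {z : Model n × Model n} (hz : z ∈ slitTarget e) :
    ContDiffAt ℝ ∞ (chartSq F e) z :=
  (contDiffOn_localF_sq F he).contDiffAt (isOpen_slitTarget.mem_nhds hz)

lemma differentiableAt_fderiv_chartSq {z : Model n × Model n} (hz : z ∈ slitTarget e) :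
    DifferentiableAt ℝ (fderiv ℝ (chartSq F e)) z :=
  ((contDiffAt_chartSq F he hz).fderiv_right (m := 1) (by norm_cast)).differentiableAt (by simp)

lemma fderiv_fderiv_chartSq {z : Model n × Model n} (hz : z ∈ slitTarget e)
    (v w : Model n × Model n) : fderiv ℝ (fun z => fderiv ℝ (chartSq F e) z v) z w =
      fderiv ℝ (fderiv ℝ (chartSq F e)) z w v := by
  have := ((differentiableAt_fderiv_chartSq F he hz).hasFDerivAt.clm_apply
    (hasFDerivAt_const v z)).fderiv
  have h2 := congrArg (fun k => k w) this
  simpa using h2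

/-- Differentiate ∂F²/∂y^j = 2 g_jl y^l with respect to x in the direction y, keeping y fixed. -/
lemma fderiv_fderiv_chartSq_fst {z : Model n × Model n} (hz : z ∈ slitTarget e) (j : Fin n) :
    fderiv ℝ (fderiv ℝ (chartSq F e)) z (z.2, 0) (0, EuclideanSpace.single j 1) =
      2 * ∑ k, ∑ l, z.2 k * z.2 l * pdx k (gLower F e j l) z.1 z.2 := by
  have hdv : DifferentiableAt ℝ (fun z => fderiv ℝ (chartSq F e) z
      (0, EuclideanSpace.single j 1)) z :=
    (differentiableAt_fderiv_chartSq F he hz).clm_apply (differentiableAt_const _)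
  have h0 : (fun x => fderiv ℝ (chartSq F e) (x, z.2) (0, EuclideanSpace.single j 1)) =ᶠ[nhds z.1]
      fun x => 2 * ∑ k, z.2 k * gLower F e j k x z.2 :=
    Filter.eventually_of_mem (e.open_target.mem_nhds hz.1) fun x hx =>
        fderiv_localF_sq_snd F he j (z := (x, z.2)) ⟨hx, hz.2⟩
  rw [← fderiv_fderiv_chartSq F he hz, fderiv_apply_fst hdv, h0.fderiv_eq]
  have h1 : HasFDerivAt (fun x => 2 * ∑ l, z.2 l * gLower F e j l x z.2)
      ((2 : ℝ) • ∑ l, z.2 l • fderiv ℝ (fun x => gLower F e j l x z.2) z.1) z.1 :=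
    (HasFDerivAt.fun_sum fun l _ =>
      (differentiableAt_gLower_fst F he j l hz).hasFDerivAt.const_mul _).const_mul _
  rw [h1.fderiv, ← sum_apply_single]
  simp only [_root_.smul_apply, _root_.sum_apply, smul_eq_mul, pdx, Finset.mul_sum]
  refine Finset.sum_congr rfl fun k _ => Finset.sum_congr rfl fun l _ => by ring

lemma fderiv_fderiv_chartSq_snd {z : Model n × Model n} (hz : z ∈ slitTarget e) (a : Model n)
    (j : Fin n) : fderiv ℝ (fderiv ℝ (chartSq F e)) z (0, a) (0, EuclideanSpace.single j 1) =
      2 * ∑ k, gLower F e j k z.1 z.2 * a k := by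
  have hdv : DifferentiableAt ℝ (fun z => fderiv ℝ (chartSq F e) z
      (0, EuclideanSpace.single j 1)) z :=
    (differentiableAt_fderiv_chartSq F he hz).clm_apply (differentiableAt_const _)
  rw [← fderiv_fderiv_chartSq F he hz, fderiv_apply_snd hdv, ← sum_apply_single, Finset.mul_sum]
  refine Finset.sum_congr rfl fun k _ => ?_
  have h1 : (fun y => fderiv ℝ (chartSq F e) (z.1, y)
      (0, EuclideanSpace.single j 1)) =ᶠ[nhds z.2]
      fun y => pdy j (fun x y => localF F e x y ^ 2) z.1 y :=
    Filter.eventually_of_mem (isOpen_compl_singleton.mem_nhds hz.2) fun y hy =>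
      (pdy_eq (f := fun x y => localF F e x y ^ 2) isOpen_slitTarget (contDiffOn_localF_sq F he) j
        (z := (z.1, y)) ⟨hz.1, hy⟩).symm
  rw [h1.fderiv_eq, gLower_comm F he j k hz]
  simp only [gLower]
  rw [pdy]; ring

/-- Differentiate F² = g_kl y^k y^l with respect to x, keeping y fixed. -/
lemma fderiv_chartSq_fst {z : Model n × Model n} (hz : z ∈ slitTarget e) (j : Fin n) :
    fderiv ℝ (chartSq F e) z (EuclideanSpace.single j 1, 0) =
      ∑ k, ∑ l, z.2 k * z.2 l * pdx j (gLower F e k l) z.1 z.2 := by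
  have h0 : (fun x => chartSq F e (x, z.2)) =ᶠ[nhds z.1]
      fun x => ∑ k, ∑ l, z.2 k * (z.2 l * gLower F e k l x z.2) :=
    Filter.eventually_of_mem (e.open_target.mem_nhds hz.1) fun x hx =>
      chartF_sq_eq F he (z := (x, z.2)) ⟨hx, hz.2⟩
  rw [fderiv_apply_fst ((contDiffAt_chartSq F he hz).differentiableAt (by simp)), h0.fderiv_eq]
  have h1 : HasFDerivAt (fun x => ∑ k, ∑ l, z.2 k * (z.2 l * gLower F e k l x z.2))
      (∑ k, ∑ l, z.2 k • (z.2 l • fderiv ℝ (fun x => gLower F e k l x z.2) z.1)) z.1 :=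
    HasFDerivAt.fun_sum fun k _ => HasFDerivAt.fun_sum fun l _ =>
      ((differentiableAt_gLower_fst F he k l hz).hasFDerivAt.const_mul _).const_mul _
  rw [h1.fderiv]
  simp only [_root_.smul_apply, _root_.sum_apply, smul_eq_mul, pdx, mul_assoc]

/-- The left side is d/dt(∂F²/∂y^j) - ∂F²/∂x^j along a curve with velocity y and acceleration a; the
right side is its expression through g. -/
lemma eulerLagrange_single {z : Model n × Model n} (hz : z ∈ slitTarget e) (a : Model n)
    (j : Fin n) : fderiv ℝ (fderiv ℝ (chartSq F e)) z (z.2, a) (0, EuclideanSpace.single j 1) -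
      fderiv ℝ (chartSq F e) z (EuclideanSpace.single j 1, 0) =
        2 * (∑ k, gLower F e j k z.1 z.2 * a k + loweredSpray F e z j) := by
  have h1 : fderiv ℝ (fderiv ℝ (chartSq F e)) z (z.2, a) =
      fderiv ℝ (fderiv ℝ (chartSq F e)) z (z.2, 0) +
        fderiv ℝ (fderiv ℝ (chartSq F e)) z (0, a) := by rw [← map_add]; simp
  rw [h1, _root_.add_apply, fderiv_fderiv_chartSq_fst F he hz, fderiv_fderiv_chartSq_snd F he hz,
    fderiv_chartSq_fst F he hz]
  simp only [loweredSpray, mul_sub, Finset.sum_sub_distrib]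
  have h2 : ∑ k, ∑ l, z.2 k * z.2 l * (2 * pdx k (gLower F e j l) z.1 z.2) =
      2 * ∑ k, ∑ l, z.2 k * z.2 l * pdx k (gLower F e j l) z.1 z.2 := by
    simp only [Finset.mul_sum]
    refine Finset.sum_congr rfl fun k _ => Finset.sum_congr rfl fun l _ => by ring
  rw [h2]; ring

/-- The first two terms of the Christoffel symbol become equal after contraction with y^k y^l;
raising the index then gives Γ₀₀. -/
lemma christoffel00_eq {z : Model n × Model n} (hz : z ∈ slitTarget e) (i : Fin n) :
    christoffel00 F e i z.1 z.2 =
      ((Matrix.of fun a b => gLower F e a b z.1 z.2)⁻¹.mulVec (loweredSpray F e z)) i := by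
  have h1 : ∀ j, ∑ k, ∑ l, z.2 k * z.2 l * (pdx k (gLower F e j l) z.1 z.2 +
      pdx l (gLower F e k j) z.1 z.2 - pdx j (gLower F e k l) z.1 z.2) =
        2 * loweredSpray F e z j := by
    intro j
    have h2 : ∑ k, ∑ l, z.2 k * z.2 l * pdx l (gLower F e k j) z.1 z.2 =
        ∑ k, ∑ l, z.2 k * z.2 l * pdx k (gLower F e j l) z.1 z.2 := by
      rw [Finset.sum_comm]
      refine Finset.sum_congr rfl fun k _ => Finset.sum_congr rfl fun l _ => ?_
      rw [pdx_congr he hz (fun _ hw => gLower_comm F he l j hw)]; ring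
    simp only [loweredSpray, mul_sub, mul_add, Finset.sum_sub_distrib, Finset.sum_add_distrib, h2]
    have h3 : ∑ k, ∑ l, z.2 k * z.2 l * (2 * pdx k (gLower F e j l) z.1 z.2) =
        2 * ∑ k, ∑ l, z.2 k * z.2 l * pdx k (gLower F e j l) z.1 z.2 := by
      simp only [Finset.mul_sum]
      refine Finset.sum_congr rfl fun k _ => Finset.sum_congr rfl fun l _ => by ring
    rw [h3]; ring
  have h2 : ∀ j, gUpper F e i j z.1 z.2 * loweredSpray F e z j = ∑ k, ∑ l,
      1 / 2 * (gUpper F e i j z.1 z.2 * (pdx k (gLower F e j l) z.1 z.2 +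
        pdx l (gLower F e k j) z.1 z.2 - pdx j (gLower F e k l) z.1 z.2)) * z.2 k * z.2 l := by
    intro j
    have h3 : loweredSpray F e z j = 1 / 2 * (2 * loweredSpray F e z j) := by ring
    rw [h3, ← h1]
    simp only [Finset.mul_sum]
    refine Finset.sum_congr rfl fun k _ => Finset.sum_congr rfl fun l _ => by ring
  have h4 : ((Matrix.of fun a b => gLower F e a b z.1 z.2)⁻¹.mulVec (loweredSpray F e z)) i =
      ∑ j, gUpper F e i j z.1 z.2 * loweredSpray F e z j := rfl
  rw [h4, Finset.sum_congr rfl fun j _ => h2 j, Finset.sum_comm]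
  simp only [christoffel00, christoffel]
  refine Finset.sum_congr rfl fun k _ => ?_
  rw [Finset.sum_comm]
  refine Finset.sum_congr rfl fun l _ => ?_
  rw [Finset.mul_sum, Finset.sum_mul, Finset.sum_mul]

/-- The geodesic equation is the Euler-Lagrange equation of `F²`. -/
lemma geodesic_equation_iff {z : Model n × Model n} (hz : z ∈ slitTarget e) (a : Model n) :
    (∀ i, a i + christoffel00 F e i z.1 z.2 = 0) ↔
      ∀ v : Model n, fderiv ℝ (fderiv ℝ (chartSq F e)) z (z.2, a) (0, v) =
        fderiv ℝ (chartSq F e) z (v, 0) := by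
  -- Multiply by the matrix g in one direction and by its inverse in the other.
  have step : (∀ i, a i + christoffel00 F e i z.1 z.2 = 0) ↔
      ∀ j, ∑ k, gLower F e j k z.1 z.2 * a k + loweredSpray F e z j = 0 := by
    have hC := christoffel00_eq F he hz
    have hdet := (det_gLower_ne_zero F he hz).isUnit
    set A : Matrix (Fin n) (Fin n) ℝ := Matrix.of fun a b => gLower F e a b z.1 z.2 with hA
    have hS : ∀ j, ∑ k, gLower F e j k z.1 z.2 * a k = (A.mulVec (fun k => a k)) j := fun j => rfl
    have e1 : (∀ i, a i + christoffel00 F e i z.1 z.2 = 0) ↔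
        (fun k => a k) + A⁻¹.mulVec (loweredSpray F e z) = 0 := by
      simp only [funext_iff, Pi.add_apply, Pi.zero_apply, hC]
    have e2 : (∀ j, ∑ k, gLower F e j k z.1 z.2 * a k + loweredSpray F e z j = 0) ↔
        A.mulVec (fun k => a k) + loweredSpray F e z = 0 := by
      simp only [funext_iff, Pi.add_apply, Pi.zero_apply, hS]
    rw [e1, e2]
    constructor
    · intro h
      have := congrArg A.mulVec h
      rwa [Matrix.mulVec_add, Matrix.mulVec_mulVec, Matrix.mul_nonsing_inv _ hdet,
        Matrix.one_mulVec, Matrix.mulVec_zero] at this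
    · intro h
      have := congrArg A⁻¹.mulVec h
      rwa [Matrix.mulVec_add, Matrix.mulVec_mulVec, Matrix.nonsing_inv_mul _ hdet,
        Matrix.one_mulVec, Matrix.mulVec_zero] at this
  rw [step]
  constructor
  · intro h v
    have h1 := sum_apply_single ((fderiv ℝ (fderiv ℝ (chartSq F e)) z (z.2, a)).comp
      (ContinuousLinearMap.inr ℝ _ _)) v
    have h2 := sum_apply_single ((fderiv ℝ (chartSq F e) z).comp
      (ContinuousLinearMap.inl ℝ _ _)) v
    simp only [ContinuousLinearMap.comp_apply, ContinuousLinearMap.inr_apply,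
      ContinuousLinearMap.inl_apply] at h1 h2
    rw [← h1, ← h2]
    refine Finset.sum_congr rfl fun j _ => ?_
    have h3 := eulerLagrange_single F he hz a j
    rw [h j, mul_zero, sub_eq_zero] at h3
    rw [h3]
  · intro h j
    have h3 := eulerLagrange_single F he hz a j
    rw [h, sub_self] at h3
    linarith

end Cartan

/-! ### The Euler-Lagrange equations of F and of its powers. -/

section EulerLagrange

variable {n : ℕ} {M : Type*} [TopologicalSpace M] [ChartedSpace (Model n) M]
  [IsManifold (𝓡 n) ∞ M] (F : FinslerMetric n M) {e : OpenPartialHomeomorph M (Model n)}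
  (he : e ∈ IsManifold.maximalAtlas (𝓡 n) ∞ M)
include he

lemma contDiffAt_chartF {z : Model n × Model n} (hz : z ∈ slitTarget e) :
    ContDiffAt ℝ ∞ (chartF F e) z :=
  (contDiffOn_chartF F he).contDiffAt (isOpen_slitTarget.mem_nhds hz)

lemma hasFDerivAt_chartF {z : Model n × Model n} (hz : z ∈ slitTarget e) :
    HasFDerivAt (chartF F e) (fderiv ℝ (chartF F e) z) z :=
  ((contDiffAt_chartF F he hz).differentiableAt (by simp)).hasFDerivAt

lemma hasFDerivAt_fderiv_chartF {z : Model n × Model n} (hz : z ∈ slitTarget e) :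
    HasFDerivAt (fderiv ℝ (chartF F e)) (fderiv ℝ (fderiv ℝ (chartF F e)) z) z :=
  (((contDiffAt_chartF F he hz).fderiv_right (m := 1) (by norm_cast)).differentiableAt
    (by simp)).hasFDerivAt

lemma chartF_pos {z : Model n × Model n} (hz : z ∈ slitTarget e) : 0 < chartF F e z :=
  (isMinkowskiNorm_localF F he hz.1).pos _ hz.2

lemma fderiv_chartF_snd {z : Model n × Model n} (hz : z ∈ slitTarget e) (v : Model n) :
    fderiv ℝ (chartF F e) z (0, v) = fderiv ℝ (localF F e z.1) z.2 v :=
  fderiv_apply_snd (hasFDerivAt_chartF F he hz).differentiableAt v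

lemma fderiv_chartF_self {z : Model n × Model n} (hz : z ∈ slitTarget e) :
    fderiv ℝ (chartF F e) z (0, z.2) = chartF F e z := by
  rw [fderiv_chartF_snd F he hz]
  exact (isMinkowskiNorm_localF F he hz.1).fderiv_self hz.2

/-- Differentiate Euler's identity DF(0, y) = F in the direction w; the terms with w.2 cancel. For w
= (y, a) this says that the Euler-Lagrange equation of F in the direction y holds for every
acceleration a. -/
lemma fderiv_fderiv_chartF_self {z : Model n × Model n} (hz : z ∈ slitTarget e)
    (w : Model n × Model n) : fderiv ℝ (fderiv ℝ (chartF F e)) z w (0, z.2) =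
      fderiv ℝ (chartF F e) z (w.1, 0) := by
  have h1 : (fun z : Model n × Model n => fderiv ℝ (chartF F e) z (0, z.2)) =ᶠ[nhds z] chartF F e :=
    Filter.eventually_of_mem (isOpen_slitTarget.mem_nhds hz) fun w hw => fderiv_chartF_self F he hw
  have h2 : HasFDerivAt (fun z : Model n × Model n => ((0 : Model n), z.2))
      ((ContinuousLinearMap.inr ℝ (Model n) (Model n)).comp (ContinuousLinearMap.snd ℝ _ _)) z :=
    ((ContinuousLinearMap.inr ℝ (Model n) (Model n)).comp
      (ContinuousLinearMap.snd ℝ (Model n) (Model n))).hasFDerivAt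
  have h3 := ((hasFDerivAt_fderiv_chartF F he hz).clm_apply h2).unique
    ((hasFDerivAt_chartF F he hz).congr_of_eventuallyEq h1)
  have h4 := congrArg (fun L => L w) h3
  simp only [_root_.add_apply, ContinuousLinearMap.comp_apply, ContinuousLinearMap.inr_apply,
    ContinuousLinearMap.coe_snd', ContinuousLinearMap.flip_apply] at h4
  have h5 := fderiv_apply_eq_add (h := chartF F e) (z := z) w.1 w.2
  have h6 : fderiv ℝ (chartF F e) z (w.1, w.2) = fderiv ℝ (chartF F e) z w := rfl
  linarith

lemma fderiv_chartSq {z : Model n × Model n} (hz : z ∈ slitTarget e) (v : Model n × Model n) :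
    fderiv ℝ (chartSq F e) z v = 2 * chartF F e z * fderiv ℝ (chartF F e) z v := by
  have := ((hasFDerivAt_chartF F he hz).pow 2).fderiv
  have h2 := congrArg (fun L => L v) this
  simpa using h2

lemma fderiv_fderiv_chartSq_eq {z : Model n × Model n} (hz : z ∈ slitTarget e)
    (v w : Model n × Model n) : fderiv ℝ (fderiv ℝ (chartSq F e)) z w v =
      2 * fderiv ℝ (chartF F e) z w * fderiv ℝ (chartF F e) z v +
        2 * chartF F e z * fderiv ℝ (fderiv ℝ (chartF F e)) z w v := by
  rw [← fderiv_fderiv_chartSq F he hz]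
  have h1 : (fun z => fderiv ℝ (chartSq F e) z v) =ᶠ[nhds z]
      fun z => 2 * chartF F e z * fderiv ℝ (chartF F e) z v :=
    Filter.eventually_of_mem (isOpen_slitTarget.mem_nhds hz) fun w hw => fderiv_chartSq F he hw v
  have h2 := (((hasFDerivAt_chartF F he hz).const_mul 2).mul
    ((hasFDerivAt_fderiv_chartF F he hz).clm_apply (hasFDerivAt_const v z))).fderiv
  rw [h1.fderiv_eq]
  have h3 := congrArg (fun L => L w) h2
  refine Eq.trans h3 ?_
  simp
  ring

/-- The geodesic equation: `F` satisfies its Euler-Lagrange equation and is constant. -/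
lemma geodesic_equation_iff_chartF {z : Model n × Model n} (hz : z ∈ slitTarget e) (a : Model n) :
    (∀ i, a i + christoffel00 F e i z.1 z.2 = 0) ↔
      (∀ v : Model n, fderiv ℝ (fderiv ℝ (chartF F e)) z (z.2, a) (0, v) =
        fderiv ℝ (chartF F e) z (v, 0)) ∧ fderiv ℝ (chartF F e) z (z.2, a) = 0 := by
  have hpos := chartF_pos F he hz
  rw [geodesic_equation_iff F he hz]
  simp only [fderiv_fderiv_chartSq_eq F he hz, fderiv_chartSq F he hz]
  constructor
  · intro h
    -- In the direction v = y the second order terms cancel against the right side, leaving 2 F ·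
    -- dF(y, a) = 0, the constancy of speed.
    have h1 := h z.2
    rw [fderiv_fderiv_chartF_self F he hz, fderiv_chartF_self F he hz] at h1
    have h2 : fderiv ℝ (chartF F e) z (z.2, a) = 0 := by
      have : fderiv ℝ (chartF F e) z (z.2, a) * chartF F e z = 0 := by
        simp only at h1; linarith
      exact (mul_eq_zero.1 this).resolve_right hpos.ne'
    refine ⟨fun v => ?_, h2⟩
    have h3 := h v
    rw [h2, mul_zero, zero_mul, zero_add] at h3
    exact mul_left_cancel₀ (by positivity) h3
  · rintro ⟨h1, h2⟩ v
    rw [h1, h2]; ring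

/-- For `p ≠ 0, 1` the Euler-Lagrange equation of `F ^ p` is the geodesic equation. -/
lemma geodesic_equation_of_eulerLagrange {p : ℝ} (hp0 : p ≠ 0) (hp1 : p ≠ 1)
    {z : Model n × Model n} (hz : z ∈ slitTarget e) (a : Model n)
    (h : ∀ v : Model n, p * ((p - 1) * chartF F e z ^ (p - 2) * fderiv ℝ (chartF F e) z (z.2, a)) *
        fderiv ℝ (chartF F e) z (0, v) + p * chartF F e z ^ (p - 1) *
          fderiv ℝ (fderiv ℝ (chartF F e)) z (z.2, a) (0, v) =
      p * chartF F e z ^ (p - 1) * fderiv ℝ (chartF F e) z (v, 0)) :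
    ∀ i, a i + christoffel00 F e i z.1 z.2 = 0 := by
  have hpos := chartF_pos F he hz
  rw [geodesic_equation_iff_chartF F he hz]
  -- The same test direction leaves p(p - 1) F^(p-1) dF(y, a) = 0, so p ≠ 0, 1 forces constant
  -- speed.
  have h1 := h z.2
  rw [fderiv_fderiv_chartF_self F he hz, fderiv_chartF_self F he hz] at h1
  have h2 : fderiv ℝ (chartF F e) z (z.2, a) = 0 := by
    have h3 : p * ((p - 1) * chartF F e z ^ (p - 2) * fderiv ℝ (chartF F e) z (z.2, a)) *
        chartF F e z = 0 := by simp only at h1; linarith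
    simpa [hp0, sub_ne_zero.2 hp1, hpos.ne', (Real.rpow_pos_of_pos hpos (p - 2)).ne'] using h3
  refine ⟨fun v => ?_, h2⟩
  have h3 := h v
  rw [h2, mul_zero, mul_zero, zero_mul, zero_add] at h3
  exact mul_left_cancel₀ (mul_ne_zero hp0 (Real.rpow_pos_of_pos hpos _).ne') h3

end EulerLagrange

/-! ### Smooth pieces of curves -/

section Pieces

variable {n : ℕ} {M : Type*} [TopologicalSpace M] [ChartedSpace (Model n) M]

variable (n) in
/-- `c` is smooth and regular on `[a, b]`. -/
def IsRegularPiece (c : ℝ → M) (a b : ℝ) : Prop :=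
  ContMDiffOn 𝓘(ℝ, ℝ) (𝓡 n) ∞ c (Icc a b) ∧ ∀ t ∈ Icc a b, velocity n c (Icc a b) t ≠ 0

lemma velocity_subset {c : ℝ → M} {a b a' b' t : ℝ} (hab : a' < b')
    (hsub : Icc a' b' ⊆ Icc a b) (ht : t ∈ Icc a' b')
    (hc : MDifferentiableWithinAt 𝓘(ℝ, ℝ) (𝓡 n) c (Icc a b) t) :
    velocity n c (Icc a' b') t = velocity n c (Icc a b) t := by
  unfold velocity
  rw [mfderivWithin_subset hsub ((uniqueDiffOn_Icc hab) t ht).uniqueMDiffWithinAt hc]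

lemma velocity_congr_Ioo {c : ℝ → M} {a b a' b' t : ℝ} (ht : t ∈ Ioo a b) (ht' : t ∈ Ioo a' b') :
    velocity n c (Icc a b) t = velocity n c (Icc a' b') t := by
  unfold velocity
  rw [mfderivWithin_of_mem_nhds (Icc_mem_nhds ht.1 ht.2),
    mfderivWithin_of_mem_nhds (Icc_mem_nhds ht'.1 ht'.2)]

lemma mdifferentiableWithinAt_of_mem {c : ℝ → M} {S : Set ℝ} {t : ℝ}
    (hc : ContMDiffOn 𝓘(ℝ, ℝ) (𝓡 n) ∞ c S) (ht : t ∈ S) :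
    MDifferentiableWithinAt 𝓘(ℝ, ℝ) (𝓡 n) c S t :=
  hc.mdifferentiableOn (by simp) t ht

lemma IsRegularPiece.subset {c : ℝ → M} {a b a' b' : ℝ} (h : IsRegularPiece n c a b) (ha : a ≤ a')
    (hab : a' < b') (hb : b' ≤ b) : IsRegularPiece n c a' b' := by
  have hsub := Icc_subset_Icc ha hb
  refine ⟨h.1.mono hsub, fun t ht => ?_⟩
  rw [velocity_subset hab hsub ht (mdifferentiableWithinAt_of_mem h.1 (hsub ht))]
  exact h.2 t (hsub ht)

lemma mem_pathSpace_iff {x₀ x₁ : M} {c : ℝ → M} : c ∈ pathSpace n x₀ x₁ ↔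
    ContinuousOn c (Icc 0 1) ∧ c 0 = x₀ ∧ c 1 = x₁ ∧ PiecewiseOn (IsRegularPiece n c) := by
  refine and_congr_right fun _ => and_congr_right fun _ => and_congr_right fun _ => ?_
  constructor
  · rintro ⟨k, τ, hτ, h⟩
    exact hτ.piecewiseOn h fun a b a' b' hP ha hab hb => hP.subset ha hab hb
  · exact fun h => h.exists_partition

/-- Regularity is known only on some pieces of c. At each t a short one-sided piece suffices: its
velocity at t agrees with the one relative to `[a, b]`, where c is smooth. -/
lemma IsRegularPiece.of_pathSpace {x₀ x₁ : M} {c : ℝ → M} (hc : c ∈ pathSpace n x₀ x₁) {a b : ℝ}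
    (ha : 0 ≤ a) (hab : a < b) (hb : b ≤ 1) (h : ContMDiffOn 𝓘(ℝ, ℝ) (𝓡 n) ∞ c (Icc a b)) :
    IsRegularPiece n c a b := by
  refine ⟨h, fun t ht => ?_⟩
  obtain ⟨-, -, -, hP⟩ := mem_pathSpace_iff.1 hc
  rcases eq_or_lt_of_le ht.2 with rfl | htb
  · obtain ⟨d, hd, -, hd1, hP⟩ := hP.exists_left ⟨ha.trans_lt hab, hb⟩ hab
    rw [← velocity_subset hd (Icc_subset_Icc hd1 le_rfl) (right_mem_Icc.2 hd.le)
      (mdifferentiableWithinAt_of_mem h ht)]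
    exact hP.2 t (right_mem_Icc.2 hd.le)
  · obtain ⟨d, hd, -, hd1, hP⟩ := hP.exists_right ⟨ha.trans ht.1, htb.trans_le hb⟩ htb
    rw [← velocity_subset hd (Icc_subset_Icc ht.1 hd1) (left_mem_Icc.2 hd.le)
      (mdifferentiableWithinAt_of_mem h ht)]
    exact hP.2 t (left_mem_Icc.2 hd.le)

lemma isVariation_iff {x₀ x₁ : M} {c : ℝ → M} {ε : ℝ} {α : ℝ → ℝ → M} :
    IsVariation n x₀ x₁ c ε α ↔ 0 < ε ∧ (∀ t ∈ Icc (0 : ℝ) 1, α 0 t = c t) ∧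
      (∀ s ∈ Ioo (-ε) ε, α s ∈ pathSpace n x₀ x₁) ∧
      ContinuousOn (fun q : ℝ × ℝ => α q.1 q.2) (Ioo (-ε) ε ×ˢ Icc 0 1) ∧
      PiecewiseOn fun a b => ContMDiffOn 𝓘(ℝ, ℝ × ℝ) (𝓡 n) ∞ (fun q : ℝ × ℝ => α q.1 q.2)
        (Ioo (-ε) ε ×ˢ Icc a b) := by
  refine and_congr_right fun _ => and_congr_right fun _ => and_congr_right fun _ =>
    and_congr_right fun _ => ?_
  constructor
  · rintro ⟨k, τ, hτ, h⟩
    exact hτ.piecewiseOn (P := fun a b => ContMDiffOn 𝓘(ℝ, ℝ × ℝ) (𝓡 n) ∞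
      (fun q : ℝ × ℝ => α q.1 q.2) (Ioo (-ε) ε ×ˢ Icc a b)) h
      fun a b a' b' hP ha hab hb => hP.mono (prod_mono le_rfl (Icc_subset_Icc ha hb))
  · exact fun h => h.exists_partition

end Pieces

/-! ### The first variation of the energy -/

section Variation

variable {n : ℕ} {M : Type*} [TopologicalSpace M] [ChartedSpace (Model n) M]
  [IsManifold (𝓡 n) ∞ M] (F : FinslerMetric n M)

/-- The speed of `c`, with velocities relative to `[a, b]`. -/
def speedOn (c : ℝ → M) (a b t : ℝ) : ℝ := F.toFun ⟨c t, velocity n c (Icc a b) t⟩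

/-- The speed of `c : [0, 1] → M`. -/
abbrev speed (c : ℝ → M) (t : ℝ) : ℝ := speedOn F c 0 1 t

lemma speedOn_congr_Ioo {c : ℝ → M} {a b a' b' t : ℝ} (ht : t ∈ Ioo a b) (ht' : t ∈ Ioo a' b') :
    speedOn F c a b t = speedOn F c a' b' t := by
  unfold speedOn
  rw [velocity_congr_Ioo ht ht']

lemma speedOn_eq_speed {c : ℝ → M} {a b t : ℝ} (ha : 0 ≤ a) (hb : b ≤ 1) (ht : t ∈ Ioo a b) :
    speedOn F c a b t = speed F c t :=
  speedOn_congr_Ioo F ht ⟨ha.trans_lt ht.1, ht.2.trans_le hb⟩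

lemma IsRegularPiece.speedOn_pos {c : ℝ → M} {a b t : ℝ} (h : IsRegularPiece n c a b)
    (ht : t ∈ Icc a b) : 0 < speedOn F c a b t := F.pos _ _ (h.2 t ht)

lemma IsRegularPiece.coord_mem {c : ℝ → M} {a b t : ℝ} (h : IsRegularPiece n c a b) (hab : a < b)
    (ht : t ∈ Icc a b) {e : OpenPartialHomeomorph M (Model n)}
    (he : e ∈ IsManifold.maximalAtlas (𝓡 n) ∞ M) (hx : c t ∈ e.source) :
    (e (c t), derivWithin (fun r => e (c r)) (Icc a b) t) ∈ slitTarget e :=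
  ⟨e.map_source hx, (velocity_ne_zero_iff he hx (mdifferentiableWithinAt_of_mem h.1 ht)
    (uniqueDiffOn_Icc hab t ht)).1 (h.2 t ht)⟩

lemma IsRegularPiece.speedOn_eq {c : ℝ → M} {a b t : ℝ} (h : IsRegularPiece n c a b) (hab : a < b)
    (ht : t ∈ Icc a b) {e : OpenPartialHomeomorph M (Model n)}
    (he : e ∈ IsManifold.maximalAtlas (𝓡 n) ∞ M) (hx : c t ∈ e.source) :
    speedOn F c a b t = chartF F e (e (c t), derivWithin (fun r => e (c r)) (Icc a b) t) :=
  toFun_velocity F he hx (mdifferentiableWithinAt_of_mem h.1 ht) (uniqueDiffOn_Icc hab t ht)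

/-- The strip `(-ε, ε) × [a, b]`. -/
abbrev strip (ε a b : ℝ) : Set (ℝ × ℝ) := Ioo (-ε) ε ×ˢ Icc a b

lemma uniqueDiffOn_strip_inter {ε a b : ℝ} (hab : a < b) {O : Set (ℝ × ℝ)} (hO : IsOpen O) :
    UniqueDiffOn ℝ (strip ε a b ∩ O) :=
  (isOpen_Ioo.uniqueDiffOn.prod (uniqueDiffOn_Icc hab)).inter hO

lemma exists_strip_chart {ε a b : ℝ} {α : ℝ → ℝ → M}
    (hα : ContMDiffOn 𝓘(ℝ, ℝ × ℝ) (𝓡 n) ∞ (fun q : ℝ × ℝ => α q.1 q.2) (strip ε a b))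
    {e : OpenPartialHomeomorph M (Model n)} (he : e ∈ IsManifold.maximalAtlas (𝓡 n) ∞ M)
    {q : ℝ × ℝ} (hq : q ∈ strip ε a b) (hx : α q.1 q.2 ∈ e.source) :
    ∃ O : Set (ℝ × ℝ), IsOpen O ∧ q ∈ O ∧ (∀ r ∈ strip ε a b ∩ O, α r.1 r.2 ∈ e.source) ∧
      ContDiffOn ℝ ∞ (fun r : ℝ × ℝ => e (α r.1 r.2)) (strip ε a b ∩ O) := by
  obtain ⟨O, hO, h⟩ := continuousOn_iff'.1 hα.continuousOn e.source e.open_source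
  have hO' : ∀ r ∈ strip ε a b ∩ O, α r.1 r.2 ∈ e.source := fun r hr => by
    have : r ∈ O ∩ strip ε a b := ⟨hr.2, hr.1⟩
    rw [← h] at this
    exact this.1
  refine ⟨O, hO, ?_, hO', ?_⟩
  · have : q ∈ (fun q : ℝ × ℝ => α q.1 q.2) ⁻¹' e.source ∩ strip ε a b := ⟨hx, hq⟩
    rw [h] at this
    exact this.1
  · rw [← contMDiffOn_iff_contDiffOn]
    exact (contMDiffOn_of_mem_maximalAtlas he).comp (hα.mono inter_subset_left) hO'

/-- It expresses the velocities of the individual curves through the derivative of the two-variable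
map, which is jointly smooth in (s, t). -/
lemma derivWithin_strip {E : Type*} [NormedAddCommGroup E] [NormedSpace ℝ E] {ε a b : ℝ}
    (hab : a < b) {O : Set (ℝ × ℝ)} (hO : IsOpen O) {u : ℝ × ℝ → E}
    (hu : ContDiffOn ℝ ∞ u (strip ε a b ∩ O)) {q : ℝ × ℝ} (hq : q ∈ strip ε a b ∩ O) :
    derivWithin (fun r => u (q.1, r)) (Icc a b) q.2 =
      fderivWithin ℝ u (strip ε a b ∩ O) q (0, 1) := by
  have h1 := (hu.differentiableOn (by simp) q hq).hasFDerivWithinAt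
  have h2 : HasDerivWithinAt (fun r : ℝ => (q.1, r)) ((0 : ℝ), (1 : ℝ))
      (Icc a b ∩ {r | (q.1, r) ∈ O}) q.2 :=
    ((hasDerivAt_const q.2 q.1).prodMk (hasDerivAt_id q.2)).hasDerivWithinAt
  have h3 : MapsTo (fun r : ℝ => (q.1, r)) (Icc a b ∩ {r | (q.1, r) ∈ O}) (strip ε a b ∩ O) :=
    fun r hr => ⟨⟨hq.1.1, hr.1⟩, hr.2⟩
  have h4 := HasFDerivWithinAt.comp_hasDerivWithinAt (l := u) q.2 h1 h2 h3
  have h5 : {r | (q.1, r) ∈ O} ∈ nhds q.2 :=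
    (hO.preimage (by fun_prop : Continuous fun r : ℝ => (q.1, r))).mem_nhds hq.2
  exact ((hasDerivWithinAt_inter h5).1 h4).derivWithin (uniqueDiffOn_Icc hab _ hq.1.2)

lemma contMDiffOn_of_strip {ε a b : ℝ} {α : ℝ → ℝ → M}
    (hα : ContMDiffOn 𝓘(ℝ, ℝ × ℝ) (𝓡 n) ∞ (fun q : ℝ × ℝ => α q.1 q.2) (strip ε a b)) {s : ℝ}
    (hs : s ∈ Ioo (-ε) ε) : ContMDiffOn 𝓘(ℝ, ℝ) (𝓡 n) ∞ (α s) (Icc a b) := by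
  have h : ContMDiff 𝓘(ℝ, ℝ) 𝓘(ℝ, ℝ × ℝ) ∞ (fun t : ℝ => (s, t)) :=
    contMDiff_iff_contDiff.2 (by fun_prop)
  exact hα.comp h.contMDiffOn fun t ht => ⟨hs, ht⟩

lemma contDiffOn_speedOn_strip {ε a b : ℝ} (hab : a < b) {α : ℝ → ℝ → M}
    (hα : ContMDiffOn 𝓘(ℝ, ℝ × ℝ) (𝓡 n) ∞ (fun q : ℝ × ℝ => α q.1 q.2) (strip ε a b))
    (hreg : ∀ s ∈ Ioo (-ε) ε, IsRegularPiece n (α s) a b) :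
    ContDiffOn ℝ ∞ (fun q : ℝ × ℝ => speedOn F (α q.1) a b q.2) (strip ε a b) := by
  intro q hq
  set e := chartAt (Model n) (α q.1 q.2) with he'
  have he : e ∈ IsManifold.maximalAtlas (𝓡 n) ∞ M := IsManifold.chart_mem_maximalAtlas _
  obtain ⟨O, hO, hqO, hsrc, hu⟩ := exists_strip_chart hα he hq (mem_chart_source _ _)
  have hV := uniqueDiffOn_strip_inter (ε := ε) hab hO
  rw [← contDiffWithinAt_inter (hO.mem_nhds hqO)]
  have hz : ∀ r ∈ strip ε a b ∩ O, (e (α r.1 r.2),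
      fderivWithin ℝ (fun r : ℝ × ℝ => e (α r.1 r.2)) (strip ε a b ∩ O) r (0, 1)) ∈ slitTarget e := by
    intro r hr
    rw [← derivWithin_strip hab hO hu hr]
    exact (hreg r.1 hr.1.1).coord_mem hab hr.1.2 he (hsrc r hr)
  have h1 : ContDiffOn ℝ ∞ (fun r : ℝ × ℝ => chartF F e (e (α r.1 r.2),
      fderivWithin ℝ (fun r : ℝ × ℝ => e (α r.1 r.2)) (strip ε a b ∩ O) r (0, 1)))
      (strip ε a b ∩ O) :=
    (contDiffOn_chartF F he).comp
      (hu.prodMk ((hu.fderivWithin hV (by simp)).clm_apply contDiffOn_const)) hz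
  refine (h1.congr fun r hr => ?_) q ⟨hq, hqO⟩
  rw [(hreg r.1 hr.1.1).speedOn_eq F hab hr.1.2 he (hsrc r hr), ← derivWithin_strip hab hO hu hr]

/-- The integrand of the first variation of the `p`-energy. -/
def variationDensity (p : ℝ) (α : ℝ → ℝ → M) (t : ℝ) : ℝ :=
  p * speed F (α 0) t ^ (p - 1) * deriv (fun s => speed F (α s) t) 0

lemma hasDerivAt_integral_speed_strip (p : ℝ) {ε a b : ℝ} (hε : 0 < ε) (ha : 0 ≤ a) (hab : a < b)
    (hb : b ≤ 1) {α : ℝ → ℝ → M}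
    (hα : ContMDiffOn 𝓘(ℝ, ℝ × ℝ) (𝓡 n) ∞ (fun q : ℝ × ℝ => α q.1 q.2) (strip ε a b))
    (hreg : ∀ s ∈ Ioo (-ε) ε, IsRegularPiece n (α s) a b) :
    (∀ s ∈ Ioo (-ε) ε,
      IntervalIntegrable (fun t => speed F (α s) t ^ p) MeasureTheory.volume a b) ∧
    IntervalIntegrable (variationDensity F p α) MeasureTheory.volume a b ∧
    HasDerivAt (fun s => ∫ t in a..b, speed F (α s) t ^ p)
      (∫ t in a..b, variationDensity F p α t) 0 := by
  have hf := contDiffOn_speedOn_strip F hab hα hreg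
  have hpos : ∀ q ∈ strip ε a b, 0 < speedOn F (α q.1) a b q.2 :=
    fun q hq => (hreg q.1 hq.1).speedOn_pos F hq.2
  have hfp : ContDiffOn ℝ 1 (fun q : ℝ × ℝ => speedOn F (α q.1) a b q.2 ^ p) (strip ε a b) :=
    (hf.rpow_const_of_ne fun q hq => (hpos q hq).ne').of_le (by simp)
  obtain ⟨h1, h2, h3⟩ := hasDerivAt_integral_of_contDiffOn_strip hε hab hfp
  have h0 : (0 : ℝ) ∈ Ioo (-ε) ε := ⟨by linarith, hε⟩
  -- Velocities relative to `[a, b]` and `[0, 1]` can differ only at a and b, which the integral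
  -- does not see.
  have e1 : ∀ s, EqOn (fun t => speedOn F (α s) a b t ^ p) (fun t => speed F (α s) t ^ p)
      (Ioo a b) := fun s t ht => by simp only [speedOn_eq_speed F ha hb ht]
  have e2 : EqOn (fun t => deriv (fun s => speedOn F (α s) a b t ^ p) 0)
      (variationDensity F p α) (Ioo a b) := by
    intro t ht
    have hd : HasDerivAt (fun s => speedOn F (α s) a b t)
        (deriv (fun s => speedOn F (α s) a b t) 0) 0 := by
      have : ContDiffOn ℝ ∞ (fun s => speedOn F (α s) a b t) (Ioo (-ε) ε) :=
        hf.comp (f := fun s : ℝ => (s, t)) (by fun_prop) fun s hs => ⟨hs, Ioo_subset_Icc_self ht⟩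
      exact ((this.contDiffAt (isOpen_Ioo.mem_nhds h0)).differentiableAt (by simp)).hasDerivAt
    have h4 := (hd.rpow_const (p := p)
      (Or.inl (hpos (0, t) ⟨h0, Ioo_subset_Icc_self ht⟩).ne')).deriv
    simp only [variationDensity]
    rw [h4]
    simp only [speedOn_eq_speed F ha hb ht]
    ring
  refine ⟨fun s hs => (h1 s hs).congr_uIoo ?_, h2.congr_uIoo ?_, ?_⟩
  · rw [uIoo_of_le hab.le]; exact e1 s
  · rw [uIoo_of_le hab.le]; exact e2
  · rw [← intervalIntegral.integral_congr_Ioo_of_le hab.le e2]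
    simp only [← intervalIntegral.integral_congr_Ioo_of_le hab.le (e1 _)]
    exact h3

lemma IsVariation.piecewiseOn {x₀ x₁ : M} {c : ℝ → M} {ε : ℝ} {α : ℝ → ℝ → M}
    (h : IsVariation n x₀ x₁ c ε α) : PiecewiseOn fun a b =>
      ContMDiffOn 𝓘(ℝ, ℝ × ℝ) (𝓡 n) ∞ (fun q : ℝ × ℝ => α q.1 q.2) (strip ε a b) ∧
      ∀ s ∈ Ioo (-ε) ε, IsRegularPiece n (α s) a b := by
  obtain ⟨-, -, hΩ, -, hP⟩ := isVariation_iff.1 h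
  exact hP.mono fun a b ha hab hb hs => ⟨hs, fun s hs' =>
    IsRegularPiece.of_pathSpace (hΩ s hs') ha hab hb (contMDiffOn_of_strip hs hs')⟩

lemma PiecewiseOn.exists_finset {P : ℝ → ℝ → Prop} (h : PiecewiseOn P) : ∃ S : Finset ℝ,
    ∀ t ∈ Ioo (0 : ℝ) 1, t ∉ S → ∃ a b, 0 ≤ a ∧ b ≤ 1 ∧ t ∈ Ioo a b ∧ P a b := by
  obtain ⟨S, hS⟩ := h
  refine ⟨S, fun t ht htS => ?_⟩
  have hfin : (Ioo 0 1 ∩ (S : Set ℝ)ᶜ) ∈ nhds t :=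
    Filter.inter_mem (isOpen_Ioo.mem_nhds ht) (S.finite_toSet.isClosed.isOpen_compl.mem_nhds htS)
  obtain ⟨a, b, hab, hsub⟩ := mem_nhds_iff_exists_Ioo_subset.1 hfin
  have hne := nonempty_Ioo.1 ⟨t, hab⟩
  have h01 := (Ioo_subset_Ioo_iff hne).1 (hsub.trans inter_subset_left)
  exact ⟨a, b, h01.1, h01.2, hab, hS a b h01.1 hne h01.2 fun x hx hxI => (hsub hxI).2 hx⟩

lemma pEnergy_eq {x₀ x₁ : M} {c : ℝ → M} (hc : c ∈ pathSpace n x₀ x₁) (p : ℝ) :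
    pEnergy F p c = ∫ t in (0 : ℝ)..1, speed F c t ^ p := by
  obtain ⟨-, -, -, hP⟩ := mem_pathSpace_iff.1 hc
  obtain ⟨S, hS⟩ := hP.exists_finset
  apply intervalIntegral.integral_congr_ae
  -- At a corner the velocity relative to `Icc 0 1` is the default value 0; the finitely many
  -- exceptional points are discarded.
  have h1 : ∀ᵐ t ∂(MeasureTheory.volume : MeasureTheory.Measure ℝ), t ∉ insert (1 : ℝ) (S : Set ℝ) :=
    ((S.finite_toSet.insert 1).countable).ae_notMem _
  filter_upwards [h1] with t ht htI
  rw [uIoc_of_le zero_le_one] at htI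
  have ht1 : t ≠ 1 := fun h => ht (by simp [h])
  obtain ⟨a, b, ha, hb, htab, hreg⟩ := hS t ⟨htI.1, lt_of_le_of_ne htI.2 ht1⟩
    fun h => ht (by simp [h])
  have hne : velocity n c (Icc 0 1) t ≠ 0 := by
    rw [← velocity_congr_Ioo htab ⟨htI.1, lt_of_le_of_ne htI.2 ht1⟩]
    exact hreg.2 t (Ioo_subset_Icc_self htab)
  rw [fundamentalTensor_self F _ hne, ← Real.rpow_natCast, ← Real.rpow_mul (F.pos _ _ hne).le]
  congr 1
  push_cast; ring

/-- The first variation formula. -/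
lemma IsVariation.hasDerivAt_pEnergy {x₀ x₁ : M} {c : ℝ → M} {ε : ℝ} {α : ℝ → ℝ → M}
    (h : IsVariation n x₀ x₁ c ε α) (p : ℝ) :
    IntervalIntegrable (variationDensity F p α) MeasureTheory.volume 0 1 ∧
    HasDerivAt (fun s => pEnergy F p (α s)) (∫ t in (0 : ℝ)..1, variationDensity F p α t) 0 := by
  have key := (h.piecewiseOn.mono fun a b ha hab hb hP =>
    hasDerivAt_integral_speed_strip F p h.1 ha hab hb hP.1 hP.2).induction
    (fun a b c _ _ _ _ h1 h2 => by
      refine ⟨fun s hs => (h1.1 s hs).trans (h2.1 s hs), h1.2.1.trans h2.2.1, ?_⟩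
      rw [← intervalIntegral.integral_add_adjacent_intervals h1.2.1 h2.2.1]
      refine (h1.2.2.add h2.2.2).congr_of_eventuallyEq ?_
      filter_upwards [isOpen_Ioo.mem_nhds (⟨by linarith [h.1], h.1⟩ : (0 : ℝ) ∈ Ioo (-ε) ε)] with s hs
      exact (intervalIntegral.integral_add_adjacent_intervals (h1.1 s hs) (h2.1 s hs)).symm)
  refine ⟨key.2.1, key.2.2.congr_of_eventuallyEq ?_⟩
  filter_upwards [isOpen_Ioo.mem_nhds (⟨by linarith [h.1], h.1⟩ : (0 : ℝ) ∈ Ioo (-ε) ε)] with s hs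
  exact pEnergy_eq F ((isVariation_iff.1 h).2.2.1 s hs) p

lemma isCriticalPoint_iff {x₀ x₁ : M} {c : ℝ → M} {p : ℝ} : IsCriticalPoint F p x₀ x₁ c ↔
    ∀ (ε : ℝ) (α : ℝ → ℝ → M), IsVariation n x₀ x₁ c ε α →
      ∫ t in (0 : ℝ)..1, variationDensity F p α t = 0 := by
  refine forall_congr' fun ε => forall_congr' fun α => forall_congr' fun h => ?_
  have h1 := (h.hasDerivAt_pEnergy F p).2
  exact ⟨fun h2 => h1.unique h2, fun h2 => by rwa [h2] at h1⟩

end Variation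

/-! ### Geodesics are critical points -/

section Geodesic

variable {n : ℕ} {M : Type*} [TopologicalSpace M] [ChartedSpace (Model n) M]
  [IsManifold (𝓡 n) ∞ M] (F : FinslerMetric n M)

lemma exists_chart_piece {c : ℝ → M} {a b t : ℝ} (hab : a < b)
    (hc : ContMDiffOn 𝓘(ℝ, ℝ) (𝓡 n) ∞ c (Icc a b))
    {e : OpenPartialHomeomorph M (Model n)} (he : e ∈ IsManifold.maximalAtlas (𝓡 n) ∞ M)
    (ht : t ∈ Icc a b) (hx : c t ∈ e.source) :
    ∃ O : Set ℝ, IsOpen O ∧ t ∈ O ∧ (∀ r ∈ Icc a b ∩ O, c r ∈ e.source) ∧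
      ContDiffOn ℝ ∞ (fun r => e (c r)) (Icc a b ∩ O) ∧
      ContDiffOn ℝ ∞ (derivWithin (fun r => e (c r)) (Icc a b)) (Icc a b ∩ O) := by
  obtain ⟨O, hO, h⟩ := continuousOn_iff'.1 hc.continuousOn e.source e.open_source
  have hO' : ∀ r ∈ Icc a b ∩ O, c r ∈ e.source := fun r hr => by
    have : r ∈ O ∩ Icc a b := ⟨hr.2, hr.1⟩
    rw [← h] at this
    exact this.1
  have hu : ContDiffOn ℝ ∞ (fun r => e (c r)) (Icc a b ∩ O) := by
    rw [← contMDiffOn_iff_contDiffOn]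
    exact (contMDiffOn_of_mem_maximalAtlas he).comp (hc.mono inter_subset_left) hO'
  refine ⟨O, hO, ?_, hO', hu, ?_⟩
  · have : t ∈ c ⁻¹' e.source ∩ Icc a b := ⟨hx, ht⟩
    rw [h] at this
    exact this.1
  · refine (hu.derivWithin ((uniqueDiffOn_Icc hab).inter hO) (by simp)).congr fun r hr => ?_
    exact (derivWithin_inter (hO.mem_nhds hr.2)).symm

lemma hasDerivWithinAt_of_contDiffOn_inter {E : Type*} [NormedAddCommGroup E] [NormedSpace ℝ E]
    {u : ℝ → E} {S O : Set ℝ} (hO : IsOpen O) (hu : ContDiffOn ℝ ∞ u (S ∩ O)) {t : ℝ}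
    (ht : t ∈ S ∩ O) : HasDerivWithinAt u (derivWithin u S t) S t := by
  have h1 := (hu.differentiableOn (by simp) t ht).hasDerivWithinAt
  rw [hasDerivWithinAt_inter (hO.mem_nhds ht.2), derivWithin_inter (hO.mem_nhds ht.2)] at h1
  exact h1

lemma IsGeodesic.isRegularPiece {F : FinslerMetric n M} {c : ℝ → M} (hc : IsGeodesic F c) :
    IsRegularPiece n c 0 1 := ⟨hc.1, hc.2.1⟩

lemma IsGeodesic.congr {F : FinslerMetric n M} {c c' : ℝ → M} (hc : IsGeodesic F c)
    (h : ∀ t ∈ Icc (0 : ℝ) 1, c' t = c t) : IsGeodesic F c' := by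
  have h1 : ContMDiffOn 𝓘(ℝ, ℝ) (𝓡 n) ∞ c' (Icc 0 1) := hc.1.congr h
  have h2 : ∀ (e : OpenPartialHomeomorph M (Model n)), EqOn (fun r => e (c' r)) (fun r => e (c r))
      (Icc 0 1) := fun e r hr => congrArg e (h r hr)
  have hu := uniqueDiffOn_Icc (zero_lt_one' ℝ)
  have h3 : ∀ (e : OpenPartialHomeomorph M (Model n)), EqOn (derivWithin (fun r => e (c' r)) (Icc 0 1))
      (derivWithin (fun r => e (c r)) (Icc 0 1)) (Icc 0 1) := fun e r hr =>
    derivWithin_congr (h2 e) (h2 e hr)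
  refine ⟨h1, fun t ht => ?_, fun t ht e he hx i => ?_⟩
  · have hx : c' t ∈ (chartAt (Model n) (c' t)).source := mem_chart_source _ _
    have he := IsManifold.chart_mem_maximalAtlas (I := 𝓡 n) (n := ∞) (c' t)
    rw [velocity_ne_zero_iff he hx (mdifferentiableWithinAt_of_mem h1 ht) (hu t ht), h3 _ ht,
      ← velocity_ne_zero_iff he (h t ht ▸ hx) (mdifferentiableWithinAt_of_mem hc.1 ht) (hu t ht)]
    exact hc.2.1 t ht
  · have h4 := hc.2.2 t ht e he (h t ht ▸ hx) i
    refine Eq.trans ?_ h4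
    simp only [covDeriv]
    rw [derivWithin_congr (h3 e) (h3 e ht), h3 e ht, h t ht]

/-- The Euler-Lagrange equation of `F` along a geodesic and the constancy of its speed. -/
lemma IsGeodesic.eulerLagrange {F : FinslerMetric n M} {c : ℝ → M} (hc : IsGeodesic F c) {t : ℝ}
    (ht : t ∈ Icc (0 : ℝ) 1) {e : OpenPartialHomeomorph M (Model n)}
    (he : e ∈ IsManifold.maximalAtlas (𝓡 n) ∞ M) (hx : c t ∈ e.source) :
    (∀ v : Model n, fderiv ℝ (fderiv ℝ (chartF F e))
      (e (c t), derivWithin (fun r => e (c r)) (Icc 0 1) t)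
      (derivWithin (fun r => e (c r)) (Icc 0 1) t,
        derivWithin (derivWithin (fun r => e (c r)) (Icc 0 1)) (Icc 0 1) t) (0, v) =
      fderiv ℝ (chartF F e) (e (c t), derivWithin (fun r => e (c r)) (Icc 0 1) t) (v, 0)) ∧
    fderiv ℝ (chartF F e) (e (c t), derivWithin (fun r => e (c r)) (Icc 0 1) t)
      (derivWithin (fun r => e (c r)) (Icc 0 1) t,
        derivWithin (derivWithin (fun r => e (c r)) (Icc 0 1)) (Icc 0 1) t) = 0 := by
  have hz := hc.isRegularPiece.coord_mem zero_lt_one ht he hx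
  refine (geodesic_equation_iff_chartF F he hz _).1 fun i => ?_
  rw [← covDeriv_velocity F he hz]
  exact hc.2.2 t ht e he hx i

/-- The geodesic equation contains dF(u̇, ü) = 0, which is the derivative of the speed in a chart.
-/
lemma IsGeodesic.speed_eq {F : FinslerMetric n M} {c : ℝ → M} (hc : IsGeodesic F c) {t : ℝ}
    (ht : t ∈ Icc (0 : ℝ) 1) : speed F c t = speed F c 0 := by
  have key : ∀ t ∈ Icc (0 : ℝ) 1, HasDerivWithinAt (speed F c) 0 (Icc 0 1) t := by
    intro t ht
    have he := IsManifold.chart_mem_maximalAtlas (I := 𝓡 n) (n := ∞) (c t)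
    have hx : c t ∈ (chartAt (Model n) (c t)).source := mem_chart_source _ _
    set e := chartAt (Model n) (c t)
    obtain ⟨O, hO, htO, hsrc, hu, hu'⟩ := exists_chart_piece zero_lt_one hc.1 he ht hx
    have hz := hc.isRegularPiece.coord_mem zero_lt_one ht he hx
    have h1 := hasDerivWithinAt_of_contDiffOn_inter hO hu ⟨ht, htO⟩
    have h2 := hasDerivWithinAt_of_contDiffOn_inter hO hu' ⟨ht, htO⟩
    have h3 := HasFDerivAt.comp_hasDerivWithinAt (l := chartF F e) t (hasFDerivAt_chartF F he hz)
      (h1.prodMk h2)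
    rw [(hc.eulerLagrange ht he hx).2] at h3
    refine h3.congr_of_eventuallyEq ?_ (hc.isRegularPiece.speedOn_eq F zero_lt_one ht he hx)
    filter_upwards [inter_mem_nhdsWithin (Icc 0 1) (hO.mem_nhds htO)] with r hr
    exact hc.isRegularPiece.speedOn_eq F zero_lt_one hr.1 he (hsrc r hr)
  exact constant_of_derivWithin_zero (fun t ht => (key t ht).differentiableWithinAt)
    (fun t ht => (key t (Ico_subset_Icc_self ht)).derivWithin
      (uniqueDiffOn_Icc zero_lt_one t (Ico_subset_Icc_self ht))) t ht

/-- The pointwise first variation formula in a chart. -/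
lemma hasDerivAt_momentum {e : OpenPartialHomeomorph M (Model n)}
    (he : e ∈ IsManifold.maximalAtlas (𝓡 n) ∞ M) {u : ℝ × ℝ → Model n} {t : ℝ}
    (hu : ContDiffAt ℝ ∞ u (0, t)) (hz : (u (0, t), fderiv ℝ u (0, t) (0, 1)) ∈ slitTarget e)
    (hEL : ∀ v : Model n, fderiv ℝ (fderiv ℝ (chartF F e)) (u (0, t), fderiv ℝ u (0, t) (0, 1))
      (fderiv ℝ u (0, t) (0, 1), fderiv ℝ (fderiv ℝ u) (0, t) (0, 1) (0, 1)) (0, v) =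
        fderiv ℝ (chartF F e) (u (0, t), fderiv ℝ u (0, t) (0, 1)) (v, 0)) :
    HasDerivAt (fun t => fderiv ℝ (chartF F e) (u (0, t), fderiv ℝ u (0, t) (0, 1))
      (0, fderiv ℝ u (0, t) (1, 0)))
      (deriv (fun s => chartF F e (u (s, t), fderiv ℝ u (s, t) (0, 1))) 0) t := by
  have hL : HasFDerivAt (fderiv ℝ u) (fderiv ℝ (fderiv ℝ u) (0, t)) (0, t) :=
    ((hu.fderiv_right (m := 1) (by norm_cast)).differentiableAt (by simp)).hasFDerivAt
  have hu1 : HasFDerivAt u (fderiv ℝ u (0, t)) (0, t) :=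
    (hu.differentiableAt (by simp)).hasFDerivAt
  have hsymm := (hu.isSymmSndFDerivAt (by simp [show (2 : ℕ∞ω) ≤ ∞ from by norm_cast]))
    (1, 0) (0, 1)
  have l1 : HasDerivAt (fun t : ℝ => ((0 : ℝ), t)) ((0 : ℝ), (1 : ℝ)) t :=
    (hasDerivAt_const t (0 : ℝ)).prodMk (hasDerivAt_id t)
  have l2 : HasDerivAt (fun s : ℝ => (s, t)) ((1 : ℝ), (0 : ℝ)) 0 :=
    (hasDerivAt_id (0 : ℝ)).prodMk (hasDerivAt_const (0 : ℝ) t)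
  have ut : HasDerivAt (fun t => u (0, t)) (fderiv ℝ u (0, t) (0, 1)) t :=
    hu1.comp_hasDerivAt t l1
  have us : HasDerivAt (fun s => u (s, t)) (fderiv ℝ u (0, t) (1, 0)) 0 :=
    HasFDerivAt.comp_hasDerivAt (l := u) (0 : ℝ) hu1 l2
  have Lt : HasDerivAt (fun t => fderiv ℝ u (0, t)) (fderiv ℝ (fderiv ℝ u) (0, t) (0, 1)) t :=
    hL.comp_hasDerivAt t l1
  have Ls : HasDerivAt (fun s => fderiv ℝ u (s, t)) (fderiv ℝ (fderiv ℝ u) (0, t) (1, 0)) 0 :=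
    HasFDerivAt.comp_hasDerivAt (l := fderiv ℝ u) (0 : ℝ) hL l2
  have Lt1 : HasDerivAt (fun t => fderiv ℝ u (0, t) (0, 1))
      (fderiv ℝ (fderiv ℝ u) (0, t) (0, 1) (0, 1)) t := by
    simpa using Lt.clm_apply (hasDerivAt_const t ((0 : ℝ), (1 : ℝ)))
  have Lt2 : HasDerivAt (fun t => fderiv ℝ u (0, t) (1, 0))
      (fderiv ℝ (fderiv ℝ u) (0, t) (0, 1) (1, 0)) t := by
    simpa using Lt.clm_apply (hasDerivAt_const t ((1 : ℝ), (0 : ℝ)))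
  have Ls1 : HasDerivAt (fun s => fderiv ℝ u (s, t) (0, 1))
      (fderiv ℝ (fderiv ℝ u) (0, t) (1, 0) (0, 1)) 0 := by
    simpa using Ls.clm_apply (hasDerivAt_const (0 : ℝ) ((0 : ℝ), (1 : ℝ)))
  have hs : HasDerivAt (fun s => chartF F e (u (s, t), fderiv ℝ u (s, t) (0, 1)))
      (fderiv ℝ (chartF F e) (u (0, t), fderiv ℝ u (0, t) (0, 1))
        (fderiv ℝ u (0, t) (1, 0), fderiv ℝ (fderiv ℝ u) (0, t) (1, 0) (0, 1))) 0 :=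
    HasFDerivAt.comp_hasDerivAt (l := chartF F e) (0 : ℝ) (hasFDerivAt_chartF F he hz)
      (us.prodMk Ls1)
  have hB := HasDerivAt.clm_apply (HasFDerivAt.comp_hasDerivAt (l := fderiv ℝ (chartF F e)) t
    (hasFDerivAt_fderiv_chartF F he hz) (ut.prodMk Lt1))
    ((hasDerivAt_const t (0 : Model n)).prodMk Lt2)
  -- The derivative of the pairing has a term from the momentum and one from the variation field.
  -- The Euler-Lagrange equation and the equality of mixed partials turn them into the x-part and
  -- the y-part of ∂F/∂s.
  rw [hs.deriv, fderiv_apply_eq_add, hsymm, ← hEL]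
  exact hB

/-- The pairing of the momentum of `α 0` with the variation field. -/
def momentumPairing (α : ℝ → ℝ → M) (t : ℝ) : ℝ :=
  fderiv ℝ (fun w : TangentSpace (𝓡 n) (α 0 t) => F.toFun ⟨α 0 t, w⟩)
    (velocity n (α 0) (Icc 0 1) t) (velocity n (fun s => α s t) univ 0)

/-- The fundamental theorem of calculus for the momentum pairing, which is continuous on `[a, b]`
and differentiable inside. The pairing involves neither the chart nor `[a, b]`, so boundary terms of
adjacent pieces will cancel. -/
lemma integral_deriv_speed_of_isGeodesic {α : ℝ → ℝ → M} (hgeo : IsGeodesic F (α 0))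
    {ε a b : ℝ} (hε : 0 < ε) (ha : 0 ≤ a) (hab : a < b) (hb : b ≤ 1)
    (hα : ContMDiffOn 𝓘(ℝ, ℝ × ℝ) (𝓡 n) ∞ (fun q : ℝ × ℝ => α q.1 q.2) (strip ε a b))
    (hreg : ∀ s ∈ Ioo (-ε) ε, IsRegularPiece n (α s) a b)
    (hint : IntervalIntegrable (fun t => deriv (fun s => speed F (α s) t) 0)
      MeasureTheory.volume a b) :
    ∫ t in a..b, deriv (fun s => speed F (α s) t) 0 =
      momentumPairing F α b - momentumPairing F α a := by
  have h0 : (0 : ℝ) ∈ Ioo (-ε) ε := ⟨by linarith, hε⟩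
  have hI : Icc a b ⊆ Icc (0 : ℝ) 1 := Icc_subset_Icc ha hb
  -- the pairing in a chart
  have chart : ∀ t ∈ Icc a b, ∀ (O : Set (ℝ × ℝ)), IsOpen O → (0, t) ∈ O →
      ∀ e ∈ IsManifold.maximalAtlas (𝓡 n) ∞ M, (∀ r ∈ strip ε a b ∩ O, α r.1 r.2 ∈ e.source) →
      ContDiffOn ℝ ∞ (fun r : ℝ × ℝ => e (α r.1 r.2)) (strip ε a b ∩ O) →
      momentumPairing F α t = fderiv ℝ (chartF F e) (e (α 0 t),
        fderivWithin ℝ (fun r : ℝ × ℝ => e (α r.1 r.2)) (strip ε a b ∩ O) (0, t) (0, 1))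
        (0, fderivWithin ℝ (fun r : ℝ × ℝ => e (α r.1 r.2)) (strip ε a b ∩ O) (0, t) (1, 0)) := by
    intro t ht O hO htO e he hsrc hu
    have hx : α 0 t ∈ e.source := hsrc (0, t) ⟨⟨h0, ht⟩, htO⟩
    have hvel := hgeo.isRegularPiece.2 t (hI ht)
    have hz := hgeo.isRegularPiece.coord_mem zero_lt_one (hI ht) he hx
    -- The geodesic is smooth on all of `[0, 1]`, so its velocity at the ends of `[a, b]` does not
    -- depend on the parameter interval, even where the variation breaks.
    have e1 : derivWithin (fun r => e (α 0 r)) (Icc 0 1) t =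
        fderivWithin ℝ (fun r : ℝ × ℝ => e (α r.1 r.2)) (strip ε a b ∩ O) (0, t) (0, 1) := by
      rw [← derivWithin_strip hab hO hu (q := (0, t)) ⟨⟨h0, ht⟩, htO⟩]
      obtain ⟨O', hO', htO', -, hu', -⟩ := exists_chart_piece zero_lt_one hgeo.1 he (hI ht) hx
      exact (derivWithin_subset hI (uniqueDiffOn_Icc hab t ht)
        (hasDerivWithinAt_of_contDiffOn_inter hO' hu' ⟨hI ht, htO'⟩).differentiableWithinAt).symm
    have hP : {s : ℝ | s ∈ Ioo (-ε) ε ∧ (s, t) ∈ O} ∈ nhds (0 : ℝ) :=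
      Filter.inter_mem (isOpen_Ioo.mem_nhds h0)
        ((hO.preimage (by fun_prop : Continuous fun s : ℝ => (s, t))).mem_nhds htO)
    have e2 : derivWithin (fun s => e (α s t)) univ 0 =
        fderivWithin ℝ (fun r : ℝ × ℝ => e (α r.1 r.2)) (strip ε a b ∩ O) (0, t) (1, 0) := by
      rw [derivWithin_univ]
      have h1 := (hu.differentiableOn (by simp) (0, t) ⟨⟨h0, ht⟩, htO⟩).hasFDerivWithinAt
      have h2 : HasDerivWithinAt (fun s : ℝ => (s, t)) ((1 : ℝ), (0 : ℝ))
          {s : ℝ | s ∈ Ioo (-ε) ε ∧ (s, t) ∈ O} 0 :=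
        ((hasDerivAt_id (0 : ℝ)).prodMk (hasDerivAt_const (0 : ℝ) t)).hasDerivWithinAt
      have h3 := HasFDerivWithinAt.comp_hasDerivWithinAt
        (l := fun r : ℝ × ℝ => e (α r.1 r.2)) (0 : ℝ) h1 h2
        (show MapsTo _ _ (strip ε a b ∩ O) from fun s hs => ⟨⟨hs.1, ht⟩, hs.2⟩)
      exact (h3.hasDerivAt hP).deriv
    have hmd : MDifferentiableWithinAt 𝓘(ℝ, ℝ) (𝓡 n) (fun s => α s t) univ 0 := by
      have h : ContMDiff 𝓘(ℝ, ℝ) 𝓘(ℝ, ℝ × ℝ) ∞ (fun s : ℝ => (s, t)) :=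
        contMDiff_iff_contDiff.2 (by fun_prop)
      have h1 : ContMDiffOn 𝓘(ℝ, ℝ) (𝓡 n) ∞ (fun s => α s t) (Ioo (-ε) ε) :=
        hα.comp h.contMDiffOn fun s hs => ⟨hs, ht⟩
      exact ((h1.contMDiffAt (isOpen_Ioo.mem_nhds h0)).mdifferentiableAt
        (by simp)).mdifferentiableWithinAt
    unfold momentumPairing
    rw [fderiv_toFun F he hx hvel, mfderiv_chart_velocity he hx
      (mdifferentiableWithinAt_of_mem hgeo.1 (hI ht)) (uniqueDiffOn_Icc zero_lt_one t (hI ht)), ← e1,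
      ← e2, fderiv_chartF_snd F he hz]
    congr 1
    exact mfderiv_chart_velocity (c := fun s => α s t) he hx hmd uniqueDiffWithinAt_univ
  refine intervalIntegral.integral_eq_sub_of_hasDerivAt_of_le hab.le ?_ ?_ hint
  · intro t ht
    set e := chartAt (Model n) (α 0 t)
    have he : e ∈ IsManifold.maximalAtlas (𝓡 n) ∞ M := IsManifold.chart_mem_maximalAtlas _
    obtain ⟨O, hO, htO, hsrc, hu⟩ := exists_strip_chart hα he (q := (0, t)) ⟨h0, ht⟩
      (mem_chart_source _ _)
    have hD := hu.continuousOn_fderivWithin (uniqueDiffOn_strip_inter (ε := ε) hab hO) (by simp)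
    have hz : ∀ r ∈ strip ε a b ∩ O, (e (α r.1 r.2),
        fderivWithin ℝ (fun r : ℝ × ℝ => e (α r.1 r.2)) (strip ε a b ∩ O) r (0, 1)) ∈
          slitTarget e := by
      intro r hr
      rw [← derivWithin_strip hab hO hu hr]
      exact (hreg r.1 hr.1.1).coord_mem hab hr.1.2 he (hsrc r hr)
    have hdG : ContinuousOn (fderiv ℝ (chartF F e)) (slitTarget e) :=
      (contDiffOn_chartF F he).continuousOn_fderiv_of_isOpen isOpen_slitTarget (by simp)
    have h1 : ContinuousOn (fun r : ℝ × ℝ => fderiv ℝ (chartF F e) (e (α r.1 r.2),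
        fderivWithin ℝ (fun r : ℝ × ℝ => e (α r.1 r.2)) (strip ε a b ∩ O) r (0, 1))
        (0, fderivWithin ℝ (fun r : ℝ × ℝ => e (α r.1 r.2)) (strip ε a b ∩ O) r (1, 0)))
        (strip ε a b ∩ O) :=
      (hdG.comp (hu.continuousOn.prodMk (hD.clm_apply continuousOn_const)) hz).clm_apply
        (continuousOn_const.prodMk (hD.clm_apply continuousOn_const))
    have hO1 : IsOpen {r : ℝ | ((0 : ℝ), r) ∈ O} := hO.preimage (by fun_prop)
    have h2 := h1.comp (f := fun r : ℝ => ((0 : ℝ), r)) (s := Icc a b ∩ {r | (0, r) ∈ O})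
      (by fun_prop) fun r hr => ⟨⟨h0, hr.1⟩, hr.2⟩
    have h3 : ContinuousOn (momentumPairing F α) (Icc a b ∩ {r | (0, r) ∈ O}) :=
      h2.congr fun r hr => chart r hr.1 O hO hr.2 e he hsrc hu
    exact (continuousWithinAt_inter (hO1.mem_nhds htO)).1 (h3 t ⟨ht, htO⟩)
  · intro t ht
    have ht' := Ioo_subset_Icc_self ht
    set e := chartAt (Model n) (α 0 t) with hedef
    have hx : α 0 t ∈ e.source := mem_chart_source _ _
    have he : e ∈ IsManifold.maximalAtlas (𝓡 n) ∞ M := IsManifold.chart_mem_maximalAtlas _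
    obtain ⟨O, hO, htO, hsrc, hu⟩ := exists_strip_chart hα he (q := (0, t)) ⟨h0, ht'⟩ hx
    set u : ℝ × ℝ → Model n := fun r => e (α r.1 r.2) with hudef
    set W : Set (ℝ × ℝ) := (Ioo (-ε) ε ×ˢ Ioo a b) ∩ O with hW
    have hWo : IsOpen W := (isOpen_Ioo.prod isOpen_Ioo).inter hO
    have hWs : W ⊆ strip ε a b ∩ O := inter_subset_inter_left _ (prod_mono le_rfl Ioo_subset_Icc_self)
    have hfd : ∀ r ∈ W, fderivWithin ℝ u (strip ε a b ∩ O) r = fderiv ℝ u r := fun r hr =>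
      fderivWithin_of_mem_nhds (Filter.mem_of_superset (hWo.mem_nhds hr) hWs)
    have hW0 : (0, t) ∈ W := ⟨⟨h0, ht⟩, htO⟩
    have huA : ContDiffAt ℝ ∞ u (0, t) :=
      (hu.mono hWs).contDiffAt (hWo.mem_nhds hW0)
    have hWt : ∀ᶠ r in nhds t, ((0 : ℝ), r) ∈ W :=
      (hWo.preimage (by fun_prop : Continuous fun r : ℝ => ((0 : ℝ), r))).mem_nhds hW0
    have hWs' : ∀ᶠ s in nhds (0 : ℝ), (s, t) ∈ W :=
      (hWo.preimage (by fun_prop : Continuous fun s : ℝ => (s, t))).mem_nhds hW0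
    have hder : ∀ r, ((0 : ℝ), r) ∈ W →
        derivWithin (fun r => e (α 0 r)) (Icc 0 1) r = fderiv ℝ u (0, r) (0, 1) := by
      intro r hr
      have hr1 : r ∈ Ioo a b := hr.1.2
      rw [derivWithin_of_mem_nhds (Icc_mem_nhds (ha.trans_lt hr1.1) (hr1.2.trans_le hb)), ← hfd _ hr,
        ← derivWithin_strip hab hO hu (hWs hr),
        derivWithin_of_mem_nhds (Icc_mem_nhds hr1.1 hr1.2)]
    have hz := hgeo.isRegularPiece.coord_mem zero_lt_one (hI ht') he hx
    have hEL := (hgeo.eulerLagrange (hI ht') he hx).1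
    have hder2 : derivWithin (derivWithin (fun r => e (α 0 r)) (Icc 0 1)) (Icc 0 1) t =
        fderiv ℝ (fderiv ℝ u) (0, t) (0, 1) (0, 1) := by
      rw [derivWithin_of_mem_nhds (Icc_mem_nhds (ha.trans_lt ht.1) (ht.2.trans_le hb))]
      have h1 : derivWithin (fun r => e (α 0 r)) (Icc 0 1) =ᶠ[nhds t]
          fun r => fderiv ℝ u (0, r) (0, 1) := hWt.mono hder
      rw [h1.deriv_eq]
      have hL : HasFDerivAt (fderiv ℝ u) (fderiv ℝ (fderiv ℝ u) (0, t)) (0, t) :=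
        ((huA.fderiv_right (m := 1) (by norm_cast)).differentiableAt (by simp)).hasFDerivAt
      have l1 : HasDerivAt (fun t : ℝ => ((0 : ℝ), t)) ((0 : ℝ), (1 : ℝ)) t :=
        (hasDerivAt_const t (0 : ℝ)).prodMk (hasDerivAt_id t)
      have h2 : HasDerivAt (fun t => fderiv ℝ u (0, t)) (fderiv ℝ (fderiv ℝ u) (0, t) (0, 1)) t :=
        hL.comp_hasDerivAt t l1
      have h3 := (h2.clm_apply (hasDerivAt_const t ((0 : ℝ), (1 : ℝ)))).deriv
      simpa using h3
    rw [hder2, hder t hW0] at hEL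
    rw [hder t hW0] at hz
    have key := hasDerivAt_momentum F he huA hz hEL
    have e1 : (fun s => chartF F e (u (s, t), fderiv ℝ u (s, t) (0, 1))) =ᶠ[nhds 0]
        fun s => speed F (α s) t := by
      filter_upwards [hWs'] with s hs
      have hs1 : s ∈ Ioo (-ε) ε := hs.1.1
      rw [← speedOn_eq_speed F ha hb ht,
        (hreg s hs1).speedOn_eq F hab ht' he (hsrc (s, t) (hWs hs)), ← hfd _ hs,
        ← derivWithin_strip hab hO hu (hWs hs)]
    rw [← e1.deriv_eq]
    refine key.congr_of_eventuallyEq ?_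
    filter_upwards [hWt] with r hr
    rw [chart r (hWs hr).1.2 O hO (hWs hr).2 e he hsrc hu, hfd _ hr]

/-- If α s t does not move with s, its variation field at t is zero; this applies at the two end
points. -/
lemma momentumPairing_eq_zero {α : ℝ → ℝ → M} {ε t : ℝ} {x : M} (hε : 0 < ε)
    (h : ∀ s ∈ Ioo (-ε) ε, α s t = x) : momentumPairing F α t = 0 := by
  have h1 : (fun s => α s t) =ᶠ[nhds 0] fun _ => x := by
    filter_upwards [isOpen_Ioo.mem_nhds (⟨by linarith, hε⟩ : (0 : ℝ) ∈ Ioo (-ε) ε)] with s hs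
      using h s hs
  have h2 : velocity n (fun s => α s t) univ 0 = 0 := by
    unfold velocity
    rw [mfderivWithin_univ]
    have : HasMFDerivAt 𝓘(ℝ, ℝ) (𝓡 n) (fun s => α s t) 0 0 :=
      (hasMFDerivAt_const x (0 : ℝ)).congr_of_eventuallyEq h1
    rw [this.mfderiv]
    rfl
  unfold momentumPairing
  rw [h2, map_zero]

/-- Constant speed makes p F^(p-1) a constant factor of the first variation, which reduces to that
of length. The latter telescopes to the momentum pairings at the end points. -/
theorem IsGeodesic.isCriticalPoint {F : FinslerMetric n M} {c : ℝ → M} (hc : IsGeodesic F c) {x₀ x₁ : M}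
    (p : ℝ) : IsCriticalPoint F p x₀ x₁ c := by
  rw [isCriticalPoint_iff]
  intro ε α h
  obtain ⟨hε, h0, hΩ, -, -⟩ := isVariation_iff.1 h
  have hgeo : IsGeodesic F (α 0) := hc.congr h0
  have hd : ∀ t, variationDensity F 1 α t = deriv (fun s => speed F (α s) t) 0 := fun t => by
    simp [variationDensity]
  have h1 : ∀ t ∈ Icc (0 : ℝ) 1, variationDensity F p α t =
      p * speed F (α 0) 0 ^ (p - 1) * deriv (fun s => speed F (α s) t) 0 := fun t ht => by
    rw [variationDensity, hgeo.speed_eq ht]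
  rw [intervalIntegral.integral_congr (g := fun t => p * speed F (α 0) 0 ^ (p - 1) *
    deriv (fun s => speed F (α s) t) 0) (fun t ht => h1 t (by rwa [uIcc_of_le zero_le_one] at ht)),
    intervalIntegral.integral_const_mul]
  have key := (h.piecewiseOn.mono (Q := fun a b =>
      IntervalIntegrable (fun t => deriv (fun s => speed F (α s) t) 0) MeasureTheory.volume a b ∧
      ∫ t in a..b, deriv (fun s => speed F (α s) t) 0 =
        momentumPairing F α b - momentumPairing F α a) fun a b ha hab hb hP => by
    have hint := (hasDerivAt_integral_speed_strip F 1 hε ha hab hb hP.1 hP.2).2.1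
    have hint' : IntervalIntegrable (fun t => deriv (fun s => speed F (α s) t) 0)
      MeasureTheory.volume a b := by
      simpa only [funext hd] using hint
    exact ⟨hint', integral_deriv_speed_of_isGeodesic F hgeo hε ha hab hb hP.1 hP.2 hint'⟩).induction
    (fun a b c _ _ _ _ h1 h2 => ⟨h1.1.trans h2.1, by
      rw [← intervalIntegral.integral_add_adjacent_intervals h1.1 h2.1, h1.2, h2.2]; ring⟩)
  rw [key.2, momentumPairing_eq_zero F hε fun s hs => (hΩ s hs).2.1,
    momentumPairing_eq_zero F hε fun s hs => (hΩ s hs).2.2.1]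
  simp

end Geodesic

/-! ### Variations supported in a chart -/

section ChartVariation

variable {n : ℕ} {M : Type*} [TopologicalSpace M] [ChartedSpace (Model n) M]
  [IsManifold (𝓡 n) ∞ M] (F : FinslerMetric n M)

lemma continuousOn_strip_union {X Y : Type*} [TopologicalSpace X] [TopologicalSpace Y]
    {f : X × ℝ → Y} {I : Set X} {a m b : ℝ} (ham : a ≤ m) (hmb : m ≤ b)
    (h1 : ContinuousOn f (I ×ˢ Icc a m)) (h2 : ContinuousOn f (I ×ˢ Icc m b)) :
    ContinuousOn f (I ×ˢ Icc a b) := by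
  rw [← Icc_union_Icc_eq_Icc ham hmb, prod_union]
  have key : ∀ {l r : ℝ}, ContinuousOn f (I ×ˢ Icc l r) → ∀ q : X × ℝ, q.1 ∈ I →
      ContinuousWithinAt f (I ×ˢ Icc l r) q := by
    intro l r h q hq
    by_cases hq2 : q.2 ∈ Icc l r
    · exact h q ⟨hq, hq2⟩
    · refine continuousWithinAt_of_notMem_closure fun hcl => hq2 ?_
      rw [closure_prod_eq, isClosed_Icc.closure_eq] at hcl
      exact hcl.2
  rintro q (hq | hq)
  · exact (key h1 q hq.1).union (key h2 q hq.1)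
  · exact (key h1 q hq.1).union (key h2 q hq.1)

lemma IsRegularPiece.contDiffOn_coord {c : ℝ → M} {a b : ℝ} (h : IsRegularPiece n c a b)
    (hab : a < b) {e : OpenPartialHomeomorph M (Model n)}
    (he : e ∈ IsManifold.maximalAtlas (𝓡 n) ∞ M) (hsrc : ∀ t ∈ Icc a b, c t ∈ e.source) :
    ContDiffOn ℝ ∞ (fun r => e (c r)) (Icc a b) ∧
      ContDiffOn ℝ ∞ (derivWithin (fun r => e (c r)) (Icc a b)) (Icc a b) := by
  have hu : ContDiffOn ℝ ∞ (fun r => e (c r)) (Icc a b) := by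
    rw [← contMDiffOn_iff_contDiffOn]
    exact (contMDiffOn_of_mem_maximalAtlas he).comp h.1 hsrc
  exact ⟨hu, hu.derivWithin (uniqueDiffOn_Icc hab) (by simp)⟩

lemma IsRegularPiece.congr {c c' : ℝ → M} {a b : ℝ} (h : IsRegularPiece n c a b)
    (heq : ∀ t ∈ Icc a b, c' t = c t) : IsRegularPiece n c' a b := by
  refine ⟨h.1.congr heq, fun t ht h0 => h.2 t ht ?_⟩
  unfold velocity at h0 ⊢
  rw [mfderivWithin_congr heq (heq t ht)] at h0
  exact h0

/-- The condition is open and holds on the compact set {0} × [a, b], so the tube lemma gives a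
uniform ε. -/
lemma exists_chart_variation_mem {c : ℝ → M} {a b : ℝ} (h : IsRegularPiece n c a b)
    (hab : a < b) {e : OpenPartialHomeomorph M (Model n)}
    (he : e ∈ IsManifold.maximalAtlas (𝓡 n) ∞ M) (hsrc : ∀ t ∈ Icc a b, c t ∈ e.source)
    {ρ : ℝ → ℝ} (hρ : ContDiff ℝ ∞ ρ) (v : Model n) :
    ∃ ε > 0, ∀ s ∈ Ioo (-ε) ε, ∀ t ∈ Icc a b, (e (c t) + (s * ρ t) • v,
      derivWithin (fun r => e (c r)) (Icc a b) t + (s * deriv ρ t) • v) ∈ slitTarget e := by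
  obtain ⟨hu, hu'⟩ := h.contDiffOn_coord hab he hsrc
  have hρ' : Continuous (deriv ρ) := hρ.continuous_deriv (by simp)
  have hρc := hρ.continuous
  have hsnd : MapsTo (Prod.snd : ℝ × ℝ → ℝ) (univ ×ˢ Icc a b) (Icc a b) := fun q hq => hq.2
  have hΦ : ContinuousOn (fun q : ℝ × ℝ => (e (c q.2) + (q.1 * ρ q.2) • v,
      derivWithin (fun r => e (c r)) (Icc a b) q.2 + (q.1 * deriv ρ q.2) • v))
      (univ ×ˢ Icc a b) :=
    ((hu.continuousOn.comp continuousOn_snd hsnd).add (by fun_prop)).prodMk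
      ((hu'.continuousOn.comp continuousOn_snd hsnd).add (by fun_prop))
  obtain ⟨O, hO, hOeq⟩ := continuousOn_iff'.1 hΦ (slitTarget e) isOpen_slitTarget
  have hsub : ({0} : Set ℝ) ×ˢ Icc a b ⊆ O := by
    rintro ⟨s, t⟩ ⟨hs, ht⟩
    obtain rfl : s = 0 := hs
    have h1 := h.coord_mem hab ht he (hsrc t ht)
    refine (hOeq.subset ⟨?_, mem_univ _, ht⟩).1
    simpa using h1
  obtain ⟨U, V, hU, -, hU0, hV, hUV⟩ := generalized_tube_lemma isCompact_singleton isCompact_Icc hO hsub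
  obtain ⟨ε, hε, hball⟩ := Metric.isOpen_iff.1 hU 0 (hU0 rfl)
  refine ⟨ε, hε, fun s hs t ht => ?_⟩
  have h1 : (s, t) ∈ O := hUV ⟨hball (by simpa [abs_lt] using hs), hV ht⟩
  exact (hOeq.superset ⟨h1, mem_univ _, ht⟩).1

/-- Pushing `c` on `(a, b)` in the coordinate direction `v`. -/
def chartVariation (c : ℝ → M) (e : OpenPartialHomeomorph M (Model n)) (a b : ℝ) (ρ : ℝ → ℝ)
    (v : Model n) (s t : ℝ) : M :=
  if t ∈ Ioo a b then e.symm (e (c t) + (s * ρ t) • v) else c t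

lemma chartVariation_of_notMem {c : ℝ → M} {e : OpenPartialHomeomorph M (Model n)} {a b : ℝ}
    {ρ : ℝ → ℝ} {v : Model n} {s t : ℝ} (ht : t ∉ Ioo a b) :
    chartVariation c e a b ρ v s t = c t := if_neg ht

/-- Because ρ vanishes outside (a, b), the coordinate formula persists at a and b, so the variation
is smooth up to the seams. -/
lemma chartVariation_of_mem {c : ℝ → M} {e : OpenPartialHomeomorph M (Model n)} {a b : ℝ}
    {ρ : ℝ → ℝ} (hρ : tsupport ρ ⊆ Ioo a b) {v : Model n} {s t : ℝ} (hx : c t ∈ e.source) :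
    chartVariation c e a b ρ v s t = e.symm (e (c t) + (s * ρ t) • v) := by
  unfold chartVariation
  split_ifs with h
  · rfl
  · have : ρ t = 0 := image_eq_zero_of_notMem_tsupport fun h' => h (hρ h')
    rw [this, mul_zero, zero_smul, add_zero, e.left_inv hx]

lemma regular_of_chart_eq {c : ℝ → M} {α : ℝ → ℝ → M} {a b : ℝ} (h : IsRegularPiece n c a b)
    (hab : a < b) {e : OpenPartialHomeomorph M (Model n)}
    (he : e ∈ IsManifold.maximalAtlas (𝓡 n) ∞ M) (hsrc : ∀ t ∈ Icc a b, c t ∈ e.source)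
    {ρ : ℝ → ℝ} (hρ : ContDiff ℝ ∞ ρ) {v : Model n} {ε : ℝ}
    (hε : ∀ s ∈ Ioo (-ε) ε, ∀ t ∈ Icc a b, (e (c t) + (s * ρ t) • v,
      derivWithin (fun r => e (c r)) (Icc a b) t + (s * deriv ρ t) • v) ∈ slitTarget e)
    (hα : ∀ s, ∀ t ∈ Icc a b, α s t = e.symm (e (c t) + (s * ρ t) • v)) :
    ContMDiffOn 𝓘(ℝ, ℝ × ℝ) (𝓡 n) ∞ (fun q : ℝ × ℝ => α q.1 q.2) (strip ε a b) ∧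
    ∀ s ∈ Ioo (-ε) ε, IsRegularPiece n (α s) a b ∧ ∀ t ∈ Icc a b, α s t ∈ e.source ∧
      e (α s t) = e (c t) + (s * ρ t) • v ∧ derivWithin (fun r => e (α s r)) (Icc a b) t =
        derivWithin (fun r => e (c r)) (Icc a b) t + (s * deriv ρ t) • v := by
  obtain ⟨hu, hu'⟩ := h.contDiffOn_coord hab he hsrc
  have hsm : ContMDiffOn 𝓘(ℝ, ℝ × ℝ) (𝓡 n) ∞ (fun q : ℝ × ℝ => α q.1 q.2) (strip ε a b) := by
    have h1 : ContDiffOn ℝ ∞ (fun q : ℝ × ℝ => e (c q.2) + (q.1 * ρ q.2) • v) (strip ε a b) :=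
      (hu.comp contDiffOn_snd fun q hq => hq.2).add (by fun_prop)
    exact ((contMDiffOn_symm_of_mem_maximalAtlas he).comp (contMDiffOn_iff_contDiffOn.2 h1)
      fun q hq => (hε q.1 hq.1 q.2 hq.2).1).congr fun q hq => hα q.1 q.2 hq.2
  refine ⟨hsm, fun s hs => ?_⟩
  have hmem : ∀ t ∈ Icc a b, α s t ∈ e.source ∧ e (α s t) = e (c t) + (s * ρ t) • v := by
    intro t ht
    have := (hε s hs t ht).1
    rw [hα s t ht]
    exact ⟨e.map_target this, e.right_inv this⟩
  have hder : ∀ t ∈ Icc a b, derivWithin (fun r => e (α s r)) (Icc a b) t =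
      derivWithin (fun r => e (c r)) (Icc a b) t + (s * deriv ρ t) • v := by
    intro t ht
    rw [derivWithin_congr (fun r hr => (hmem r hr).2) (hmem t ht).2]
    have h1 := (hu.differentiableOn (by simp) t ht).hasDerivWithinAt
    have h2 : HasDerivAt ρ (deriv ρ t) t := (hρ.differentiable (by simp) t).hasDerivAt
    exact (h1.add ((h2.const_mul s).smul_const v).hasDerivWithinAt).derivWithin
      (uniqueDiffOn_Icc hab t ht)
  have hs1 := contMDiffOn_of_strip hsm hs
  refine ⟨⟨hs1, fun t ht => ?_⟩, fun t ht => ⟨(hmem t ht).1, (hmem t ht).2, hder t ht⟩⟩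
  rw [velocity_ne_zero_iff he (hmem t ht).1 (mdifferentiableWithinAt_of_mem hs1 ht)
    (uniqueDiffOn_Icc hab t ht), hder t ht]
  exact (hε s hs t ht).2

lemma isVariation_chartVariation {x₀ x₁ : M} {c : ℝ → M} (hc : c ∈ pathSpace n x₀ x₁)
    {a m b : ℝ} (ha : 0 ≤ a) (ham : a < m) (hmb : m < b) (hb : b ≤ 1)
    (h1 : IsRegularPiece n c a m) (h2 : IsRegularPiece n c m b)
    {e : OpenPartialHomeomorph M (Model n)}
    (he : e ∈ IsManifold.maximalAtlas (𝓡 n) ∞ M) (hsrc : ∀ t ∈ Icc a b, c t ∈ e.source)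
    {ρ : ℝ → ℝ} (hρ : ContDiff ℝ ∞ ρ) (hρs : tsupport ρ ⊆ Ioo a b) {v : Model n} {ε : ℝ}
    (hε0 : 0 < ε)
    (hε1 : ∀ s ∈ Ioo (-ε) ε, ∀ t ∈ Icc a m, (e (c t) + (s * ρ t) • v,
      derivWithin (fun r => e (c r)) (Icc a m) t + (s * deriv ρ t) • v) ∈ slitTarget e)
    (hε2 : ∀ s ∈ Ioo (-ε) ε, ∀ t ∈ Icc m b, (e (c t) + (s * ρ t) • v,
      derivWithin (fun r => e (c r)) (Icc m b) t + (s * deriv ρ t) • v) ∈ slitTarget e) :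
    IsVariation n x₀ x₁ c ε (chartVariation c e a b ρ v) := by
  have hα : ∀ s, ∀ t ∈ Icc a b, chartVariation c e a b ρ v s t =
    e.symm (e (c t) + (s * ρ t) • v) := fun s t ht => chartVariation_of_mem hρs (hsrc t ht)
  have k1 := regular_of_chart_eq h1 ham he (fun t ht => hsrc t ⟨ht.1, ht.2.trans hmb.le⟩) hρ hε1
    fun s t ht => hα s t ⟨ht.1, ht.2.trans hmb.le⟩
  have k2 := regular_of_chart_eq h2 hmb he (fun t ht => hsrc t ⟨ham.le.trans ht.1, ht.2⟩) hρ hε2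
    fun s t ht => hα s t ⟨ham.le.trans ht.1, ht.2⟩
  obtain ⟨hcc, hc0, hc1, hP⟩ := mem_pathSpace_iff.1 hc
  -- Adding a, m, b to the exceptional points puts every admissible interval inside `[a, m]`, inside
  -- `[m, b]`, or outside (a, b).
  have hS : PiecewiseOn fun a' b' => ∀ x ∈ ({a, m, b} : Finset ℝ), x ∉ Ioo a' b' :=
    ⟨{a, m, b}, fun a' b' _ _ _ h => h⟩
  have hpw : PiecewiseOn fun a' b' =>
      ContMDiffOn 𝓘(ℝ, ℝ × ℝ) (𝓡 n) ∞ (fun q : ℝ × ℝ => chartVariation c e a b ρ v q.1 q.2)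
        (strip ε a' b') ∧ ∀ s ∈ Ioo (-ε) ε, IsRegularPiece n (chartVariation c e a b ρ v s) a' b' := by
    refine (hP.and hS).mono fun a' b' ha' hab' hb' hPS => ?_
    obtain ⟨hreg, hS⟩ := hPS
    simp only [Finset.mem_insert, Finset.mem_singleton, forall_eq_or_imp, forall_eq, mem_Ioo,
      not_and_or, not_lt] at hS
    obtain ⟨hSa, hSm, hSb⟩ := hS
    have out : (∀ t ∈ Icc a' b', t ∉ Ioo a b) → ContMDiffOn 𝓘(ℝ, ℝ × ℝ) (𝓡 n) ∞
        (fun q : ℝ × ℝ => chartVariation c e a b ρ v q.1 q.2) (strip ε a' b') ∧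
        ∀ s ∈ Ioo (-ε) ε, IsRegularPiece n (chartVariation c e a b ρ v s) a' b' := fun hout => by
      have heq : ∀ s, ∀ t ∈ Icc a' b', chartVariation c e a b ρ v s t = c t :=
        fun s t ht => chartVariation_of_notMem (hout t ht)
      have hsm : ContMDiffOn 𝓘(ℝ, ℝ × ℝ) (𝓡 n) ∞ (fun q : ℝ × ℝ => chartVariation c e a b ρ v q.1 q.2)
          (strip ε a' b') := by
        have h : ContMDiff 𝓘(ℝ, ℝ × ℝ) 𝓘(ℝ, ℝ) ∞ (Prod.snd : ℝ × ℝ → ℝ) :=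
          contMDiff_iff_contDiff.2 contDiff_snd
        exact (hreg.1.comp h.contMDiffOn fun q hq => hq.2).congr fun q hq => heq q.1 q.2 hq.2
      exact And.intro hsm fun s hs => hreg.congr (heq s)
    rcases le_or_gt b' a with h | h
    · exact out fun t ht ht' => by linarith [ht.2, ht'.1]
    rcases le_or_gt b a' with h' | h'
    · exact out fun t ht ht' => by linarith [ht.1, ht'.2]
    have haa : a ≤ a' := hSa.resolve_right (not_le.2 h)
    have hbb : b' ≤ b := hSb.resolve_left (not_le.2 h')
    rcases hSm with h3 | h3
    · exact ⟨k2.1.mono (prod_mono le_rfl (Icc_subset_Icc h3 hbb)), fun s hs =>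
        (k2.2 s hs).1.subset h3 hab' hbb⟩
    · exact ⟨k1.1.mono (prod_mono le_rfl (Icc_subset_Icc haa h3)), fun s hs =>
        (k1.2 s hs).1.subset haa hab' h3⟩
  have hcont : ContinuousOn (fun q : ℝ × ℝ => chartVariation c e a b ρ v q.1 q.2)
      (Ioo (-ε) ε ×ˢ Icc 0 1) :=
    (hpw.mono (Q := fun a' b' => ContinuousOn
      (fun q : ℝ × ℝ => chartVariation c e a b ρ v q.1 q.2) (strip ε a' b'))
      fun _ _ _ _ _ h => h.1.continuousOn).induction
      fun a b c _ hab hbc _ h1 h2 => continuousOn_strip_union hab.le hbc.le h1 h2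
  refine isVariation_iff.2 ⟨hε0, fun t _ => ?_, fun s hs => mem_pathSpace_iff.2 ⟨?_, ?_, ?_, ?_⟩,
    hcont, hpw.mono fun _ _ _ _ _ h => h.1⟩
  · by_cases ht : t ∈ Ioo a b
    · rw [hα 0 t (Ioo_subset_Icc_self ht), zero_mul, zero_smul, add_zero,
        e.left_inv (hsrc t (Ioo_subset_Icc_self ht))]
    · exact chartVariation_of_notMem ht
  · exact hcont.comp (f := fun t : ℝ => (s, t)) (by fun_prop) fun t ht => ⟨hs, ht⟩
  · rw [chartVariation_of_notMem (by simp [ha]), hc0]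
  · rw [chartVariation_of_notMem (by simp [hb]), hc1]
  · exact hpw.mono fun _ _ _ _ _ h => h.2 s hs

end ChartVariation

/-! ### The Euler-Lagrange equation of the energy -/

section EnergyEulerLagrange

variable {n : ℕ} {M : Type*} [TopologicalSpace M] [ChartedSpace (Model n) M]
  [IsManifold (𝓡 n) ∞ M] (F : FinslerMetric n M)

lemma speedOn_congr {c c' : ℝ → M} {a b t : ℝ} (h : ∀ t ∈ Icc a b, c' t = c t)
    (ht : t ∈ Icc a b) : speedOn F c' a b t = speedOn F c a b t := by
  have key : ∀ (x y : M) (v : Model n), x = y →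
      F.toFun ⟨x, (v : TangentSpace (𝓡 n) x)⟩ = F.toFun ⟨y, (v : TangentSpace (𝓡 n) y)⟩ := by
    rintro x _ v rfl; rfl
  unfold speedOn velocity
  rw [mfderivWithin_congr h (h t ht)]
  exact key _ _ _ (h t ht)

/-- The coordinates of `(c, ċ)`, with velocities relative to `[a, b]`. -/
def chartVelocity (c : ℝ → M) (e : OpenPartialHomeomorph M (Model n)) (a b t : ℝ) :
    Model n × Model n := (e (c t), derivWithin (fun r => e (c r)) (Icc a b) t)

/-- The derivative of `F ^ p` at `(c, ċ)` in coordinates. -/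
def chartMomentum (p : ℝ) (c : ℝ → M) (e : OpenPartialHomeomorph M (Model n)) (a b : ℝ)
    (w : Model n × Model n) (t : ℝ) : ℝ :=
  p * chartF F e (chartVelocity c e a b t) ^ (p - 1) *
    fderiv ℝ (chartF F e) (chartVelocity c e a b t) w

variable {F}

lemma contDiffOn_chartMomentum (p : ℝ) {c : ℝ → M} {a b : ℝ} (h : IsRegularPiece n c a b)
    (hab : a < b) {e : OpenPartialHomeomorph M (Model n)}
    (he : e ∈ IsManifold.maximalAtlas (𝓡 n) ∞ M) (hsrc : ∀ t ∈ Icc a b, c t ∈ e.source)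
    (w : Model n × Model n) : ContDiffOn ℝ ∞ (chartMomentum F p c e a b w) (Icc a b) := by
  obtain ⟨hu, hu'⟩ := h.contDiffOn_coord hab he hsrc
  have hz : MapsTo (chartVelocity c e a b) (Icc a b) (slitTarget e) :=
    fun t ht => h.coord_mem hab ht he (hsrc t ht)
  have hv : ContDiffOn ℝ ∞ (chartVelocity c e a b) (Icc a b) := hu.prodMk hu'
  have hG := contDiffOn_chartF F he
  have hdG : ContDiffOn ℝ ∞ (fderiv ℝ (chartF F e)) (slitTarget e) :=
    hG.fderiv_of_isOpen isOpen_slitTarget (by simp)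
  exact (contDiffOn_const.mul ((hG.comp hv hz).rpow_const_of_ne fun t ht =>
    (chartF_pos F he (hz ht)).ne')).mul ((hdG.comp hv hz).clm_apply contDiffOn_const)

/-- In coordinates the curves are u + sρv, so the chain rule at s = 0 gives ∂_x(F^p)v · ρ +
∂_y(F^p)v · ρ'. -/
lemma variationDensity_eq_chartMomentum (p : ℝ) {c : ℝ → M} {a b : ℝ}
    (h : IsRegularPiece n c a b) (ha : 0 ≤ a)
    (hab : a < b) (hb : b ≤ 1) {e : OpenPartialHomeomorph M (Model n)}
    (he : e ∈ IsManifold.maximalAtlas (𝓡 n) ∞ M) (hsrc : ∀ t ∈ Icc a b, c t ∈ e.source)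
    {ρ : ℝ → ℝ} {v : Model n} {ε : ℝ} (hε : 0 < ε) {α : ℝ → ℝ → M}
    (hα : ∀ s ∈ Ioo (-ε) ε, IsRegularPiece n (α s) a b ∧ ∀ t ∈ Icc a b, α s t ∈ e.source ∧
      e (α s t) = e (c t) + (s * ρ t) • v ∧ derivWithin (fun r => e (α s r)) (Icc a b) t =
        derivWithin (fun r => e (c r)) (Icc a b) t + (s * deriv ρ t) • v) {t : ℝ}
    (ht : t ∈ Ioo a b) : variationDensity F p α t =
      chartMomentum F p c e a b (v, 0) t * ρ t + chartMomentum F p c e a b (0, v) t * deriv ρ t := by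
  have ht' := Ioo_subset_Icc_self ht
  have hz := h.coord_mem hab ht' he (hsrc t ht')
  have h0 : (0 : ℝ) ∈ Ioo (-ε) ε := ⟨by linarith, hε⟩
  have hsp : ∀ s ∈ Ioo (-ε) ε, speed F (α s) t = chartF F e (e (c t) + (s * ρ t) • v,
      derivWithin (fun r => e (c r)) (Icc a b) t + (s * deriv ρ t) • v) := by
    intro s hs
    obtain ⟨h1, h2⟩ := hα s hs
    rw [← speedOn_eq_speed F ha hb ht, h1.speedOn_eq F hab ht' he (h2 t ht').1, (h2 t ht').2.1,
      (h2 t ht').2.2]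
  have hl : ∀ (x : Model n) (r : ℝ), HasDerivAt (fun s : ℝ => x + (s * r) • v) (r • v) 0 := by
    intro x r
    simpa using (((hasDerivAt_id (0 : ℝ)).mul_const r).smul_const v).const_add x
  have hd : HasDerivAt (fun s => chartF F e (e (c t) + (s * ρ t) • v,
      derivWithin (fun r => e (c r)) (Icc a b) t + (s * deriv ρ t) • v))
      (fderiv ℝ (chartF F e) (chartVelocity c e a b t) (ρ t • v, deriv ρ t • v)) 0 := by
    refine HasFDerivAt.comp_hasDerivAt (l := chartF F e) (0 : ℝ) ?_ ((hl _ _).prodMk (hl _ _))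
    simp only [zero_mul, zero_smul, add_zero]
    exact hasFDerivAt_chartF F he hz
  have heq : (fun s => speed F (α s) t) =ᶠ[nhds 0] fun s => chartF F e (e (c t) + (s * ρ t) • v,
      derivWithin (fun r => e (c r)) (Icc a b) t + (s * deriv ρ t) • v) := by
    filter_upwards [isOpen_Ioo.mem_nhds h0] with s hs using hsp s hs
  have h3 : ((ρ t • v, deriv ρ t • v) : Model n × Model n) =
      ρ t • (v, (0 : Model n)) + deriv ρ t • ((0 : Model n), v) := by simp
  have h4 := hsp 0 h0
  simp only [zero_mul, zero_smul, add_zero] at h4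
  unfold variationDensity
  rw [heq.deriv_eq, hd.deriv, h3, map_add, map_smul, map_smul, h4]
  simp only [chartMomentum, smul_eq_mul]
  change p * chartF F e (chartVelocity c e a b t) ^ (p - 1) * _ = _
  ring

lemma variationDensity_eq_zero (p : ℝ) {c : ℝ → M} {a b : ℝ} (ha : 0 ≤ a) (hb : b ≤ 1)
    {α : ℝ → ℝ → M} (hα : ∀ s, ∀ t ∈ Icc a b, α s t = c t) {t : ℝ} (ht : t ∈ Ioo a b) :
    variationDensity F p α t = 0 := by
  have h1 : (fun s => speed F (α s) t) = fun _ => speed F c t := by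
    funext s
    rw [← speedOn_eq_speed F ha hb ht, speedOn_congr F (hα s) (Ioo_subset_Icc_self ht),
      speedOn_eq_speed F ha hb ht]
  rw [variationDensity, h1]
  simp

/-- The weak Euler-Lagrange equation around a possible corner of a critical point. -/
lemma IsCriticalPoint.eulerLagrange {p : ℝ} {x₀ x₁ : M} {c : ℝ → M} (hcrit : IsCriticalPoint F p x₀ x₁ c)
    (hc : c ∈ pathSpace n x₀ x₁) {a m b : ℝ} (ha : 0 ≤ a) (ham : a < m) (hmb : m < b) (hb : b ≤ 1)
    (h1 : IsRegularPiece n c a m) (h2 : IsRegularPiece n c m b)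
    {e : OpenPartialHomeomorph M (Model n)}
    (he : e ∈ IsManifold.maximalAtlas (𝓡 n) ∞ M) (hsrc : ∀ t ∈ Icc a b, c t ∈ e.source)
    (v : Model n) :
    EqOn (derivWithin (chartMomentum F p c e a m (0, v)) (Icc a m)) (chartMomentum F p c e a m (v, 0))
      (Ioo a m) ∧ chartMomentum F p c e a m (0, v) m = chartMomentum F p c e m b (0, v) m := by
  have hs1 : ∀ t ∈ Icc a m, c t ∈ e.source := fun t ht => hsrc t ⟨ht.1, ht.2.trans hmb.le⟩
  have hs2 : ∀ t ∈ Icc m b, c t ∈ e.source := fun t ht => hsrc t ⟨ham.le.trans ht.1, ht.2⟩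
  have hX := fun w => contDiffOn_chartMomentum (F := F) p h1 ham he hs1 w
  have hX' := fun w => contDiffOn_chartMomentum (F := F) p h2 hmb he hs2 w
  obtain ⟨k1, -, k2⟩ := weak_eulerLagrange ham hmb (hX (0, v)) (hX (v, 0)).continuousOn
    (hX' (0, v)) (hX' (v, 0)).continuousOn fun ρ hρ _ hρs => by
      obtain ⟨ε₁, hε₁, H1⟩ := exists_chart_variation_mem h1 ham he hs1 hρ v
      obtain ⟨ε₂, hε₂, H2⟩ := exists_chart_variation_mem h2 hmb he hs2 hρ v
      set ε := min ε₁ ε₂ with hεdef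
      have hε : 0 < ε := lt_min hε₁ hε₂
      have hI1 : Ioo (-ε) ε ⊆ Ioo (-ε₁) ε₁ :=
        Ioo_subset_Ioo (neg_le_neg (min_le_left _ _)) (min_le_left _ _)
      have hI2 : Ioo (-ε) ε ⊆ Ioo (-ε₂) ε₂ :=
        Ioo_subset_Ioo (neg_le_neg (min_le_right _ _)) (min_le_right _ _)
      replace H1 := fun s hs => H1 s (hI1 hs)
      replace H2 := fun s hs => H2 s (hI2 hs)
      have hvar := isVariation_chartVariation hc ha ham hmb hb h1 h2 he hsrc hρ hρs hε H1 H2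
      have hα : ∀ s, ∀ t ∈ Icc a b, chartVariation c e a b ρ v s t =
        e.symm (e (c t) + (s * ρ t) • v) := fun s t ht => chartVariation_of_mem hρs (hsrc t ht)
      have r1 := (regular_of_chart_eq h1 ham he hs1 hρ H1
        fun s t ht => hα s t ⟨ht.1, ht.2.trans hmb.le⟩).2
      have r2 := (regular_of_chart_eq h2 hmb he hs2 hρ H2
        fun s t ht => hα s t ⟨ham.le.trans ht.1, ht.2⟩).2
      have hint := (hvar.hasDerivAt_pEnergy F p).1
      have h0 := (isCriticalPoint_iff F).1 hcrit ε _ hvar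
      have hsub : ∀ {l r : ℝ}, 0 ≤ l → l ≤ r → r ≤ 1 → IntervalIntegrable
          (variationDensity F p (chartVariation c e a b ρ v)) MeasureTheory.volume l r :=
        fun hl hlr hr => hint.mono_set (by
          rw [uIcc_of_le hlr, uIcc_of_le zero_le_one]; exact Icc_subset_Icc hl hr)
      have ha1 : a ≤ 1 := by linarith
      have hm0 : 0 ≤ m := by linarith
      have hm1 : m ≤ 1 := by linarith
      have hb0 : 0 ≤ b := by linarith
      -- Split `[0, 1]` at a, m and b: the outer parts vanish, and the two inner ones form the weak
      -- equation across m.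
      rw [← intervalIntegral.integral_add_adjacent_intervals (hsub le_rfl hm0 hm1)
          (hsub hm0 hm1 le_rfl),
        ← intervalIntegral.integral_add_adjacent_intervals (hsub le_rfl ha ha1)
          (hsub ha ham.le hm1),
        ← intervalIntegral.integral_add_adjacent_intervals (hsub hm0 hmb.le hb)
          (hsub hb0 hb le_rfl),
        intervalIntegral.integral_congr_Ioo_of_le (g := fun _ => (0 : ℝ)) ha fun t ht =>
          variationDensity_eq_zero p le_rfl ha1 (fun s t ht => chartVariation_of_notMem
            fun h => by linarith [ht.2, h.1]) ht,
        intervalIntegral.integral_congr_Ioo_of_le (g := fun _ => (0 : ℝ)) hb fun t ht =>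
          variationDensity_eq_zero p hb0 le_rfl (fun s t ht => chartVariation_of_notMem
            fun h => by linarith [ht.1, h.2]) ht,
        intervalIntegral.integral_congr_Ioo_of_le ham.le fun t ht =>
          variationDensity_eq_chartMomentum p h1 ha ham hm1 he hs1 hε r1 ht,
        intervalIntegral.integral_congr_Ioo_of_le hmb.le fun t ht =>
          variationDensity_eq_chartMomentum p h2 hm0 hmb hb he hs2 hε r2 ht] at h0
      simpa using h0
  exact ⟨k1, k2⟩

end EnergyEulerLagrange

/-! ### Critical points of the `p`-energy are geodesics -/

section CriticalPoint

variable {n : ℕ} {M : Type*} [TopologicalSpace M] [ChartedSpace (Model n) M]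
  [IsManifold (𝓡 n) ∞ M] (F : FinslerMetric n M)

/-- `c` is a geodesic on `[a, b]`. -/
def IsGeodesicOn (c : ℝ → M) (a b : ℝ) : Prop :=
  IsRegularPiece n c a b ∧ ∀ t ∈ Icc a b, ∀ e ∈ IsManifold.maximalAtlas (𝓡 n) ∞ M,
    c t ∈ e.source → ∀ i : Fin n,
      derivWithin (derivWithin (fun r => e (c r)) (Icc a b)) (Icc a b) t i +
        christoffel00 F e i (e (c t)) (derivWithin (fun r => e (c r)) (Icc a b) t) = 0

variable {F}

lemma IsGeodesicOn.isGeodesic {c : ℝ → M} (h : IsGeodesicOn F c 0 1) : IsGeodesic F c := by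
  refine ⟨h.1.1, h.1.2, fun t ht e he hx i => ?_⟩
  rw [covDeriv_velocity F he (h.1.coord_mem zero_lt_one ht he hx)]
  exact h.2 t ht e he hx i

/-- Since c is smooth on the larger interval, restricting the parameter interval changes neither
coordinate derivative, even at its ends. -/
lemma derivWithin_coord_subset {c : ℝ → M} {a b a' b' t : ℝ}
    (h : ContMDiffOn 𝓘(ℝ, ℝ) (𝓡 n) ∞ c (Icc a b)) (ha : a ≤ a') (hab : a' < b') (hb : b' ≤ b)
    {e : OpenPartialHomeomorph M (Model n)} (he : e ∈ IsManifold.maximalAtlas (𝓡 n) ∞ M)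
    (ht : t ∈ Icc a' b') (hx : c t ∈ e.source) :
    derivWithin (fun r => e (c r)) (Icc a' b') t = derivWithin (fun r => e (c r)) (Icc a b) t ∧
    derivWithin (derivWithin (fun r => e (c r)) (Icc a' b')) (Icc a' b') t =
      derivWithin (derivWithin (fun r => e (c r)) (Icc a b)) (Icc a b) t := by
  have hsub := Icc_subset_Icc ha hb
  obtain ⟨O, hO, htO, hsrc, hu, hu'⟩ :=
    exists_chart_piece (ha.trans_lt (hab.trans_le hb)) h he (hsub ht) hx
  have h1 : ∀ r ∈ Icc a' b' ∩ O, derivWithin (fun r => e (c r)) (Icc a' b') r =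
      derivWithin (fun r => e (c r)) (Icc a b) r := fun r hr =>
    derivWithin_subset hsub (uniqueDiffOn_Icc hab r hr.1)
      (hasDerivWithinAt_of_contDiffOn_inter hO hu ⟨hsub hr.1, hr.2⟩).differentiableWithinAt
  refine ⟨h1 t ⟨ht, htO⟩, ?_⟩
  rw [← derivWithin_inter (hO.mem_nhds htO), derivWithin_congr h1 (h1 t ⟨ht, htO⟩),
    derivWithin_inter (hO.mem_nhds htO)]
  exact derivWithin_subset hsub (uniqueDiffOn_Icc hab t ht)
      (hasDerivWithinAt_of_contDiffOn_inter hO hu' ⟨hsub ht, htO⟩).differentiableWithinAt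

lemma IsCriticalPoint.geodesic_equation {p : ℝ} (hp0 : p ≠ 0) (hp1 : p ≠ 1) {x₀ x₁ : M} {c : ℝ → M}
    (hcrit : IsCriticalPoint F p x₀ x₁ c)
    (hc : c ∈ pathSpace n x₀ x₁) {a m b : ℝ} (ha : 0 ≤ a) (ham : a < m) (hmb : m < b) (hb : b ≤ 1)
    (h1 : IsRegularPiece n c a m) (h2 : IsRegularPiece n c m b)
    {e : OpenPartialHomeomorph M (Model n)}
    (he : e ∈ IsManifold.maximalAtlas (𝓡 n) ∞ M) (hsrc : ∀ t ∈ Icc a b, c t ∈ e.source)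
    {t : ℝ} (ht : t ∈ Ioo a m) (i : Fin n) :
    derivWithin (derivWithin (fun r => e (c r)) (Icc a m)) (Icc a m) t i +
        christoffel00 F e i (e (c t)) (derivWithin (fun r => e (c r)) (Icc a m) t) = 0 := by
  have hs1 : ∀ t ∈ Icc a m, c t ∈ e.source := fun t ht => hsrc t ⟨ht.1, ht.2.trans hmb.le⟩
  have ht' := Ioo_subset_Icc_self ht
  have hz := h1.coord_mem ham ht' he (hs1 t ht')
  obtain ⟨hu, hu'⟩ := h1.contDiffOn_coord ham he hs1
  have d1 := (hu.differentiableOn (by simp) t ht').hasDerivWithinAt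
  have d2 := (hu'.differentiableOn (by simp) t ht').hasDerivWithinAt
  have dz : HasDerivWithinAt (chartVelocity c e a m) _ (Icc a m) t := d1.prodMk d2
  refine geodesic_equation_of_eulerLagrange F he hp0 hp1 hz _ (fun v => ?_) i
  have hG := HasFDerivAt.comp_hasDerivWithinAt (l := chartF F e) t (hasFDerivAt_chartF F he hz) dz
  have hdG := HasFDerivAt.comp_hasDerivWithinAt (l := fderiv ℝ (chartF F e)) t
    (hasFDerivAt_fderiv_chartF F he hz) dz
  have hP := ((hG.rpow_const (p := p - 1) (Or.inl (chartF_pos F he hz).ne')).const_mul p).mul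
    (hdG.clm_apply (hasDerivWithinAt_const t (Icc a m) ((0 : Model n), v)))
  have h3 := hP.derivWithin (uniqueDiffOn_Icc ham t ht')
  have h4 := (hcrit.eulerLagrange hc ha ham hmb hb h1 h2 he hsrc v).1 ht
  have h5 := h3.symm.trans h4
  simp only [chartMomentum, chartVelocity, map_zero, add_zero, Function.comp_apply,
    show p - 1 - 1 = p - 2 by ring] at h5
  refine Eq.trans ?_ h5
  ring

lemma IsCriticalPoint.geodesic_equation_of_mem_Ioo {p : ℝ} (hp0 : p ≠ 0) (hp1 : p ≠ 1) {x₀ x₁ : M}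
    {c : ℝ → M} (hcrit : IsCriticalPoint F p x₀ x₁ c) (hc : c ∈ pathSpace n x₀ x₁) {a b : ℝ}
    (ha : 0 ≤ a) (hb : b ≤ 1) (h : IsRegularPiece n c a b)
    {e : OpenPartialHomeomorph M (Model n)} (he : e ∈ IsManifold.maximalAtlas (𝓡 n) ∞ M) {O : Set ℝ}
    (hO : IsOpen O) (hsrc : ∀ r ∈ Icc a b ∩ O, c r ∈ e.source) {t : ℝ} (ht : t ∈ Ioo a b ∩ O)
    (i : Fin n) : derivWithin (derivWithin (fun r => e (c r)) (Icc a b)) (Icc a b) t i +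
        christoffel00 F e i (e (c t)) (derivWithin (fun r => e (c r)) (Icc a b) t) = 0 := by
  have hsub : Ioo a b ∩ O ⊆ Icc a b ∩ O := inter_subset_inter_left _ Ioo_subset_Icc_self
  obtain ⟨l, r, hlr, hsubI⟩ := mem_nhds_iff_exists_Ioo_subset.1 ((isOpen_Ioo.inter hO).mem_nhds ht)
  have hl := hlr.1
  have hr := hlr.2
  -- At an interior point there is no break, so an artificial one is placed at (t + r)/2; t lies in
  -- the left half of the window, where the equation is available.
  have hIcc : ∀ x ∈ Icc ((l + t) / 2) ((t + 3 * r) / 4), x ∈ Ioo a b ∩ O := fun x hx =>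
    hsubI ⟨by linarith [hx.1], by linarith [hx.2]⟩
  have hl' := (hIcc ((l + t) / 2) ⟨le_rfl, by linarith⟩).1
  have hr' := (hIcc ((t + 3 * r) / 4) ⟨by linarith, le_rfl⟩).1
  have key := hcrit.geodesic_equation hp0 hp1 hc (a := (l + t) / 2) (m := (t + r) / 2)
    (b := (t + 3 * r) / 4) (ha.trans hl'.1.le) (by linarith) (by linarith) (hr'.2.le.trans hb)
    (h.subset hl'.1.le (by linarith) (by linarith [hr'.2]))
    (h.subset (by linarith [hl'.1]) (by linarith) hr'.2.le) he
    (fun x hx => hsrc x (hsub (hIcc x hx))) (t := t) ⟨by linarith, by linarith⟩ i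
  obtain ⟨e1, e2⟩ := derivWithin_coord_subset (t := t) h.1 hl'.1.le
    (show (l + t) / 2 < (t + r) / 2 by linarith) (by linarith [hr'.2]) he
    ⟨by linarith, by linarith⟩ (hsrc t (hsub ht))
  rw [e1, e2] at key
  exact key

lemma continuousOn_geodesic_equation {c : ℝ → M} {a b : ℝ} (hab : a < b)
    (h : IsRegularPiece n c a b) {e : OpenPartialHomeomorph M (Model n)}
    (he : e ∈ IsManifold.maximalAtlas (𝓡 n) ∞ M) {O : Set ℝ} (hO : IsOpen O)
    (hsrc : ∀ r ∈ Icc a b ∩ O, c r ∈ e.source)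
    (hu : ContDiffOn ℝ ∞ (fun r => e (c r)) (Icc a b ∩ O))
    (hu' : ContDiffOn ℝ ∞ (derivWithin (fun r => e (c r)) (Icc a b)) (Icc a b ∩ O)) (i : Fin n) :
    ContinuousOn (fun t => derivWithin (derivWithin (fun r => e (c r)) (Icc a b)) (Icc a b) t i +
        christoffel00 F e i (e (c t)) (derivWithin (fun r => e (c r)) (Icc a b) t))
      (Icc a b ∩ O) := by
  have hu'' : ContinuousOn (derivWithin (derivWithin (fun r => e (c r)) (Icc a b)) (Icc a b))
      (Icc a b ∩ O) := by
    refine ((hu'.continuousOn_derivWithin ((uniqueDiffOn_Icc hab).inter hO) (by simp))).congr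
      fun r hr => (derivWithin_inter (hO.mem_nhds hr.2)).symm
  have h1 := (EuclideanSpace.proj i : Model n →L[ℝ] ℝ).continuous.comp_continuousOn hu''
  have h2 := (contDiffOn_christoffel00 F he i).continuousOn.comp
    (hu.continuousOn.prodMk hu'.continuousOn) fun r hr => h.coord_mem hab hr.1 he (hsrc r hr)
  exact h1.add h2

/-- The equation holds in the open piece, and continuity of the one-sided derivatives carries it to
the end points. -/
lemma IsCriticalPoint.isGeodesicOn {p : ℝ} (hp0 : p ≠ 0) (hp1 : p ≠ 1) {x₀ x₁ : M} {c : ℝ → M}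
    (hcrit : IsCriticalPoint F p x₀ x₁ c) (hc : c ∈ pathSpace n x₀ x₁) {a b : ℝ} (ha : 0 ≤ a)
    (hab : a < b) (hb : b ≤ 1) (h : IsRegularPiece n c a b) : IsGeodesicOn F c a b := by
  refine ⟨h, fun t ht e he hx i => ?_⟩
  obtain ⟨O, hO, htO, hsrc, hu, hu'⟩ := exists_chart_piece hab h.1 he ht hx
  have hE := continuousOn_geodesic_equation (F := F) hab h he hO hsrc hu hu' i
  have h0 := fun t ht => hcrit.geodesic_equation_of_mem_Ioo hp0 hp1 hc ha hb h he hO hsrc (t := t) ht i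
  have hcl : Icc a b ∩ O ⊆ closure (Ioo a b ∩ O) := by
    rintro x ⟨hx, hxO⟩
    rw [← closure_Ioo hab.ne] at hx
    exact hO.closure_inter ⟨hx, hxO⟩
  have h1 := EqOn.of_subset_closure (g := fun _ => (0 : ℝ)) (s := Ioo a b ∩ O) h0 hE
    continuousOn_const (inter_subset_inter_left _ Ioo_subset_Icc_self) hcl
  exact h1 ⟨ht, htO⟩

/-- The Weierstrass-Erdmann corner condition equates the one-sided momenta, and the Legendre
transformation of F^p is injective for p ≠ 1. -/
lemma IsCriticalPoint.velocity_eq {p : ℝ} (hp0 : p ≠ 0) (hp1 : p ≠ 1) {x₀ x₁ : M} {c : ℝ → M}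
    (hcrit : IsCriticalPoint F p x₀ x₁ c) (hc : c ∈ pathSpace n x₀ x₁) {a m b : ℝ} (ha : 0 ≤ a)
    (ham : a < m) (hmb : m < b) (hb : b ≤ 1) (h1 : IsRegularPiece n c a m)
    (h2 : IsRegularPiece n c m b) {e : OpenPartialHomeomorph M (Model n)}
    (he : e ∈ IsManifold.maximalAtlas (𝓡 n) ∞ M) (hsrc : ∀ t ∈ Icc a b, c t ∈ e.source) :
    derivWithin (fun r => e (c r)) (Icc a m) m = derivWithin (fun r => e (c r)) (Icc m b) m := by
  have hx := hsrc m ⟨ham.le, hmb.le⟩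
  have hz1 := h1.coord_mem ham (right_mem_Icc.2 ham.le) he hx
  have hz2 := h2.coord_mem hmb (left_mem_Icc.2 hmb.le) he hx
  refine (isMinkowskiNorm_localF F he hz1.1).eq_of_legendre_eq hp1 hz1.2 hz2.2 fun v => ?_
  have h3 := (hcrit.eulerLagrange hc ha ham hmb hb h1 h2 he hsrc v).2
  simp only [chartMomentum, chartVelocity, mul_assoc] at h3
  have h4 := mul_left_cancel₀ hp0 h3
  rw [fderiv_chartF_snd F he hz1, fderiv_chartF_snd F he hz2] at h4
  exact h4

lemma hasDerivWithinAt_Icc_union {E : Type*} [NormedAddCommGroup E] [NormedSpace ℝ E]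
    {f f' : ℝ → E} {a m b : ℝ} (ham : a ≤ m) (hmb : m ≤ b)
    (h1 : ∀ t ∈ Icc a m, HasDerivWithinAt f (f' t) (Icc a m) t)
    (h2 : ∀ t ∈ Icc m b, HasDerivWithinAt f (f' t) (Icc m b) t) :
    ∀ t ∈ Icc a b, HasDerivWithinAt f (f' t) (Icc a b) t := by
  -- Away from a closed interval differentiability within it is vacuous, so no case distinction on t
  -- is needed in the union.
  have key : ∀ {l r : ℝ}, (∀ t ∈ Icc l r, HasDerivWithinAt f (f' t) (Icc l r) t) →
      ∀ t, HasDerivWithinAt f (f' t) (Icc l r) t := by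
    intro l r h t
    by_cases ht : t ∈ Icc l r
    · exact h t ht
    · exact HasFDerivWithinAt.of_notMem_closure (by rwa [isClosed_Icc.closure_eq])
  intro t _
  rw [← Icc_union_Icc_eq_Icc ham hmb]
  exact (key h1 t).union (key h2 t)

/-- A broken solution of a second order equation without corner is smooth. -/
lemma contDiffOn_of_second_order {E : Type*} [NormedAddCommGroup E] [NormedSpace ℝ E]
    {U : Set (E × E)} {Γ : E × E → E} (hΓ : ContDiffOn ℝ ∞ Γ U) {u : ℝ → E} {a m b : ℝ}
    (ham : a < m) (hmb : m < b) (hu1 : ContDiffOn ℝ ∞ u (Icc a m)) (hu2 : ContDiffOn ℝ ∞ u (Icc m b))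
    (hU1 : ∀ t ∈ Icc a m, (u t, derivWithin u (Icc a m) t) ∈ U)
    (hU2 : ∀ t ∈ Icc m b, (u t, derivWithin u (Icc m b) t) ∈ U)
    (h1 : ∀ t ∈ Icc a m, derivWithin (derivWithin u (Icc a m)) (Icc a m) t =
      Γ (u t, derivWithin u (Icc a m) t))
    (h2 : ∀ t ∈ Icc m b, derivWithin (derivWithin u (Icc m b)) (Icc m b) t =
      Γ (u t, derivWithin u (Icc m b) t))
    (hm : derivWithin u (Icc a m) m = derivWithin u (Icc m b) m) : ContDiffOn ℝ ∞ u (Icc a b) := by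
  set v : ℝ → E := fun t => if t ≤ m then derivWithin u (Icc a m) t else derivWithin u (Icc m b) t
    with hv
  have v1 : EqOn v (derivWithin u (Icc a m)) (Icc a m) := fun t ht => if_pos ht.2
  have v2 : EqOn v (derivWithin u (Icc m b)) (Icc m b) := by
    intro t ht
    rcases eq_or_lt_of_le ht.1 with rfl | hlt
    · rw [v1 (right_mem_Icc.2 ham.le), hm]
    · exact if_neg (not_le.2 hlt)
  have w1 : ∀ {l r : ℝ}, l < r → ContDiffOn ℝ ∞ u (Icc l r) → EqOn v (derivWithin u (Icc l r)) (Icc l r) →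
      (∀ t ∈ Icc l r, derivWithin (derivWithin u (Icc l r)) (Icc l r) t =
        Γ (u t, derivWithin u (Icc l r) t)) →
      ∀ t ∈ Icc l r, HasDerivWithinAt (fun t => (u t, v t)) (v t, Γ (u t, v t)) (Icc l r) t := by
    intro l r hlr hu hve hΓe t ht
    have d1 := (hu.differentiableOn (by simp) t ht).hasDerivWithinAt
    have d2 := ((hu.derivWithin (uniqueDiffOn_Icc hlr) (m := ∞) (by simp)).differentiableOn
      (by simp) t ht).hasDerivWithinAt
    rw [hΓe t ht] at d2
    rw [hve ht]
    exact d1.prodMk (d2.congr hve (hve ht))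
  have hw := hasDerivWithinAt_Icc_union ham.le hmb.le (w1 ham hu1 v1 h1) (w1 hmb hu2 v2 h2)
  have hmaps : MapsTo (fun t => (u t, v t)) (Icc a b) U := by
    intro t ht
    rcases le_total t m with htm | htm
    · have := hU1 t ⟨ht.1, htm⟩
      rwa [← v1 ⟨ht.1, htm⟩] at this
    · have := hU2 t ⟨htm, ht.2⟩
      rwa [← v2 ⟨htm, ht.2⟩] at this
  -- Without a velocity jump, (u, v) solves the first order system (u, v)' = (v, Γ(u, v)) across m,
  -- and the bootstrap applies.
  have hsm := contDiffOn_of_hasDerivWithinAt_comp (H := fun z : E × E => (z.2, Γ z))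
    (uniqueDiffOn_Icc (ham.trans hmb)) (contDiff_snd.contDiffOn.prodMk hΓ) hmaps hw
  exact contDiff_fst.comp_contDiffOn hsm

end CriticalPoint

/-! ### Removing the corners of critical points. -/

section Corners

variable {n : ℕ} {M : Type*} [TopologicalSpace M] [ChartedSpace (Model n) M]
  [IsManifold (𝓡 n) ∞ M] {F : FinslerMetric n M}

lemma IsGeodesicOn.subset {c : ℝ → M} {a b a' b' : ℝ} (h : IsGeodesicOn F c a b) (ha : a ≤ a')
    (hab : a' < b') (hb : b' ≤ b) : IsGeodesicOn F c a' b' := by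
  refine ⟨h.1.subset ha hab hb, fun t ht e he hx i => ?_⟩
  obtain ⟨e1, e2⟩ := derivWithin_coord_subset h.1.1 ha hab hb he ht hx
  rw [e1, e2]
  exact h.2 t (Icc_subset_Icc ha hb ht) e he hx i

/-- Two geodesics form a geodesic if the resulting curve is smooth. -/
lemma IsGeodesicOn.union {c : ℝ → M} {a m b : ℝ} (ham : a < m) (hmb : m < b)
    (h1 : IsGeodesicOn F c a m) (h2 : IsGeodesicOn F c m b)
    (hc : ContMDiffOn 𝓘(ℝ, ℝ) (𝓡 n) ∞ c (Icc a b)) : IsGeodesicOn F c a b := by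
  have hcases : ∀ t ∈ Icc a b, ∃ l r, a ≤ l ∧ l < r ∧ r ≤ b ∧ t ∈ Icc l r ∧ IsGeodesicOn F c l r := by
    intro t ht
    rcases le_total t m with h | h
    · exact ⟨a, m, le_rfl, ham, hmb.le, ⟨ht.1, h⟩, h1⟩
    · exact ⟨m, b, ham.le, hmb, le_rfl, ⟨h, ht.2⟩, h2⟩
  refine ⟨⟨hc, fun t ht => ?_⟩, fun t ht e he hx i => ?_⟩
  · obtain ⟨l, r, hl, hlr, hr, htlr, h⟩ := hcases t ht
    rw [← velocity_subset hlr (Icc_subset_Icc hl hr) htlr (mdifferentiableWithinAt_of_mem hc ht)]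
    exact h.1.2 t htlr
  · obtain ⟨l, r, hl, hlr, hr, htlr, h⟩ := hcases t ht
    obtain ⟨e1, e2⟩ := derivWithin_coord_subset hc hl hlr hr he htlr hx
    rw [← e1, ← e2]
    exact h.2 t htlr e he hx i

/-- Two geodesics in a chart form a smooth curve if they meet without corner. -/
lemma IsGeodesicOn.contMDiffOn_of_chart {c : ℝ → M} {a m b : ℝ} (ham : a < m) (hmb : m < b)
    (h1 : IsGeodesicOn F c a m) (h2 : IsGeodesicOn F c m b)
    {e : OpenPartialHomeomorph M (Model n)} (he : e ∈ IsManifold.maximalAtlas (𝓡 n) ∞ M)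
    (hsrc : ∀ t ∈ Icc a b, c t ∈ e.source)
    (hm : derivWithin (fun r => e (c r)) (Icc a m) m = derivWithin (fun r => e (c r)) (Icc m b) m) :
    ContMDiffOn 𝓘(ℝ, ℝ) (𝓡 n) ∞ c (Icc a b) := by
  have hs1 : ∀ t ∈ Icc a m, c t ∈ e.source := fun t ht => hsrc t ⟨ht.1, ht.2.trans hmb.le⟩
  have hs2 : ∀ t ∈ Icc m b, c t ∈ e.source := fun t ht => hsrc t ⟨ham.le.trans ht.1, ht.2⟩
  have hΓ : ContDiffOn ℝ ∞ (fun z : Model n × Model n =>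
      (WithLp.toLp 2 fun i => -christoffel00 F e i z.1 z.2 : Model n)) (slitTarget e) :=
    contDiffOn_euclidean.2 fun i => (contDiffOn_christoffel00 F he i).neg
  have hu := contDiffOn_of_second_order hΓ ham hmb (h1.1.contDiffOn_coord ham he hs1).1
    (h2.1.contDiffOn_coord hmb he hs2).1 (fun t ht => h1.1.coord_mem ham ht he (hs1 t ht))
    (fun t ht => h2.1.coord_mem hmb ht he (hs2 t ht))
    (fun t ht => by
      ext i
      exact eq_neg_of_add_eq_zero_left (h1.2 t ht e he (hs1 t ht) i))
    (fun t ht => by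
      ext i
      exact eq_neg_of_add_eq_zero_left (h2.2 t ht e he (hs2 t ht) i)) hm
  exact ((contMDiffOn_symm_of_mem_maximalAtlas he).comp (contMDiffOn_iff_contDiffOn.2 hu)
    fun t ht => e.map_source (hsrc t ht)).congr fun t ht => (e.left_inv (hsrc t ht)).symm

lemma IsCriticalPoint.isGeodesicOn_union {p : ℝ} (hp0 : p ≠ 0) (hp1 : p ≠ 1) {x₀ x₁ : M} {c : ℝ → M}
    (hcrit : IsCriticalPoint F p x₀ x₁ c) (hc : c ∈ pathSpace n x₀ x₁) {a m b : ℝ} (ha : 0 ≤ a)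
    (ham : a < m) (hmb : m < b) (hb : b ≤ 1) (h1 : IsGeodesicOn F c a m)
    (h2 : IsGeodesicOn F c m b) : IsGeodesicOn F c a b := by
  refine h1.union ham hmb h2 ?_
  have hx := mem_chart_source (Model n) (c m)
  have he := IsManifold.chart_mem_maximalAtlas (I := 𝓡 n) (n := ∞) (c m)
  set e := chartAt (Model n) (c m)
  obtain ⟨O₁, hO₁, hm₁, hs₁, -⟩ := exists_chart_piece ham h1.1.1 he (right_mem_Icc.2 ham.le) hx
  obtain ⟨O₂, hO₂, hm₂, hs₂, -⟩ := exists_chart_piece hmb h2.1.1 he (left_mem_Icc.2 hmb.le) hx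
  -- The corner analysis needs a single chart, so both pieces are shortened to `[a', m]` and `[m,
  -- b']` inside the chart around c(m). Away from m smoothness is already known.
  obtain ⟨l, r, ⟨hl, hr⟩, hsub⟩ := mem_nhds_iff_exists_Ioo_subset.1
    ((hO₁.inter hO₂).mem_nhds ⟨hm₁, hm₂⟩)
  set a' := max a ((l + m) / 2)
  set b' := min b ((m + r) / 2)
  have ha1 : a ≤ a' := le_max_left _ _
  have ha2 : (l + m) / 2 ≤ a' := le_max_right _ _
  have ha3 : a' < m := max_lt ham (by linarith)
  have hb1 : b' ≤ b := min_le_left _ _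
  have hb2 : b' ≤ (m + r) / 2 := min_le_right _ _
  have hb3 : m < b' := lt_min hmb (by linarith)
  have hsrc : ∀ t ∈ Icc a' b', c t ∈ e.source := by
    intro t ht
    have htO : t ∈ O₁ ∩ O₂ := hsub ⟨by linarith [ht.1], by linarith [ht.2]⟩
    rcases le_total t m with h | h
    · exact hs₁ t ⟨⟨ha1.trans ht.1, h⟩, htO.1⟩
    · exact hs₂ t ⟨⟨h, ht.2.trans hb1⟩, htO.2⟩
  have k1 := h1.subset ha1 ha3 le_rfl
  have k2 := h2.subset le_rfl hb3 hb1
  have hsm := k1.contMDiffOn_of_chart ha3 hb3 k2 he hsrc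
    (hcrit.velocity_eq hp0 hp1 hc (ha.trans ha1) ha3 hb3 (hb1.trans hb) k1.1 k2.1 he hsrc)
  intro t ht
  rcases lt_trichotomy t m with h | rfl | h
  · refine (h1.1.1 t ⟨ht.1, h.le⟩).mono_of_mem_nhdsWithin ?_
    filter_upwards [inter_mem_nhdsWithin (Icc a b) (isOpen_Iio.mem_nhds h)] with r hr
    exact ⟨hr.1.1, le_of_lt hr.2⟩
  · refine (hsm t ⟨ha3.le, hb3.le⟩).mono_of_mem_nhdsWithin ?_
    exact mem_nhdsWithin_of_mem_nhds (Icc_mem_nhds ha3 hb3)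
  · refine (h2.1.1 t ⟨h.le, ht.2⟩).mono_of_mem_nhdsWithin ?_
    filter_upwards [inter_mem_nhdsWithin (Icc a b) (isOpen_Ioi.mem_nhds h)] with r hr
    exact ⟨le_of_lt hr.2, hr.1.2⟩

theorem IsCriticalPoint.isGeodesic {p : ℝ} (hp0 : p ≠ 0) (hp1 : p ≠ 1) {x₀ x₁ : M} {c : ℝ → M}
    (hcrit : IsCriticalPoint F p x₀ x₁ c) (hc : c ∈ pathSpace n x₀ x₁) : IsGeodesic F c := by
  obtain ⟨-, -, -, hP⟩ := mem_pathSpace_iff.1 hc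
  refine IsGeodesicOn.isGeodesic ((hP.mono fun a b ha hab hb h =>
    hcrit.isGeodesicOn hp0 hp1 hc ha hab hb h).induction fun a m b ha ham hmb hb h1 h2 =>
      hcrit.isGeodesicOn_union hp0 hp1 hc ha ham hmb hb h1 h2)

end Corners

/-! ### Changes of parameter -/

section ParameterChange

/-- `φ` is smooth on `[a, b]` with positive derivative. -/
def IsParameterPiece (φ : ℝ → ℝ) (a b : ℝ) : Prop :=
  ContDiffOn ℝ ∞ φ (Icc a b) ∧ ∀ t ∈ Icc a b, 0 < derivWithin φ (Icc a b) t

lemma IsParameterPiece.hasDerivWithinAt {φ : ℝ → ℝ} {a b t : ℝ} (h : IsParameterPiece φ a b)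
    (ht : t ∈ Icc a b) : HasDerivWithinAt φ (derivWithin φ (Icc a b) t) (Icc a b) t :=
  (h.1.differentiableOn (by simp) t ht).hasDerivWithinAt

lemma IsParameterPiece.subset {φ : ℝ → ℝ} {a b a' b' : ℝ} (h : IsParameterPiece φ a b) (ha : a ≤ a')
    (hab : a' < b') (hb : b' ≤ b) : IsParameterPiece φ a' b' := by
  have hsub := Icc_subset_Icc ha hb
  refine ⟨h.1.mono hsub, fun t ht => ?_⟩
  rw [((h.hasDerivWithinAt (hsub ht)).mono hsub).derivWithin (uniqueDiffOn_Icc hab t ht)]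
  exact h.2 t (hsub ht)

lemma IsParameterPiece.congr {φ φ' : ℝ → ℝ} {a b : ℝ} (h : IsParameterPiece φ a b)
    (heq : EqOn φ' φ (Icc a b)) : IsParameterPiece φ' a b := by
  refine ⟨h.1.congr heq, fun t ht => ?_⟩
  rw [derivWithin_congr heq (heq ht)]
  exact h.2 t ht

lemma IsParameterPiece.strictMonoOn {φ : ℝ → ℝ} {a b : ℝ} (h : IsParameterPiece φ a b) :
    StrictMonoOn φ (Icc a b) := by
  refine strictMonoOn_of_deriv_pos (convex_Icc a b) h.1.continuousOn fun x hx => ?_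
  rw [← derivWithin_of_mem_nhds (mem_interior_iff_mem_nhds.1 hx)]
  exact h.2 x (interior_subset hx)

lemma isParameterChange_iff {φ : ℝ → ℝ} : IsParameterChange φ ↔
    ContinuousOn φ (Icc 0 1) ∧ φ 0 = 0 ∧ φ 1 = 1 ∧ PiecewiseOn (IsParameterPiece φ) := by
  refine and_congr_right fun _ => and_congr_right fun _ => and_congr_right fun _ => ?_
  constructor
  · rintro ⟨k, τ, hτ, h⟩
    exact hτ.piecewiseOn h fun a b a' b' hP ha hab hb => hP.subset ha hab hb
  · exact fun h => h.exists_partition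

lemma IsParameterChange.strictMonoOn {φ : ℝ → ℝ} (h : IsParameterChange φ) :
    StrictMonoOn φ (Icc 0 1) := by
  refine ((isParameterChange_iff.1 h).2.2.2.mono (Q := fun a b => StrictMonoOn φ (Icc a b))
    fun _ _ _ _ _ h => h.strictMonoOn).induction fun a m b _ ham hmb _ h1 h2 => ?_
  rw [← Icc_union_Icc_eq_Icc ham.le hmb.le]
  exact h1.union h2 (isGreatest_Icc ham.le) (isLeast_Icc hmb.le)

/-- A change of parameter extends to an order isomorphism of `ℝ`. -/
lemma IsParameterChange.exists_orderIso {φ : ℝ → ℝ} (h : IsParameterChange φ) :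
    ∃ Φ : ℝ ≃o ℝ, EqOn Φ φ (Icc 0 1) ∧ IsParameterChange Φ := by
  obtain ⟨hc, h0, h1, hP⟩ := isParameterChange_iff.1 h
  have hmono := h.strictMonoOn
  -- Extend by the identity outside `[0, 1]`, where both maps agree at 0 and 1.
  set f : ℝ → ℝ := fun t => if t ∈ Icc (0 : ℝ) 1 then φ t else t with hf
  have f1 : EqOn f φ (Icc 0 1) := fun t ht => if_pos ht
  have f2 : ∀ t, t ∉ Icc (0 : ℝ) 1 → f t = t := fun t ht => if_neg ht
  have hmaps : ∀ t ∈ Icc (0 : ℝ) 1, φ t ∈ Icc (0 : ℝ) 1 := fun t ht =>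
    ⟨h0 ▸ hmono.monotoneOn (left_mem_Icc.2 zero_le_one) ht ht.1,
      h1 ▸ hmono.monotoneOn ht (right_mem_Icc.2 zero_le_one) ht.2⟩
  have hfm : StrictMono f := by
    intro x y hxy
    by_cases hx : x ∈ Icc (0 : ℝ) 1
    · by_cases hy : y ∈ Icc (0 : ℝ) 1
      · rw [f1 hx, f1 hy]; exact hmono hx hy hxy
      · rw [f1 hx, f2 y hy]
        have : 1 < y := by
          by_contra hcon
          exact hy ⟨hx.1.trans hxy.le, not_lt.1 hcon⟩
        exact (hmaps x hx).2.trans_lt this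
    · by_cases hy : y ∈ Icc (0 : ℝ) 1
      · rw [f2 x hx, f1 hy]
        have : x < 0 := by
          by_contra hcon
          exact hx ⟨not_lt.1 hcon, hxy.le.trans hy.2⟩
        exact this.trans_le (hmaps y hy).1
      · rwa [f2 x hx, f2 y hy]
  have hfs : Function.Surjective f := by
    intro y
    by_cases hy : y ∈ Icc (0 : ℝ) 1
    · obtain ⟨t, ht, rfl⟩ := intermediate_value_Icc zero_le_one hc (by rwa [h0, h1])
      exact ⟨t, f1 ht⟩
    · exact ⟨y, f2 y hy⟩
  refine ⟨hfm.orderIsoOfSurjective f hfs, f1, ?_⟩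
  rw [StrictMono.coe_orderIsoOfSurjective]
  refine isParameterChange_iff.2 ⟨hc.congr f1, ?_, ?_, hP.mono fun a b ha hab hb h =>
    h.congr fun t ht => f1 (Icc_subset_Icc ha hb ht)⟩
  · rw [f1 (left_mem_Icc.2 zero_le_one), h0]
  · rw [f1 (right_mem_Icc.2 zero_le_one), h1]

lemma PiecewiseOn.comp_orderIso {P : ℝ → ℝ → Prop} (h : PiecewiseOn P) (Φ : ℝ ≃o ℝ) (h0 : Φ 0 = 0)
    (h1 : Φ 1 = 1) : PiecewiseOn fun a b => P (Φ a) (Φ b) := by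
  classical
  obtain ⟨S, hS⟩ := h
  refine ⟨S.image Φ.symm, fun a b ha hab hb hx => hS _ _ ?_ (Φ.strictMono hab) ?_ fun x hxS hxI => ?_⟩
  · rw [← h0]; exact Φ.monotone ha
  · rw [← h1]; exact Φ.monotone hb
  · refine hx _ (Finset.mem_image_of_mem _ hxS) ⟨Φ.lt_symm_apply.2 hxI.1, Φ.symm_apply_lt.2 hxI.2⟩

lemma orderIso_mapsTo_Icc (Φ : ℝ ≃o ℝ) (a b : ℝ) : MapsTo Φ (Icc a b) (Icc (Φ a) (Φ b)) :=
  fun _ ht => ⟨Φ.monotone ht.1, Φ.monotone ht.2⟩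

/-- The inverse satisfies ψ' = 1/Φ'(ψ), an autonomous equation with smooth right side, so the
bootstrap gives smoothness. -/
lemma IsParameterPiece.symm {Φ : ℝ ≃o ℝ} {a b : ℝ} (hab : a < b) (h : IsParameterPiece Φ a b) :
    IsParameterPiece Φ.symm (Φ a) (Φ b) := by
  have hmaps : MapsTo Φ.symm (Icc (Φ a) (Φ b)) (Icc a b) := by
    simpa using orderIso_mapsTo_Icc Φ.symm (Φ a) (Φ b)
  have hu := uniqueDiffOn_Icc (Φ.strictMono hab)
  have hd : ∀ t ∈ Icc (Φ a) (Φ b), HasDerivWithinAt Φ.symm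
      (derivWithin Φ (Icc a b) (Φ.symm t))⁻¹ (Icc (Φ a) (Φ b)) t := by
    intro t ht
    have h1 := h.hasDerivWithinAt (hmaps ht)
    have h2 : HasFDerivWithinAt Φ (ContinuousLinearEquiv.unitsEquivAut ℝ
        (Units.mk0 _ (h.2 _ (hmaps ht)).ne') : ℝ →L[ℝ] ℝ) (Icc a b) (Φ.symm t) := h1
    exact HasFDerivWithinAt.of_local_left_inverse
      ((Φ.symm.continuous.continuousWithinAt).tendsto_nhdsWithin hmaps) h2 ht
      (Filter.Eventually.of_forall Φ.apply_symm_apply)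
  have hH : ContDiffOn ℝ ∞ (fun t => (derivWithin Φ (Icc a b) t)⁻¹) (Icc a b) :=
    (h.1.derivWithin (uniqueDiffOn_Icc hab) (by simp)).inv fun t ht => (h.2 t ht).ne'
  refine ⟨contDiffOn_of_hasDerivWithinAt_comp hu hH hmaps hd, fun t ht => ?_⟩
  rw [(hd t ht).derivWithin (hu t ht)]
  exact inv_pos.2 (h.2 _ (hmaps ht))

lemma IsParameterChange.symm {Φ : ℝ ≃o ℝ} (h : IsParameterChange Φ) : IsParameterChange Φ.symm := by
  obtain ⟨-, h0, h1, hP⟩ := isParameterChange_iff.1 h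
  have h0' : Φ.symm 0 = 0 := by rw [OrderIso.symm_apply_eq, h0]
  have h1' : Φ.symm 1 = 1 := by rw [OrderIso.symm_apply_eq, h1]
  refine isParameterChange_iff.2 ⟨Φ.symm.continuous.continuousOn, h0', h1',
    (hP.comp_orderIso Φ.symm h0' h1').mono fun a b _ hab _ h => ?_⟩
  simpa using h.symm (Φ.symm.strictMono hab)

end ParameterChange

/-! ### Curves and variations under changes of parameter. -/

section Reparametrization

variable {n : ℕ} {M : Type*} [TopologicalSpace M] [ChartedSpace (Model n) M]

lemma velocity_comp {c : ℝ → M} {φ : ℝ → ℝ} {a b a' b' t : ℝ} (hab : a < b)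
    (hφ : DifferentiableWithinAt ℝ φ (Icc a b) t) (hmaps : MapsTo φ (Icc a b) (Icc a' b'))
    (ht : t ∈ Icc a b) (hc : MDifferentiableWithinAt 𝓘(ℝ, ℝ) (𝓡 n) c (Icc a' b') (φ t)) :
    velocity n (c ∘ φ) (Icc a b) t =
      derivWithin φ (Icc a b) t • velocity n c (Icc a' b') (φ t) := by
  unfold velocity
  rw [mfderivWithin_comp t hc hφ.mdifferentiableWithinAt hmaps
    (uniqueDiffOn_Icc hab t ht).uniqueMDiffWithinAt, mfderivWithin_eq_fderivWithin,
    ← fderivWithin_derivWithin]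
  have h : fderivWithin ℝ φ (Icc a b) t 1 = fderivWithin ℝ φ (Icc a b) t 1 • (1 : ℝ) := by simp
  change mfderivWithin 𝓘(ℝ, ℝ) (𝓡 n) c (Icc a' b') (φ t) (fderivWithin ℝ φ (Icc a b) t 1) = _
  exact (congrArg _ h).trans (map_smul (mfderivWithin 𝓘(ℝ, ℝ) (𝓡 n) c (Icc a' b') (φ t)) _ _)

variable [IsManifold (𝓡 n) ∞ M]

lemma IsRegularPiece.comp {c : ℝ → M} {Φ : ℝ ≃o ℝ} {a b : ℝ} (hab : a < b)
    (hΦ : IsParameterPiece Φ a b) (hc : IsRegularPiece n c (Φ a) (Φ b)) :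
    IsRegularPiece n (c ∘ Φ) a b := by
  have hm := orderIso_mapsTo_Icc Φ a b
  refine ⟨hc.1.comp (contMDiffOn_iff_contDiffOn.2 hΦ.1) hm, fun t ht => ?_⟩
  rw [velocity_comp hab (hΦ.hasDerivWithinAt ht).differentiableWithinAt hm ht
    (mdifferentiableWithinAt_of_mem hc.1 (hm ht))]
  exact smul_ne_zero (hΦ.2 t ht).ne' (hc.2 _ (hm ht))

lemma IsRegularPiece.speedOn_comp (F : FinslerMetric n M) {c : ℝ → M} {Φ : ℝ ≃o ℝ} {a b t : ℝ}
    (hab : a < b) (hΦ : IsParameterPiece Φ a b) (hc : IsRegularPiece n c (Φ a) (Φ b))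
    (ht : t ∈ Icc a b) :
    speedOn F (c ∘ Φ) a b t = derivWithin Φ (Icc a b) t * speedOn F c (Φ a) (Φ b) (Φ t) := by
  have hm := orderIso_mapsTo_Icc Φ a b
  have h1 := velocity_comp hab (hΦ.hasDerivWithinAt ht).differentiableWithinAt hm ht
    (mdifferentiableWithinAt_of_mem hc.1 (hm ht))
  unfold speedOn
  rw [h1]
  have h2 := F.homogeneous (c (Φ t)) (velocity n c (Icc (Φ a) (Φ b)) (Φ t))
    (derivWithin Φ (Icc a b) t)
  rw [abs_of_pos (hΦ.2 t ht)] at h2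
  exact h2

lemma pathSpace_comp {x₀ x₁ : M} {c : ℝ → M} (hc : c ∈ pathSpace n x₀ x₁) {Φ : ℝ ≃o ℝ}
    (hΦ : IsParameterChange Φ) : c ∘ Φ ∈ pathSpace n x₀ x₁ := by
  obtain ⟨hcc, hc0, hc1, hP⟩ := mem_pathSpace_iff.1 hc
  obtain ⟨-, h0, h1, hQ⟩ := isParameterChange_iff.1 hΦ
  have hm := orderIso_mapsTo_Icc Φ 0 1
  rw [h0, h1] at hm
  refine mem_pathSpace_iff.2 ⟨hcc.comp Φ.continuous.continuousOn hm, ?_, ?_,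
    (hQ.and (hP.comp_orderIso Φ h0 h1)).mono fun a b _ hab _ h => h.2.comp hab h.1⟩
  · rw [Function.comp_apply, h0, hc0]
  · rw [Function.comp_apply, h1, hc1]

lemma IsVariation.comp {x₀ x₁ : M} {c : ℝ → M} {ε : ℝ} {α : ℝ → ℝ → M}
    (h : IsVariation n x₀ x₁ c ε α) {Φ : ℝ ≃o ℝ} (hΦ : IsParameterChange Φ) :
    IsVariation n x₀ x₁ (c ∘ Φ) ε fun s => α s ∘ Φ := by
  obtain ⟨hε, hα, hΩ, hcont, hP⟩ := isVariation_iff.1 h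
  obtain ⟨-, h0, h1, hQ⟩ := isParameterChange_iff.1 hΦ
  have hm := orderIso_mapsTo_Icc Φ 0 1
  rw [h0, h1] at hm
  refine isVariation_iff.2 ⟨hε, fun t ht => hα _ (hm ht), fun s hs => pathSpace_comp (hΩ s hs) hΦ,
    hcont.comp (f := fun q : ℝ × ℝ => (q.1, Φ q.2))
      (continuous_fst.prodMk (Φ.continuous.comp continuous_snd)).continuousOn
      fun q hq => ⟨hq.1, hm hq.2⟩,
    (hQ.and (hP.comp_orderIso Φ h0 h1)).mono fun a b _ hab _ h => ?_⟩
  have h2 : ContDiffOn ℝ ∞ (fun q : ℝ × ℝ => (q.1, Φ q.2)) (strip ε a b) :=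
    contDiffOn_fst.prodMk (h.1.1.comp contDiffOn_snd fun q hq => hq.2)
  exact h.2.comp (contMDiffOn_iff_contDiffOn.2 h2) fun q hq => ⟨hq.1, orderIso_mapsTo_Icc Φ a b hq.2⟩

end Reparametrization

/-! ### The length functional -/

section Length

variable {n : ℕ} {M : Type*} [TopologicalSpace M] [ChartedSpace (Model n) M]
  [IsManifold (𝓡 n) ∞ M] (F : FinslerMetric n M)

lemma IsRegularPiece.contDiffOn_speedOn {c : ℝ → M} {a b : ℝ} (h : IsRegularPiece n c a b)
    (hab : a < b) : ContDiffOn ℝ ∞ (speedOn F c a b) (Icc a b) := by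
  have h1 : ContMDiffOn 𝓘(ℝ, ℝ × ℝ) (𝓡 n) ∞ (fun q : ℝ × ℝ => c q.2) (strip 1 a b) :=
    h.1.comp (contMDiff_iff_contDiff.2 contDiff_snd).contMDiffOn fun q hq => hq.2
  exact (contDiffOn_speedOn_strip F hab (α := fun _ => c) h1 fun _ _ => h).comp
    (f := fun t : ℝ => ((0 : ℝ), t)) (by fun_prop) fun t ht => ⟨by simp, ht⟩

lemma IsRegularPiece.intervalIntegrable_speed {c : ℝ → M} {a b : ℝ} (h : IsRegularPiece n c a b)
    (ha : 0 ≤ a) (hab : a < b) (hb : b ≤ 1) :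
    IntervalIntegrable (speed F c) MeasureTheory.volume a b := by
  have h1 := (h.contDiffOn_speedOn F hab).continuousOn
  rw [← uIcc_of_le hab.le] at h1
  refine h1.intervalIntegrable.congr_uIoo ?_
  rw [uIoo_of_le hab.le]
  exact fun t ht => speedOn_eq_speed F ha hb ht

lemma intervalIntegrable_speed_of_mem_pathSpace {x₀ x₁ : M} {c : ℝ → M}
    (hc : c ∈ pathSpace n x₀ x₁) {l r : ℝ} (hl : l ∈ Icc (0 : ℝ) 1) (hr : r ∈ Icc (0 : ℝ) 1) :
    IntervalIntegrable (speed F c) MeasureTheory.volume l r := by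
  have h : IntervalIntegrable (speed F c) MeasureTheory.volume 0 1 :=
    ((mem_pathSpace_iff.1 hc).2.2.2.mono fun _ _ ha hab hb h =>
      h.intervalIntegrable_speed F ha hab hb).induction fun _ _ _ _ _ _ _ h1 h2 => h1.trans h2
  refine h.mono_set ?_
  rw [uIcc_of_le zero_le_one]
  exact uIcc_subset_Icc hl hr

/-- By homogeneity the speed of c ∘ Φ is Φ' times the speed of c at Φ; substitution on each piece
then gives invariance of length. -/
lemma pEnergy_one_comp {x₀ x₁ : M} {c : ℝ → M} (hc : c ∈ pathSpace n x₀ x₁) {Φ : ℝ ≃o ℝ}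
    (hΦ : IsParameterChange Φ) : pEnergy F 1 (c ∘ Φ) = pEnergy F 1 c := by
  obtain ⟨-, -, -, hP⟩ := mem_pathSpace_iff.1 hc
  obtain ⟨-, h0, h1, hQ⟩ := isParameterChange_iff.1 hΦ
  have hcI := @intervalIntegrable_speed_of_mem_pathSpace _ _ _ _ _ F _ _ _ hc
  have hcΦI := @intervalIntegrable_speed_of_mem_pathSpace _ _ _ _ _ F _ _ _ (pathSpace_comp hc hΦ)
  rw [pEnergy_eq F hc, pEnergy_eq F (pathSpace_comp hc hΦ)]
  simp only [Real.rpow_one]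
  have hle : ∀ {t}, t ∈ Icc (0 : ℝ) 1 → Φ t ∈ Icc (0 : ℝ) 1 := fun {t} ht => by
    have := orderIso_mapsTo_Icc Φ 0 1 ht
    rwa [h0, h1] at this
  have key := ((hQ.and (hP.comp_orderIso Φ h0 h1)).mono (Q := fun a b =>
      ∫ t in a..b, speed F (c ∘ Φ) t = ∫ t in Φ a..Φ b, speed F c t)
    fun a b ha hab hb h => by
      obtain ⟨hΦp, hreg⟩ := h
      have hΦa := hle ⟨ha, hab.le.trans hb⟩
      have hΦb := hle ⟨ha.trans hab.le, hb⟩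
      rw [← intervalIntegral.integral_comp_mul_deriv_of_deriv_nonneg (f := Φ)
        (f' := derivWithin Φ (Icc a b)) Φ.continuous.continuousOn]
      · refine intervalIntegral.integral_congr_Ioo_of_le hab.le fun t ht => ?_
        have ht' := Ioo_subset_Icc_self ht
        have htΦ : Φ t ∈ Ioo (Φ a) (Φ b) := ⟨Φ.strictMono ht.1, Φ.strictMono ht.2⟩
        rw [← speedOn_eq_speed F ha hb ht, hreg.speedOn_comp F hab hΦp ht',
          speedOn_eq_speed F hΦa.1 hΦb.2 htΦ, mul_comm]
        rfl
      · rw [min_eq_left hab.le, max_eq_right hab.le]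
        exact fun t ht => (hΦp.hasDerivWithinAt (Ioo_subset_Icc_self ht)).hasDerivAt
          (Icc_mem_nhds ht.1 ht.2)
      · rw [min_eq_left hab.le, max_eq_right hab.le]
        exact fun t ht => (hΦp.2 t (Ioo_subset_Icc_self ht)).le).induction
    fun a m b ha ham hmb hb k1 k2 => by
      have ham' : a ∈ Icc (0 : ℝ) 1 := ⟨ha, by linarith⟩
      have hm' : m ∈ Icc (0 : ℝ) 1 := ⟨by linarith, by linarith⟩
      have hb' : b ∈ Icc (0 : ℝ) 1 := ⟨by linarith, hb⟩
      rw [← intervalIntegral.integral_add_adjacent_intervals (hcΦI ham' hm') (hcΦI hm' hb'),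
        ← intervalIntegral.integral_add_adjacent_intervals (hcI (hle ham') (hle hm'))
          (hcI (hle hm') (hle hb')), k1, k2]
  rw [key, h0, h1]

variable {F}

lemma IsCriticalPoint.congr {p : ℝ} {x₀ x₁ : M} {c c' : ℝ → M} (h : IsCriticalPoint F p x₀ x₁ c)
    (heq : ∀ t ∈ Icc (0 : ℝ) 1, c' t = c t) : IsCriticalPoint F p x₀ x₁ c' :=
  fun ε α hα => h ε α ⟨hα.1, fun t ht => (hα.2.1 t ht).trans (heq t ht), hα.2.2⟩

/-- Critical points of the length functional are invariant under changes of parameter. -/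
lemma IsCriticalPoint.comp {x₀ x₁ : M} {c : ℝ → M} (h : IsCriticalPoint F 1 x₀ x₁ c) {Φ : ℝ ≃o ℝ}
    (hΦ : IsParameterChange Φ) : IsCriticalPoint F 1 x₀ x₁ (c ∘ Φ) := by
  intro ε α hα
  -- A variation of c ∘ Φ, composed with Φ⁻¹, is a variation of c through curves of the same length.
  have h1 := hα.comp hΦ.symm
  have h2 : (c ∘ Φ) ∘ Φ.symm = c := by funext t; simp
  rw [h2] at h1
  refine (h ε _ h1).congr_of_eventuallyEq ?_
  filter_upwards [isOpen_Ioo.mem_nhds (⟨by linarith [hα.1], hα.1⟩ : (0 : ℝ) ∈ Ioo (-ε) ε)] with s hs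
  exact (pEnergy_one_comp F (hα.2.2.1 s hs) hΦ.symm).symm

theorem IsReparametrizedGeodesic.isCriticalPoint {c : ℝ → M} (h : IsReparametrizedGeodesic F c)
    (x₀ x₁ : M) : IsCriticalPoint F 1 x₀ x₁ c := by
  obtain ⟨γ, φ, hγ, hφ, hc⟩ := h
  obtain ⟨Φ, hΦφ, hΦ⟩ := hφ.exists_orderIso
  refine ((hγ.isCriticalPoint 1).comp hΦ).congr fun t ht => ?_
  rw [hc t ht, Function.comp_apply, hΦφ ht]

lemma hasDerivWithinAt_integral_Icc {f : ℝ → ℝ} {a b t : ℝ} (hf : ContinuousOn f (Icc a b))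
    (ht : t ∈ Icc a b) : HasDerivWithinAt (fun x => ∫ r in a..x, f r) (f t) (Icc a b) t := by
  have hab : a ≤ b := ht.1.trans ht.2
  -- The constant extension beyond a and b is continuous on ℝ, which yields one-sided derivatives at
  -- the end points.
  have hg : Continuous (IccExtend hab ((Icc a b).domRestrict f)) :=
    (continuousOn_iff_continuous_domRestrict.1 hf).Icc_extend'
  have hfg : ∀ r ∈ Icc a b, IccExtend hab ((Icc a b).domRestrict f) r = f r := fun r hr => by
    rw [IccExtend_of_mem _ _ hr]; rfl
  have h1 := (hg.integral_hasStrictDerivAt a t).hasDerivAt.hasDerivWithinAt (s := Icc a b)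
  rw [hfg t ht] at h1
  refine h1.congr_of_mem (fun x hx => ?_) ht
  refine intervalIntegral.integral_congr fun r hr => (hfg r ?_).symm
  rw [uIcc_of_le hx.1] at hr
  exact ⟨hr.1, hr.2.trans hx.2⟩

variable (F) in
/-- The normalized arc length parameter. -/
def arcLength (c : ℝ → M) (t : ℝ) : ℝ := (∫ r in (0 : ℝ)..t, speed F c r) / ∫ r in (0 : ℝ)..1, speed F c r

lemma integral_speed_pos {x₀ x₁ : M} {c : ℝ → M} (hc : c ∈ pathSpace n x₀ x₁) :
    0 < ∫ r in (0 : ℝ)..1, speed F c r := by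
  refine ((mem_pathSpace_iff.1 hc).2.2.2.mono (Q := fun a b => IntervalIntegrable (speed F c)
    MeasureTheory.volume a b ∧ 0 < ∫ r in a..b, speed F c r) fun a b ha hab hb h => ?_).induction
    (fun a m b _ _ _ _ h1 h2 => ⟨h1.1.trans h2.1, ?_⟩) |>.2
  · have h1 := h.intervalIntegrable_speed F ha hab hb
    refine ⟨h1, intervalIntegral.intervalIntegral_pos_of_pos_on h1 (fun t ht => ?_) hab⟩
    rw [← speedOn_eq_speed F ha hb ht]
    exact h.speedOn_pos F (Ioo_subset_Icc_self ht)
  · rw [← intervalIntegral.integral_add_adjacent_intervals h1.1 h2.1]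
    exact add_pos h1.2 h2.2

lemma IsRegularPiece.hasDerivWithinAt_arcLength {x₀ x₁ : M} {c : ℝ → M}
    (hc : c ∈ pathSpace n x₀ x₁) {a b t : ℝ} (ha : 0 ≤ a)
    (hab : a < b) (hb : b ≤ 1) (h : IsRegularPiece n c a b) (ht : t ∈ Icc a b) :
    HasDerivWithinAt (arcLength F c) (speedOn F c a b t / ∫ r in (0 : ℝ)..1, speed F c r)
      (Icc a b) t := by
  have h1 := hasDerivWithinAt_integral_Icc (h.contDiffOn_speedOn F hab).continuousOn ht
  refine ((h1.const_add (∫ r in (0 : ℝ)..a, speed F c r)).div_const _).congr_of_mem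
    (fun x hx => ?_) ht
  have ha' : a ∈ Icc (0 : ℝ) 1 := ⟨ha, hab.le.trans hb⟩
  rw [arcLength, ← intervalIntegral.integral_add_adjacent_intervals (b := a)
    (intervalIntegrable_speed_of_mem_pathSpace F hc (left_mem_Icc.2 zero_le_one) ha')
    (intervalIntegrable_speed_of_mem_pathSpace F hc ha' ⟨ha.trans hx.1, hx.2.trans hb⟩),
    intervalIntegral.integral_congr_Ioo_of_le hx.1 fun r hr =>
      (speedOn_eq_speed F ha hb ⟨hr.1, hr.2.trans_le hx.2⟩).symm]

lemma IsRegularPiece.isParameterPiece_arcLength {x₀ x₁ : M} {c : ℝ → M}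
    (hc : c ∈ pathSpace n x₀ x₁) {a b : ℝ} (ha : 0 ≤ a)
    (hab : a < b) (hb : b ≤ 1) (h : IsRegularPiece n c a b) :
    IsParameterPiece (arcLength F c) a b ∧ ∀ t ∈ Icc a b, derivWithin (arcLength F c) (Icc a b) t =
      speedOn F c a b t / ∫ r in (0 : ℝ)..1, speed F c r := by
  have hu := uniqueDiffOn_Icc hab
  have hd := fun t ht => h.hasDerivWithinAt_arcLength (F := F) hc ha hab hb (t := t) ht
  have hd' : ∀ t ∈ Icc a b, derivWithin (arcLength F c) (Icc a b) t =
      speedOn F c a b t / ∫ r in (0 : ℝ)..1, speed F c r := fun t ht => (hd t ht).derivWithin (hu t ht)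
  refine ⟨⟨(contDiffOn_infty_iff_derivWithin hu).2 ⟨fun t ht => (hd t ht).differentiableWithinAt,
    ((h.contDiffOn_speedOn F hab).div_const _).congr hd'⟩, fun t ht => ?_⟩, hd'⟩
  rw [hd' t ht]
  exact div_pos (h.speedOn_pos F ht) (integral_speed_pos hc)

lemma isParameterChange_arcLength {x₀ x₁ : M} {c : ℝ → M} (hc : c ∈ pathSpace n x₀ x₁) :
    IsParameterChange (arcLength F c) := by
  have hP := (mem_pathSpace_iff.1 hc).2.2.2
  have hI := intervalIntegrable_speed_of_mem_pathSpace F hc (left_mem_Icc.2 zero_le_one)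
    (right_mem_Icc.2 zero_le_one)
  refine isParameterChange_iff.2 ⟨?_, by simp [arcLength], div_self (integral_speed_pos hc).ne',
    hP.mono fun a b ha hab hb h => (h.isParameterPiece_arcLength hc ha hab hb).1⟩
  rw [← uIcc_of_le zero_le_one]
  exact (intervalIntegral.continuousOn_primitive_interval' hI (by simp)).div_const _

end Length

/-! ### Critical points of length are reparametrized geodesics. -/

section LengthCritical

variable {n : ℕ} {M : Type*} [TopologicalSpace M] [ChartedSpace (Model n) M]
  [IsManifold (𝓡 n) ∞ M] {F : FinslerMetric n M}

/-- A critical point of the length functional with constant speed is critical for all energies. -/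
lemma IsCriticalPoint.of_speed_eq {x₀ x₁ : M} {c : ℝ → M} (h : IsCriticalPoint F 1 x₀ x₁ c) {l : ℝ}
    (hl : PiecewiseOn fun a b => ∀ t ∈ Ioo a b, speed F c t = l) (p : ℝ) :
    IsCriticalPoint F p x₀ x₁ c := by
  rw [isCriticalPoint_iff] at h ⊢
  intro ε α hα
  obtain ⟨S, hS⟩ := hl.exists_finset
  -- The density of E_p is p F^(p-1) times that of E_1, a constant factor where the speed is l,
  -- hence almost everywhere.
  have key : ∫ t in (0 : ℝ)..1, variationDensity F p α t =
      ∫ t in (0 : ℝ)..1, p * l ^ (p - 1) * variationDensity F 1 α t := by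
    apply intervalIntegral.integral_congr_ae
    have h1 : ∀ᵐ t ∂(MeasureTheory.volume : MeasureTheory.Measure ℝ),
        t ∉ insert (1 : ℝ) (S : Set ℝ) := ((S.finite_toSet.insert 1).countable).ae_notMem _
    filter_upwards [h1] with t ht htI
    rw [uIoc_of_le zero_le_one] at htI
    have ht1 : t ≠ 1 := fun h => ht (by simp [h])
    obtain ⟨a, b, -, -, htab, hsp⟩ := hS t ⟨htI.1, lt_of_le_of_ne htI.2 ht1⟩
      fun h => ht (by simp [h])
    have h2 : speed F (α 0) t = l :=
      (speedOn_congr F hα.2.1 (Ioc_subset_Icc_self htI)).trans (hsp t htab)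
    simp [variationDensity, h2]
  rw [key, intervalIntegral.integral_const_mul, h ε α hα, mul_zero]

lemma IsCriticalPoint.isReparametrizedGeodesic {x₀ x₁ : M} {c : ℝ → M}
    (h : IsCriticalPoint F 1 x₀ x₁ c) (hc : c ∈ pathSpace n x₀ x₁) :
    IsReparametrizedGeodesic F c := by
  obtain ⟨Φ, hΦe, hΦ⟩ := (isParameterChange_arcLength (F := F) hc).exists_orderIso
  have hΨ := hΦ.symm
  obtain ⟨-, h0, h1, -⟩ := isParameterChange_iff.1 hΨ
  set γ := c ∘ Φ.symm with hγ
  have hγΦ : γ ∘ Φ = c := by funext t; simp [hγ]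
  have hsp := ((mem_pathSpace_iff.1 hc).2.2.2.mono (Q := fun a b => ∀ t ∈ Ioo (Φ a) (Φ b),
      speed F γ t = ∫ r in (0 : ℝ)..1, speed F c r) fun a b ha hab hb hreg t ht => by
    obtain ⟨hp, hd⟩ := hreg.isParameterPiece_arcLength (F := F) hc ha hab hb
    have heq : EqOn Φ (arcLength F c) (Icc a b) := hΦe.mono (Icc_subset_Icc ha hb)
    have hΦp : IsParameterPiece Φ a b := hp.congr heq
    have hγreg : IsRegularPiece n γ (Φ a) (Φ b) :=
      IsRegularPiece.comp (Φ.strictMono hab) (hΦp.symm hab) (by simpa using hreg)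
    obtain ⟨r, rfl⟩ := Φ.surjective t
    have hr : r ∈ Icc a b := ⟨(Φ.lt_iff_lt.1 ht.1).le, (Φ.lt_iff_lt.1 ht.2).le⟩
    -- The speed of c is Φ' times that of γ, while Φ' is the speed of c divided by the total length;
    -- hence γ has constant speed equal to the length.
    have k1 := hγreg.speedOn_comp F hab hΦp hr
    rw [hγΦ, derivWithin_congr heq (heq hr), hd r hr] at k1
    have k2 := hreg.speedOn_pos F hr
    have k3 := integral_speed_pos (F := F) hc
    have hΦ0 : 0 ≤ Φ a := by
      rw [← (isParameterChange_iff.1 hΦ).2.1]; exact Φ.monotone ha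
    have hΦ1 : Φ b ≤ 1 := by
      rw [← (isParameterChange_iff.1 hΦ).2.2.1]; exact Φ.monotone hb
    rw [← speedOn_eq_speed F hΦ0 hΦ1 ht]
    field_simp at k1
    exact k1.symm).comp_orderIso Φ.symm h0 h1
  simp only [OrderIso.apply_symm_apply] at hsp
  -- The exponent 2 is one choice other than 0 and 1, for which critical points are already known to
  -- be geodesics.
  exact ⟨γ, Φ, ((h.comp hΨ).of_speed_eq hsp 2).isGeodesic two_ne_zero (by norm_num)
    (pathSpace_comp hc hΨ), hΦ, fun t _ => (congrFun hγΦ t).symm⟩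

end LengthCritical

end FinslerEnergy

end

theorem mainTheorem7 {n : ℕ} {M : Type*} [TopologicalSpace M] [T2Space M] [ConnectedSpace M]
    [ChartedSpace (FinslerEnergy.Model n) M] [IsManifold (𝓡 n) ∞ M]
    (F : FinslerEnergy.FinslerMetric n M) (x₀ x₁ : M) (p : ℝ) (hp : p ≠ 0)
    (c : ℝ → M) (hc : c ∈ FinslerEnergy.pathSpace n x₀ x₁) :
    (p ≠ 1 →
      (FinslerEnergy.IsCriticalPoint F p x₀ x₁ c ↔ FinslerEnergy.IsGeodesic F c)) ∧
    (p = 1 →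
      (FinslerEnergy.IsCriticalPoint F p x₀ x₁ c ↔
        FinslerEnergy.IsReparametrizedGeodesic F c)) := by
  refine ⟨fun hp1 => ⟨fun h => h.isGeodesic hp hp1 hc, fun h => h.isCriticalPoint p⟩, fun hp1 => ?_⟩
  subst hp1
  exact ⟨fun h => h.isReparametrizedGeodesic hc, fun h => h.isCriticalPoint x₀ x₁⟩
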